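/- Theorem 3.5 (Maximal Grassmannian I, type $D$). **Partitions.** Let $n\ge 1$. For $m\ge 0$ put $\rho_m=(m,m-1,\dots,1)$ and let $\mathcal D_m$ be the set of strict partitions with parts in $\{1,\dots,m\}$; unions, intersections and differences of strict partitions are those of their sets of parts, $\ell(\lambda)$ is the number of parts, $|\lambda|$ their sum, and $\lambda_r=0$ for $r>\ell(\lambda)$. Let $\mathcal D_{n-1}^+$ be the set of strictly decreasing sequences $\beta$ of elements of $\{0,1,\dots,n-1\}$, with $\ell(\beta)$ the number of terms (a term $0$ counts) and $\beta_r=0$ for $r>\ell(\beta)$. Write $\beta\supset\mu$ if $\beta_i\ge\mu_i$ for all $i$, and $\mu'=\rho_{n-1}\smallsetminus\mu$, a zero term of $\mu$ being ignored. **Polynomials.** Let $X=(x_1,\dots,x_n)$, $Y=(y_1,\dots,y_n)$ and $Y_m=(y_1,\dots,y_m)$, and let $e_r$ be the $r$-th elementary symmetric polynomial ($e_r=0$ for $r<0$). Put $\widetilde Q_i(X)=e_i(X)$ and $\widetilde Q_{i,j}=\widetilde Q_i\widetilde Q_j+2\sum_{k=1}^{j}(-1)^k\widetilde Q_{i+k}\widetilde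 Q_{j-k}$. For a strict partition $\lambda$ let $r$ be the even one of $\ell(\lambda),\ell(\lambda)+1$, and put $\widetilde Q_\lambda=\mathrm{Pfaffian}[\widetilde Q_{\lambda_i,\lambda_j}]_{1\le i<j\le r}$ and $\widetilde P_\lambda=2^{-\ell(\lambda)}\widetilde Q_\lambda$. Let $$\widetilde P_{n-1}(X,Y)=\sum_{\mu\in\mathcal D_{n-1}}\widetilde P_\mu(X)\,\widetilde P_{\mu'}(Y),\qquad \Delta(X,Y)=\prod_{i,j\ge1,\ i+j\le n}(x_i-y_j).$$ **Weyl group.** Let $\widetilde W_n$ be the group of barred (signed) permutations of $\{1,\dots,n\}$ with an even number of bars. The product is composition, and elements are written in one-line notation. It is generated by $s_i$ ($1\le i\le n-1$), which exchanges $i$ and $i+1$, and, if $n\ge2$, $s_\Box=(\overline2,\overline1,3,\dots,n)$. On $\mathbb Z[1/2][X,Y]$ the generator $s_i$ exchanges $x_i$ and $x_{i+1}$, and $s_\Box$ sends $(x_1,x_2)$ to $(-x_2,-x_1)$; all other variables are fixed. Put $$\partial'_i f=-\frac{f-s_if}{x_i-x_{i+1}},\qquad \partial'_\Box f=\frac{f-s_\Box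 f}{x_1+x_2},$$ and $\partial'_w=\partial'_{a_1}\circ\cdots\circ\partial'_{a_r}$ for a reduced decomposition $w=s_{a_1}\cdots s_{a_r}$ (this does not depend on the decomposition). Let $\widetilde w_0=(\overline1,\dots,\overline n)$ if $n$ is even and $(1,\overline2,\dots,\overline n)$ if $n$ is odd. The type $D$ double Schubert polynomial of $w\in\widetilde W_n$ is $$\mathfrak D_w(X,Y)=(-1)^{n(n-1)/2}\,\partial'_{w^{-1}\widetilde w_0}\bigl(\Delta(X,Y)\,\widetilde P_{n-1}(X,Y)\bigr).$$ For $\lambda\in\mathcal D_{n-1}$ with $\ell=\ell(\lambda)$ put $\mathfrak D_\lambda=\mathfrak D_{w_\lambda}$, where $$w_\lambda=(\overline{\lambda_1+1},\dots,\overline{\lambda_\ell+1},\widehat1,\mu_{n-\ell-1},\dots,\mu_1),$$ $\mu_1>\dots>\mu_{n-\ell-1}$ are the elements of $\{1,\dots,n\}\smallsetminus\{\lambda_1+1,\dots,\lambda_\ell+1,1\}$, and $\widehat1$ is $\overline1$ if $\ell$ is odd and $1$ if $\ell$ is even. **Exponents.** Let $e(\lambda)=|\lambda|-\ell(\ell+1)/2$.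 If $n\equiv\ell\pmod2$ put $k=n-\ell$ and $f(\lambda)=e(\lambda)+\ell$; otherwise put $k=n-\ell-1$ and $f(\lambda)=e(\lambda)$. For $\alpha\in\mathcal D_{n-1}$ and $\beta\in\mathcal D_{n-1}^+$ let $$f(\alpha,\beta)=\sum_{i=1}^{\ell(\alpha)} i\cdot\#\{j\le\ell(\beta)\mid\alpha_i>\beta_j\ge\alpha_{i+1}\}.$$ **Theorem.** For every $n\ge1$ and every $\lambda\in\mathcal D_{n-1}$, $$\mathfrak D_\lambda(X,Y)=(-1)^{f(\lambda)+|\lambda'|}\sum_{\alpha}\widetilde P_\alpha(X)\sum_{\beta}(-1)^{f(\alpha,\beta)+|\beta|}\,\widetilde P_{(\alpha\cup\beta)'}(Y)\,\det\bigl(e_{\beta_i-\lambda'_j}(Y_{n-1-\lambda'_j})\bigr)_{1\le i,j\le k},$$ where the first sum is over all $\alpha\in\mathcal D_{n-1}$ and the second over all $\beta\in\mathcal D^+_{n-1}$ with $\beta\supset\lambda'$, $\ell(\beta)=k$ and $\alpha\cap\beta=\emptyset$. -/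

import Mathlib

noncomputable section

namespace TypeD

open Finset

/-! ### Strict partitions

A strict partition is identified with the finite set of its nonzero parts; unions, intersections and
complements of strict partitions are then those of the sets of parts. -/

/-- `𝒟_m`: the strict partitions with parts in `{1, …, m}`. -/
def strictPartitions (m : ℕ) : Finset (Finset ℕ) := (Icc 1 m).powerset

/-- `𝒟⁺_m`: the strictly decreasing sequences of elements of `{0, 1, …, m}`, each identified with
the set of its terms. The length of such a sequence is the cardinality (a term `0` counts). -/
def strictPartitionsPlus (m : ℕ) : Finset (Finset ℕ) := (range (m + 1)).powerset

/-- The `i`-th term, counted from `i = 0`, of the decreasing sequence with set of terms `s`;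
it is `0` beyond the last term. -/
def part (s : Finset ℕ) (i : ℕ) : ℕ := (s.sort (· ≥ ·)).getD i 0

/-- The weight: the sum of the parts. -/
def weight (s : Finset ℕ) : ℕ := ∑ p ∈ s, p

/-- The dual partition `ρ_m ∖ s`. A term `0` of `s` plays no role. -/
def dual (m : ℕ) (s : Finset ℕ) : Finset ℕ := Icc 1 m \ s

/-- Containment `μ ⊂ β` of diagrams. -/
def DiagramLE (μ β : Finset ℕ) : Prop := ∀ i, part μ i ≤ part β i

instance : DecidableRel DiagramLE := fun _ _ => Classical.propDecidable _

/-- The excess `e(μ) = |μ| - (1 + ⋯ + ℓ(μ))`, a nonnegative integer when `μ` is strict. -/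
def excess (μ : Finset ℕ) : ℕ := weight μ - ∑ i ∈ Icc 1 μ.card, i

/-- `f(α, β) = ∑_{i = 1}^{ℓ(α)} i · #{j | α_i > β_j ≥ α_{i+1}}` (here `i` starts at `0`). -/
def intertwine (α β : Finset ℕ) : ℕ :=
  ∑ i ∈ range α.card, (i + 1) * #{b ∈ β | b < part α i ∧ part α (i + 1) ≤ b}

/-- `f(μ)`, which depends on the rank `n`. -/
def signExponent (n : ℕ) (μ : Finset ℕ) : ℕ :=
  if n ≡ μ.card [MOD 2] then excess μ + μ.card else excess μ

/-- The even one of the two numbers `n - ℓ(μ)` and `n - ℓ(μ) - 1`. -/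
def evenColength (n : ℕ) (μ : Finset ℕ) : ℕ :=
  if n ≡ μ.card [MOD 2] then n - μ.card else n - μ.card - 1

/-! ### Polynomials -/

/-- The Pfaffian of a triangular array `A i j`, `i < j`, of even size `2 m`, by expansion along
the first row. -/
def pfaffian {R : Type*} [CommRing R] : (m : ℕ) → (Fin (2 * m) → Fin (2 * m) → R) → R
  | 0, _ => 1
  | m + 1, A => ∑ j : Fin (2 * m + 1), (-1) ^ (j : ℕ) * A 0 j.succ *
      pfaffian m (fun a b => A (j.succAbove a).succ (j.succAbove b).succ)

/-- `Q̃_i = e_i`, the elementary symmetric polynomial in the variables `v`. -/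
def Qone {R : Type*} [CommRing R] {n : ℕ} (v : Fin n → R) (i : ℕ) : R :=
  (univ.val.map v).esymm i

/-- `Q̃_{i,j} = Q̃_i Q̃_j + 2 ∑_{k = 1}^j (-1)^k Q̃_{i+k} Q̃_{j-k}`. -/
def Qtwo {R : Type*} [CommRing R] {n : ℕ} (v : Fin n → R) (i j : ℕ) : R :=
  Qone v i * Qone v j + 2 * ∑ k ∈ Icc 1 j, (-1) ^ k * (Qone v (i + k) * Qone v (j - k))

/-- `Q̃_μ` for a strict partition `μ`, as a Pfaffian whose size is the length of `μ`
rounded up to an even number. -/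
def Qtilde {R : Type*} [CommRing R] {n : ℕ} (v : Fin n → R) (μ : Finset ℕ) : R :=
  pfaffian ((μ.card + 1) / 2) (fun i j => Qtwo v (part μ i) (part μ j))

/-- The ring `ℤ[1/2]`. -/
def ZHalf : Type := Localization.Away (2 : ℤ)

instance : CommRing ZHalf := inferInstanceAs (CommRing (Localization.Away (2 : ℤ)))

instance : Algebra ℤ ZHalf := inferInstanceAs (Algebra ℤ (Localization.Away (2 : ℤ)))

instance : IsLocalization.Away (2 : ℤ) ZHalf :=
  inferInstanceAs (IsLocalization.Away (2 : ℤ) (Localization.Away (2 : ℤ)))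

/-- The ring `ℤ[1/2][X, Y]` with `X = (x_1, …, x_n)` and `Y = (y_1, …, y_n)`. -/
abbrev PolyXY (n : ℕ) : Type := MvPolynomial (Fin n ⊕ Fin n) ZHalf

/-- The variables `X`; `xvar i` is `x_{i+1}`. -/
def xvar {n : ℕ} (i : Fin n) : PolyXY n := MvPolynomial.X (Sum.inl i)

/-- The variables `Y`; `yvar i` is `y_{i+1}`. -/
def yvar {n : ℕ} (i : Fin n) : PolyXY n := MvPolynomial.X (Sum.inr i)

/-- `P̃_μ = 2^{-ℓ(μ)} Q̃_μ`. -/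
def Ptilde {n : ℕ} (v : Fin n → PolyXY n) (μ : Finset ℕ) : PolyXY n :=
  MvPolynomial.C (IsLocalization.Away.invSelf (2 : ℤ) ^ μ.card) * Qtilde v μ

/-- The reproducing kernel `P̃_k(X, Y) = ∑_{μ ∈ 𝒟_k} P̃_μ(X) P̃_{ρ_k ∖ μ}(Y)`. -/
def PtildeKernel (n k : ℕ) : PolyXY n :=
  ∑ μ ∈ strictPartitions k, Ptilde xvar μ * Ptilde yvar (dual k μ)

/-- `Δ(X, Y) = ∏_{i + j ≤ n} (x_i - y_j)`, where `i, j ≥ 1`. -/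
def Delta (n : ℕ) : PolyXY n :=
  ∏ p : Fin n × Fin n with (p.1 : ℕ) + 1 + ((p.2 : ℕ) + 1) ≤ n, (xvar p.1 - yvar p.2)

/-- `e_r(Y_m)` with `Y_m = (y_1, …, y_m)`, for an integer `r`; it is `0` for `r < 0`. -/
def elemY (n m : ℕ) (r : ℤ) : PolyXY n :=
  if 0 ≤ r then
    (({i : Fin n | (i : ℕ) < m} : Finset (Fin n)).val.map yvar).esymm r.toNat
  else 0

/-! ### Barred permutations and the Weyl group of type `D` -/

/-- A barred permutation of `{1, …, n}`: the entry in position `i` of its one-line notation has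
absolute value `perm i` (shifted to `Fin n`), and is barred when `sign i = -1`. -/
@[ext]
structure BarredPerm (n : ℕ) where
  perm : Equiv.Perm (Fin n)
  sign : Fin n → ℤˣ

namespace BarredPerm

variable {n : ℕ}

/-- The product is composition: `(w v)(i) = w(v(i))`, where `w` of a barred entry is the bar
of `w` of that entry. -/
instance : Mul (BarredPerm n) :=
  ⟨fun w v => ⟨w.perm * v.perm, fun i => v.sign i * w.sign (v.perm i)⟩⟩

instance : One (BarredPerm n) := ⟨⟨1, fun _ => 1⟩⟩

instance : Inv (BarredPerm n) := ⟨fun w => ⟨w.perm⁻¹, fun i => (w.sign (w.perm⁻¹ i))⁻¹⟩⟩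

theorem mul_perm (w v : BarredPerm n) : (w * v).perm = w.perm * v.perm := rfl

theorem mul_sign (w v : BarredPerm n) (i : Fin n) :
    (w * v).sign i = v.sign i * w.sign (v.perm i) := rfl

theorem one_perm : (1 : BarredPerm n).perm = 1 := rfl

theorem one_sign (i : Fin n) : (1 : BarredPerm n).sign i = 1 := rfl

theorem inv_perm (w : BarredPerm n) : w⁻¹.perm = w.perm⁻¹ := rfl

theorem inv_sign (w : BarredPerm n) (i : Fin n) :
    w⁻¹.sign i = (w.sign (w.perm⁻¹ i))⁻¹ := rfl

instance : Group (BarredPerm n) :=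
  Group.ofLeftAxioms
    (fun a b c => by
      ext i
      · simp [mul_perm]
      · simp [mul_perm, mul_sign, mul_assoc])
    (fun a => by
      ext i
      · simp [mul_perm, one_perm]
      · simp [mul_sign, one_sign])
    (fun a => by
      ext i
      · simp [mul_perm, one_perm, inv_perm]
      · simp [mul_sign, one_sign, inv_sign])

end BarredPerm

/-- The Weyl group `W̃_n` of type `D`: the barred permutations with an even number of bars. -/
def WeylD (n : ℕ) : Subgroup (BarredPerm n) where
  carrier := {w | ∏ i, w.sign i = 1}
  one_mem' := by simp [BarredPerm.one_sign]
  mul_mem' := by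
    intro a b ha hb
    simp only [Set.mem_ofPred_eq] at ha hb ⊢
    simp only [BarredPerm.mul_sign, Finset.prod_mul_distrib, hb, one_mul]
    rw [Equiv.prod_comp b.perm a.sign, ha]
  inv_mem' := by
    intro a ha
    simp only [Set.mem_ofPred_eq] at ha ⊢
    simp only [BarredPerm.inv_sign, Finset.prod_inv_distrib]
    rw [Equiv.prod_comp a.perm⁻¹ a.sign, ha, inv_one]

theorem mem_WeylD {n : ℕ} (w : BarredPerm n) : w ∈ WeylD n ↔ ∏ i, w.sign i = 1 := Iff.rfl

/-- The simple reflections of type `D_n`: `adj i` is `s_{i+1}`, exchanging `i + 1` and `i + 2`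
(so `i + 2 ≤ n`), and `box` is `s_□`, which exists when `n ≥ 2`. -/
inductive SimpleRefl (n : ℕ) : Type
  | adj (i : ℕ) (h : i + 1 < n) : SimpleRefl n
  | box (h : 1 < n) : SimpleRefl n

namespace SimpleRefl

variable {n : ℕ}

/-- The barred permutation given by a simple reflection; `s_□ = (2̄, 1̄, 3, …, n)`. -/
def toBarred : SimpleRefl n → BarredPerm n
  | adj i h => ⟨Equiv.swap ⟨i, by omega⟩ ⟨i + 1, h⟩, fun _ => 1⟩
  | box h => ⟨Equiv.swap ⟨0, by omega⟩ ⟨1, h⟩, fun j => if (j : ℕ) ≤ 1 then -1 else 1⟩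

/-- The action on polynomials: `s_i` exchanges `x_i` and `x_{i+1}`, and `s_□` sends `(x_1, x_2)`
to `(-x_2, -x_1)`; the other variables, and all the `y_j`, are fixed. -/
def act (s : SimpleRefl n) : PolyXY n →ₐ[ZHalf] PolyXY n :=
  MvPolynomial.aeval (Sum.elim
    (fun j => ((s.toBarred.sign j : ℤ) : PolyXY n) * xvar (s.toBarred.perm j)) yvar)

/-- The denominator of the divided difference: `x_i - x_{i+1}` for `s_i`, and `x_1 + x_2`
for `s_□`. -/
def denom : SimpleRefl n → PolyXY n
  | adj i h => xvar ⟨i, by omega⟩ - xvar ⟨i + 1, h⟩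
  | box h => xvar ⟨0, by omega⟩ + xvar ⟨1, h⟩

theorem denom_dvd (s : SimpleRefl n) (f : PolyXY n) : s.denom ∣ f - s.act f := by
  rw [← Ideal.mem_span_singleton]
  refine (Ideal.Quotient.mk_eq_mk_iff_sub_mem (I := Ideal.span {s.denom}) _ _).mp ?_
  change Ideal.Quotient.mkₐ ZHalf (Ideal.span {s.denom}) f =
    ((Ideal.Quotient.mkₐ ZHalf (Ideal.span {s.denom})).comp s.act) f
  congr 1
  apply MvPolynomial.algHom_ext
  rintro (j | j)
  · rw [AlgHom.comp_apply]
    simp only [Ideal.Quotient.mkₐ_eq_mk, act, MvPolynomial.aeval_X, Sum.elim_inl]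
    refine (Ideal.Quotient.mk_eq_mk_iff_sub_mem _ _).mpr (Ideal.mem_span_singleton.mpr ?_)
    change s.denom ∣ xvar j - _
    cases s with
    | adj i h =>
      simp only [toBarred, denom, Units.val_one, Int.cast_one, one_mul, Equiv.swap_apply_def]
      split_ifs with h1 h2
      · subst h1
        exact dvd_rfl
      · subst h2
        exact ⟨-1, by ring⟩
      · simp
    | box h =>
      simp only [toBarred, denom, Equiv.swap_apply_def]
      by_cases h1 : j = ⟨0, by omega⟩
      · subst h1
        simp
      · by_cases h2 : j = ⟨1, h⟩
        · subst h2
          simp [add_comm]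
        · have h3 : ¬ (j : ℕ) ≤ 1 := by
            intro h4
            rcases Nat.le_one_iff_eq_zero_or_eq_one.mp h4 with h5 | h5
            · exact h1 (Fin.ext h5)
            · exact h2 (Fin.ext h5)
          simp [h1, h2, h3]
  · rw [AlgHom.comp_apply]
    simp only [act, MvPolynomial.aeval_X, Sum.elim_inr]
    rfl

/-- The divided difference `∂_s f = (f - s f) / denom`, a polynomial. -/
def divDiff (s : SimpleRefl n) (f : PolyXY n) : PolyXY n := Classical.choose (s.denom_dvd f)

theorem denom_mul_divDiff (s : SimpleRefl n) (f : PolyXY n) :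
    s.denom * s.divDiff f = f - s.act f := (Classical.choose_spec (s.denom_dvd f)).symm

/-- The modified operators `∂'_i = -∂_i` and `∂'_□ = ∂_□`. -/
def divDiff' : SimpleRefl n → PolyXY n → PolyXY n
  | adj i h, f => -(adj i h).divDiff f
  | box h, f => (box h).divDiff f

end SimpleRefl

/-- The product `s_{a_1} ⋯ s_{a_r}` of a word. -/
def wordProd {n : ℕ} (a : List (SimpleRefl n)) : BarredPerm n :=
  (a.map SimpleRefl.toBarred).prod

/-- The word `a` is a reduced decomposition of `w`. -/
def IsReducedWord {n : ℕ} (a : List (SimpleRefl n)) (w : BarredPerm n) : Prop :=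
  wordProd a = w ∧ ∀ b : List (SimpleRefl n), wordProd b = w → a.length ≤ b.length

/-- `∂'_{a_1} ∘ ⋯ ∘ ∂'_{a_r}` for a word `a`. -/
def divDiffWord {n : ℕ} (a : List (SimpleRefl n)) (f : PolyXY n) : PolyXY n :=
  a.foldr SimpleRefl.divDiff' f

section Generation

theorem wordProd_append {n : ℕ} (a b : List (SimpleRefl n)) :
    wordProd (a ++ b) = wordProd a * wordProd b := by
  simp [wordProd]

theorem exists_word_mul {n : ℕ} {u v : BarredPerm n} (hu : ∃ a, wordProd a = u)
    (hv : ∃ a, wordProd a = v) : ∃ a, wordProd a = u * v := by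
  obtain ⟨a, rfl⟩ := hu
  obtain ⟨b, rfl⟩ := hv
  exact ⟨a ++ b, wordProd_append a b⟩

theorem exists_word_simple {n : ℕ} (s : SimpleRefl n) : ∃ a, wordProd a = s.toBarred :=
  ⟨[s], by simp [wordProd]⟩

theorem exists_word_perm {m : ℕ} (σ : Equiv.Perm (Fin (m + 1))) :
    ∃ a, wordProd a = (⟨σ, fun _ => 1⟩ : BarredPerm (m + 1)) := by
  have hσ : σ ∈ Submonoid.closure
      (Set.range fun i : Fin m => Equiv.swap i.castSucc i.succ) := by
    rw [Equiv.Perm.mclosure_swap_castSucc_succ]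
    trivial
  induction hσ using Submonoid.closure_induction with
  | mem x hx =>
    obtain ⟨i, rfl⟩ := hx
    exact exists_word_simple (SimpleRefl.adj (i : ℕ) (by omega))
  | one => exact ⟨[], rfl⟩
  | mul x y _ _ hx hy =>
    have h := exists_word_mul hx hy
    convert h using 3
    ext i
    · rfl
    · simp [BarredPerm.mul_sign]

theorem exists_word_flip {m : ℕ} (j : Fin (m + 1)) (hj : j ≠ 0) :
    ∃ a, wordProd a =
      (⟨1, fun i => if i = 0 ∨ i = j then -1 else 1⟩ : BarredPerm (m + 1)) := by
  have hm : 1 < m + 1 := by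
    have : (j : ℕ) ≠ 0 := fun h => hj (Fin.ext h)
    omega
  have h := exists_word_mul (exists_word_mul (exists_word_perm (Equiv.swap ⟨1, hm⟩ j))
    (exists_word_mul (exists_word_simple (SimpleRefl.box hm))
      (exists_word_simple (SimpleRefl.adj 0 hm)))) (exists_word_perm (Equiv.swap ⟨1, hm⟩ j))
  convert h using 3
  ext i
  · simp [BarredPerm.mul_perm, SimpleRefl.toBarred]
  · simp only [BarredPerm.mul_sign, SimpleRefl.toBarred, one_mul]
    congr 1
    have h0 : (⟨0, by omega⟩ : Fin (m + 1)) = 0 := rfl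
    simp only [Equiv.swap_apply_def, h0]
    by_cases h1 : i = ⟨1, hm⟩
    · subst h1
      by_cases h2 : j = ⟨1, hm⟩
      · subst h2; simp
      · have h3 : ¬ (j : ℕ) ≤ 1 := by
          intro h4
          rcases Nat.le_one_iff_eq_zero_or_eq_one.mp h4 with h5 | h5
          · exact hj (Fin.ext h5)
          · exact h2 (Fin.ext h5)
        have h6 : ¬ (⟨1, hm⟩ : Fin (m + 1)) = 0 := by simp [Fin.ext_iff]
        simp [hj, h2, h3, h6, Ne.symm h2]
    · by_cases h2 : i = j
      · subst h2; simp [h1]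
      · by_cases h3 : i = 0
        · subst h3; simp [h1, h2]
        · have h4 : ¬ (i : ℕ) ≤ 1 := by
            intro h4
            rcases Nat.le_one_iff_eq_zero_or_eq_one.mp h4 with h5 | h5
            · exact h3 (Fin.ext h5)
            · exact h1 (Fin.ext h5)
          simp [h1, h2, h3, h4]

theorem exists_word_flips {m : ℕ} (S : Finset (Fin (m + 1))) (hS : (0 : Fin (m + 1)) ∉ S) :
    ∃ a, wordProd a = (⟨1, fun i => if i = 0 then (-1) ^ S.card else
      if i ∈ S then -1 else 1⟩ : BarredPerm (m + 1)) := by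
  induction S using Finset.induction_on with
  | empty =>
    refine ⟨[], ?_⟩
    ext i
    · rfl
    · simp [wordProd, BarredPerm.one_sign]
  | insert j S hjS ih =>
    have hj : j ≠ 0 := fun h => hS (by simp [h])
    have h := exists_word_mul (exists_word_flip j hj)
      (ih (fun h => hS (Finset.mem_insert_of_mem h)))
    convert h using 3
    ext i
    · simp [BarredPerm.mul_perm]
    · simp only [BarredPerm.mul_sign]
      congr 1
      by_cases h0 : i = 0
      · subst h0
        simp [Finset.card_insert_of_notMem hjS, pow_succ]
      · by_cases h1 : i = j
        · subst h1
          simp [h0, hjS]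
        · simp [h0, h1]

/-- The simple reflections generate `W̃_n`. -/
theorem exists_word {n : ℕ} (w : BarredPerm n) (hw : w ∈ WeylD n) : ∃ a, wordProd a = w := by
  rcases n with _ | m
  · refine ⟨[], ?_⟩
    ext i
    · exact i.elim0
    · exact i.elim0
  · rw [mem_WeylD] at hw
    have h := exists_word_mul (exists_word_perm w.perm)
      (exists_word_flips ({i | i ≠ 0 ∧ w.sign i = -1} : Finset (Fin (m + 1))) (by simp))
    convert h using 3
    ext i
    · simp [BarredPerm.mul_perm]
    · simp only [BarredPerm.mul_sign, mul_one]
      congr 1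
      by_cases h0 : i = 0
      · subst h0
        have h1 : ∏ i ∈ univ.erase (0 : Fin (m + 1)), w.sign i =
            (-1) ^ #{i : Fin (m + 1) | i ≠ 0 ∧ w.sign i = -1} := by
          rw [← Finset.prod_const]
          have h2 : ({i : Fin (m + 1) | i ≠ 0 ∧ w.sign i = -1} : Finset (Fin (m + 1))) =
              (univ.erase (0 : Fin (m + 1))).filter (fun i => w.sign i = -1) := by
            ext i; simp
          rw [h2, Finset.prod_filter]
          refine Finset.prod_congr rfl fun i _ => ?_
          rcases Int.units_eq_one_or (w.sign i) with h3 | h3 <;> simp [h3]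
        rw [← Finset.mul_prod_erase univ w.sign (Finset.mem_univ 0), h1] at hw
        rw [if_pos rfl]
        rw [mul_eq_one_iff_eq_inv] at hw
        rw [hw, Int.units_inv_eq_self]
      · rcases Int.units_eq_one_or (w.sign i) with h3 | h3 <;> simp [h3, h0]

theorem exists_reducedWord {n : ℕ} (w : WeylD n) : ∃ a, IsReducedWord a (w : BarredPerm n) := by
  classical
  have h : ∃ r, ∃ a : List (SimpleRefl n), wordProd a = (w : BarredPerm n) ∧ a.length = r := by
    obtain ⟨a, ha⟩ := exists_word (w : BarredPerm n) w.2
    exact ⟨a.length, a, ha, rfl⟩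
  obtain ⟨a, ha, hr⟩ := Nat.find_spec h
  exact ⟨a, ha, fun b hb => hr ▸ Nat.find_min' h ⟨b, hb, rfl⟩⟩

end Generation

/-- The operator `∂'_w`: the composite `∂'_{a_1} ∘ ⋯ ∘ ∂'_{a_r}` along a reduced decomposition
`w = s_{a_1} ⋯ s_{a_r}`. -/
def divDiffWeyl {n : ℕ} (w : WeylD n) (f : PolyXY n) : PolyXY n :=
  divDiffWord (Classical.choose (exists_reducedWord w)) f

/-- The longest element: `(1̄, …, n̄)` for even `n`, and `(1, 2̄, …, n̄)` for odd `n`. -/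
def longest (n : ℕ) : WeylD n :=
  ⟨⟨1, fun i => if Odd n ∧ (i : ℕ) = 0 then 1 else -1⟩, by
    rw [mem_WeylD]
    rcases n with _ | m
    · simp
    · rw [Fin.prod_univ_succ]
      simp only [Fin.val_zero, Fin.val_succ, and_true, Nat.succ_ne_zero, and_false, if_false,
        Finset.prod_const, Finset.card_univ, Fintype.card_fin, Nat.odd_add_one]
      by_cases h : Odd m
      · simp [h, h.neg_one_pow]
      · simp [h, (Nat.not_odd_iff_even.mp h).neg_one_pow]⟩

/-- The type `D` double Schubert polynomial
`𝔇_w(X, Y) = (-1)^{n(n-1)/2} ∂'_{w⁻¹ w̃₀} (Δ(X, Y) P̃_{n-1}(X, Y))`. -/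
def doubleSchubert {n : ℕ} (w : WeylD n) : PolyXY n :=
  (-1) ^ (n * (n - 1) / 2) * divDiffWeyl (w⁻¹ * longest n) (Delta n * PtildeKernel n (n - 1))

/-! ### Maximal Grassmannian elements -/

/-- The barred permutation with the given one-line notation, a barred entry being written as a
negative integer. -/
def ofOneLine {n : ℕ} (L : List ℤ) (h : (L.map Int.natAbs).Perm (List.range' 1 n)) :
    BarredPerm n :=
  have hl : L.length = n := by simpa using h.length_eq
  have hmem : ∀ i : Fin n, 1 ≤ (L[i]).natAbs ∧ (L[i]).natAbs ≤ n := fun i => by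
    have h1 : (L[i]).natAbs ∈ L.map Int.natAbs := List.mem_map_of_mem (List.getElem_mem _)
    have h2 := h.mem_iff.mp h1
    rw [List.mem_range'_1] at h2
    omega
  { perm := Equiv.ofBijective
      (fun i : Fin n => (⟨(L[i]).natAbs - 1, by have := hmem i; omega⟩ : Fin n)) (by
        rw [← Finite.injective_iff_bijective]
        intro i j hij
        have h1 : (L[i]).natAbs = (L[j]).natAbs := by
          have h2 := congrArg Fin.val hij
          simp only at h2
          have := hmem i
          have := hmem j
          omega
        have hnd : (L.map Int.natAbs).Nodup := h.nodup_iff.mpr (List.nodup_range' (step := 1))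
        have h3 : (L.map Int.natAbs)[(i : ℕ)]'(by simp [hl]) =
            (L.map Int.natAbs)[(j : ℕ)]'(by simp [hl]) := by
          simpa using h1
        exact Fin.ext ((hnd.getElem_inj_iff).mp h3))
    sign := fun i => if L[i] < 0 then -1 else 1 }

/-- The one-line notation of `w_μ` for `μ ∈ 𝒟_{n-1}` of length `ℓ`: the barred entries
`μ_1 + 1, …, μ_ℓ + 1`, then `1`, barred when `ℓ` is odd, then the remaining elements of
`{1, …, n}` in increasing order. -/
def grassLine (n : ℕ) (μ : Finset ℕ) : List ℤ :=
  (μ.sort (· ≥ ·)).map (fun p : ℕ => -((p : ℤ) + 1)) ++ [(-1) ^ μ.card] ++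
    ((Icc 1 n \ insert 1 (μ.image (· + 1))).sort (· ≤ ·)).map (fun p : ℕ => (p : ℤ))

theorem grassLine_perm {n : ℕ} (hn : 1 ≤ n) {μ : Finset ℕ} (hμ : μ ∈ strictPartitions (n - 1)) :
    ((grassLine n μ).map Int.natAbs).Perm (List.range' 1 n) := by
  have hμ' : ∀ p ∈ μ, 1 ≤ p ∧ p ≤ n - 1 := fun p hp =>
    Finset.mem_Icc.mp (Finset.mem_powerset.mp hμ hp)
  have h1 : (grassLine n μ).map Int.natAbs = (μ.sort (· ≥ ·)).map (· + 1) ++ [1] ++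
      (Icc 1 n \ insert 1 (μ.image (· + 1))).sort (· ≤ ·) := by
    have h2 : Int.natAbs ∘ (fun p : ℕ => -((p : ℤ) + 1)) = (· + 1) := by
      funext p
      simp only [Function.comp_apply]
      omega
    have h3 : Int.natAbs ∘ (fun p : ℕ => (p : ℤ)) = id := by
      funext p
      simp
    simp only [grassLine, List.map_append, List.map_map, h2, h3, List.map_id, List.map_cons,
      List.map_nil, Int.natAbs_pow, Int.natAbs_neg, Int.natAbs_one, one_pow]
  rw [h1, List.perm_ext_iff_of_nodup]
  · intro a
    simp only [List.mem_append, List.mem_map, Finset.mem_sort, List.mem_singleton,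
      Finset.mem_sdiff, Finset.mem_insert, Finset.mem_image, Finset.mem_Icc, List.mem_range'_1]
    constructor
    · rintro ((⟨p, hp, rfl⟩ | rfl) | ⟨h, -⟩)
      · have := hμ' p hp
        omega
      · omega
      · omega
    · intro ha
      by_cases h4 : a = 1
      · exact Or.inl (Or.inr h4)
      · by_cases h5 : ∃ p ∈ μ, p + 1 = a
        · exact Or.inl (Or.inl h5)
        · exact Or.inr ⟨by omega, fun h => h.elim h4 h5⟩
  · rw [List.nodup_append', List.nodup_append']
    refine ⟨⟨(Finset.sort_nodup _ _).map (add_left_injective 1), List.nodup_singleton _, ?_⟩,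
      Finset.sort_nodup _ _, ?_⟩
    · intro a ha hb
      simp only [List.mem_map, Finset.mem_sort, List.mem_singleton] at ha hb
      obtain ⟨p, hp, rfl⟩ := ha
      have := hμ' p hp
      omega
    · intro a ha hb
      simp only [List.mem_append, List.mem_map, Finset.mem_sort, List.mem_singleton,
        Finset.mem_sdiff, Finset.mem_insert, Finset.mem_image] at ha hb
      exact hb.2 ha.symm
  · exact List.nodup_range' (step := 1)

theorem prod_getElem {M : Type*} [CommMonoid M] (L : List ℤ) (n : ℕ) (h : L.length = n)
    (f : ℤ → M) : ∏ i : Fin n, f (L[(i : ℕ)]'(by omega)) = (L.map f).prod := by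
  subst h
  exact Fin.prod_univ_fun_getElem L f

theorem grass_mem {n : ℕ} (hn : 1 ≤ n) {μ : Finset ℕ} (hμ : μ ∈ strictPartitions (n - 1)) :
    ofOneLine (grassLine n μ) (grassLine_perm hn hμ) ∈ WeylD n := by
  have hl : (grassLine n μ).length = n := by simpa using (grassLine_perm hn hμ).length_eq
  rw [mem_WeylD]
  refine (prod_getElem (grassLine n μ) n hl (fun a => if a < 0 then (-1 : ℤˣ) else 1)).trans ?_
  have h1 : (fun a : ℤ => if a < 0 then (-1 : ℤˣ) else 1) ∘ (fun p : ℕ => -((p : ℤ) + 1)) =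
      fun _ => -1 := by
    funext p
    simp only [Function.comp_apply]
    rw [if_pos (by omega)]
  have h2 : (fun a : ℤ => if a < 0 then (-1 : ℤˣ) else 1) ∘ (fun p : ℕ => (p : ℤ)) =
      fun _ => 1 := by
    funext p
    simp
  simp only [grassLine, List.map_append, List.map_map, h1, h2, List.prod_append, List.map_const',
    List.prod_replicate, List.map_cons, List.map_nil, List.prod_singleton, Finset.length_sort,
    one_pow, mul_one]
  rcases Nat.even_or_odd μ.card with h | h
  · simp [h.neg_one_pow]
  · simp [h.neg_one_pow]

/-- The maximal Grassmannian element `w_μ` of `W̃_n`, for `μ ∈ 𝒟_{n-1}`. -/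
def maxGrass {n : ℕ} (hn : 1 ≤ n) {μ : Finset ℕ} (hμ : μ ∈ strictPartitions (n - 1)) : WeylD n :=
  ⟨ofOneLine (grassLine n μ) (grassLine_perm hn hμ), grass_mem hn hμ⟩

end TypeD

end

noncomputable section

namespace TypeD

open Finset

/-! ### The coefficient ring -/

/-! The operator `∂'_w` for `w = w_λ⁻¹ w̃₀` is a composite of `n` steps `p = 0, …, n-1`. Each is a
chain `∂'_m ⋯ ∂'_1` of type A divided differences, preceded by the sign change `x_1 ↦ -x_1` if `p`
is a part of `λ'`. The chain has `m = n-1` after a sign change and `m = n-1-p` otherwise. The step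
`p = 0` also changes the sign when `n ≡ ℓ` mod 2, which makes the number `k` of sign changes even. A
single sign change is not in the Weyl group of type D, but it normalizes that group, exchanging
`s_1` and `s_□`. Pushing all sign changes to the left, where their even power cancels, leaves a word
in the generators (`isRealized_process`), and `maxGrass_mul_processElt` identifies its product. That
this word is reduced is not shown by counting. A word that is not reduced acts by zero
(`divDiffWord_eq_zero_of_not_reduced`), so one polynomial with nonzero image suffices
(`process_flipSet_ne_zero`). This criterion and the independence of the reduced word both rest on
the exchange condition, proved in the reflection representation. The kernel polynomial `Δ` is a
staircase of rows `∏_l (x_i - y_l)`. Every step strips the first row and shifts the others, because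
degree bounds kill all other Leibniz terms. Without a sign change a symmetric cofactor `Q` is only
multiplied by a sign. With one, the first row becomes `± ∏ (x_1 + y_l)`; expanding it replaces `Q`,
up to sign, by `∑_b e_{b-p}(Y_{n-1-p}) L_b(Q)`, where `L_b` is `lowerOp b`. The heart is
`lowerOp_Ptilde`: `L_b` removes the part `b` from the index of `P̃_s(X)`, with a sign, and gives
zero if `b` is neither a part nor `0`. Indeed `x_1 ↦ -x_1` changes the array `Q̃_{i,j}` by an
alternating array of rank two, so the Pfaffian becomes linear in the `e_a(-x_1, x_2, …)`, with
symmetric coefficients. For `b > 0` the chain then selects `a = b`. Over all steps, `k` elements `β`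
of `γ ∪ {0}` are removed from `P̃_γ(X)` in every order. The signs are those of Laplace expansions,
one column per step, so the orders add up to the determinant (`process_stairProd_mul`). Setting `α =
γ ∖ β` and comparing signs gives the formula. The condition `β ⊃ λ'` is harmless, since the
determinant vanishes without it. -/

instance : IsDomain ZHalf :=
  IsLocalization.isDomain_of_le_nonZeroDivisors (M := Submonoid.powers (2 : ℤ)) ZHalf
    (powers_le_nonZeroDivisors_of_noZeroDivisors two_ne_zero)

instance : CharZero ZHalf := by
  refine ⟨fun a b h => ?_⟩
  have hinj : Function.Injective (algebraMap ℤ ZHalf) :=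
    IsLocalization.injective (M := Submonoid.powers (2 : ℤ)) ZHalf
      (powers_le_nonZeroDivisors_of_noZeroDivisors two_ne_zero)
  have h2 : algebraMap ℤ ZHalf (a : ℤ) = algebraMap ℤ ZHalf (b : ℤ) := by
    simpa using h
  exact_mod_cast hinj h2

/-! ### The reflection representation -/

namespace BarredPerm

variable {n : ℕ}

/-- The action of barred permutations on `ℤⁿ`, with `w e_i = ± e_{w(i)}`. -/
def vec (w : BarredPerm n) (v : Fin n → ℤ) : Fin n → ℤ :=
  fun j => (w⁻¹.sign j : ℤ) * v (w⁻¹.perm j)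

theorem vec_mul (w u : BarredPerm n) (v : Fin n → ℤ) : (w * u).vec v = w.vec (u.vec v) := by
  ext j
  simp [vec, mul_inv_rev, mul_sign, mul_perm, mul_assoc]

theorem vec_one (v : Fin n → ℤ) : (1 : BarredPerm n).vec v = v := by
  ext j
  simp [vec, one_sign, one_perm]

theorem vec_sub (w : BarredPerm n) (u v : Fin n → ℤ) : w.vec (u - v) = w.vec u - w.vec v := by
  ext j
  simp [vec, mul_sub]

theorem vec_neg (w : BarredPerm n) (v : Fin n → ℤ) : w.vec (-v) = -w.vec v := by
  ext j
  simp [vec]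

theorem vec_smul (w : BarredPerm n) (c : ℤ) (v : Fin n → ℤ) : w.vec (c • v) = c • w.vec v := by
  ext j
  simp [vec]
  ring

theorem vec_dot (w : BarredPerm n) (u v : Fin n → ℤ) : w.vec u ⬝ᵥ w.vec v = u ⬝ᵥ v := by
  simp only [dotProduct, vec]
  rw [← Equiv.sum_comp w⁻¹.perm (fun i => u i * v i)]
  refine Finset.sum_congr rfl fun j _ => ?_
  have h : ((w⁻¹.sign j : ℤˣ) : ℤ) * ((w⁻¹.sign j : ℤˣ) : ℤ) = 1 := by
    rw [← Units.val_mul, Int.units_mul_self, Units.val_one]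
  linear_combination (u (w⁻¹.perm j) * v (w⁻¹.perm j)) * h

/-- The vector `(1, …, n)` has entries with distinct nonzero absolute values, so its image alone
determines the permutation and the signs. -/
theorem vec_injective {w u : BarredPerm n} (h : ∀ v, w.vec v = u.vec v) : w = u := by
  rw [← inv_inj]
  have h1 : ∀ j, (w⁻¹.sign j : ℤ) * ((w⁻¹.perm j : ℕ) + 1) =
      (u⁻¹.sign j : ℤ) * ((u⁻¹.perm j : ℕ) + 1) := fun j =>
    congrFun (h (fun i => ((i : ℕ) : ℤ) + 1)) j
  ext j
  · have := h1 j
    rcases Int.units_eq_one_or (w⁻¹.sign j) with h2 | h2 <;>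
      rcases Int.units_eq_one_or (u⁻¹.sign j) with h3 | h3 <;>
      rw [h2, h3] at this <;> simp only [Units.val_one, Units.val_neg] at this <;> omega
  · have := h1 j
    rcases Int.units_eq_one_or (w⁻¹.sign j) with h2 | h2 <;>
      rcases Int.units_eq_one_or (u⁻¹.sign j) with h3 | h3 <;>
      rw [h2, h3] at this ⊢ <;> simp only [Units.val_one, Units.val_neg] at this <;> omega

end BarredPerm

/-- The height functional `v ↦ ∑ i v_i`, positive exactly on the positive roots. -/
def height {n : ℕ} (v : Fin n → ℤ) : ℤ := ∑ i : Fin n, ((i : ℕ) : ℤ) * v i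

theorem height_sub {n : ℕ} (u v : Fin n → ℤ) : height (u - v) = height u - height v := by
  simp [height, mul_sub, Finset.sum_sub_distrib]

theorem height_neg {n : ℕ} (v : Fin n → ℤ) : height (-v) = -height v := by
  simp [height]

theorem height_smul {n : ℕ} (c : ℤ) (v : Fin n → ℤ) : height (c • v) = c * height v := by
  simp only [height, Finset.mul_sum, Pi.smul_apply, smul_eq_mul]
  exact Finset.sum_congr rfl fun _ _ => by ring

namespace SimpleRefl

variable {n : ℕ}

/-- The simple root `e_{i+1} - e_i`, respectively `e_1 + e_2`. -/
def root : SimpleRefl n → Fin n → ℤ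
  | adj i h => Pi.single ⟨i + 1, h⟩ 1 - Pi.single ⟨i, by omega⟩ 1
  | box h => Pi.single ⟨1, h⟩ 1 + Pi.single ⟨0, by omega⟩ 1

theorem root_dot_root (s : SimpleRefl n) : s.root ⬝ᵥ s.root = 2 := by
  cases s
  · simp [root]
  · simp [root]

theorem root_dot_root_of_ne (s t : SimpleRefl n) (h : s ≠ t) :
    s.root ⬝ᵥ t.root = 0 ∨ s.root ⬝ᵥ t.root = -1 := by
  cases s with
  | adj i hi =>
    cases t with
    | adj j hj =>
      have hij : i ≠ j := fun h' => h (by subst h'; rfl)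
      simp only [root, sub_dotProduct, single_dotProduct, one_mul, Pi.sub_apply, Pi.single_apply,
        Fin.mk.injEq]
      split_ifs <;> simp_all <;> omega
    | box hj =>
      simp only [root, sub_dotProduct, single_dotProduct, one_mul, Pi.add_apply, Pi.single_apply,
        Fin.mk.injEq]
      split_ifs <;> simp_all
  | box hi =>
    cases t with
    | adj j hj =>
      simp only [root, add_dotProduct, single_dotProduct, one_mul, Pi.sub_apply, Pi.single_apply,
        Fin.mk.injEq]
      split_ifs <;> simp_all
    | box hj => exact absurd rfl h

theorem height_root (s : SimpleRefl n) : height s.root = 1 := by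
  cases s <;> simp [root, height, Pi.single_apply, mul_sub, mul_add, Finset.sum_sub_distrib,
    Finset.sum_add_distrib]

theorem toBarred_mul_self (s : SimpleRefl n) : s.toBarred * s.toBarred = 1 := by
  cases s with
  | adj i h => ext j <;> simp [toBarred, BarredPerm.mul_perm, BarredPerm.mul_sign,
      BarredPerm.one_perm, BarredPerm.one_sign]
  | box h =>
    ext j
    · simp [toBarred, BarredPerm.mul_perm, BarredPerm.one_perm]
    · simp only [toBarred, BarredPerm.mul_sign, BarredPerm.one_sign, Equiv.swap_apply_def]
      by_cases h1 : (j : ℕ) ≤ 1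
      · rcases Nat.le_one_iff_eq_zero_or_eq_one.mp h1 with h2 | h2 <;>
          simp [Fin.ext_iff, h2]
      · have h2 : (j : ℕ) ≠ 0 := by omega
        have h3 : (j : ℕ) ≠ 1 := by omega
        simp [Fin.ext_iff, h1, h2, h3]

theorem toBarred_inv (s : SimpleRefl n) : s.toBarred⁻¹ = s.toBarred :=
  inv_eq_of_mul_eq_one_left s.toBarred_mul_self

theorem vec_toBarred (s : SimpleRefl n) (v : Fin n → ℤ) :
    s.toBarred.vec v = v - (v ⬝ᵥ s.root) • s.root := by
  ext j
  rw [BarredPerm.vec, toBarred_inv]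
  cases s with
  | adj i h =>
    simp only [toBarred, root, Equiv.swap_apply_def, dotProduct_sub, dotProduct_single, mul_one,
      Pi.sub_apply, Pi.smul_apply, Pi.single_apply, smul_eq_mul, Units.val_one, one_mul]
    by_cases h1 : j = ⟨i, by omega⟩
    · subst h1; simp
    · by_cases h2 : j = ⟨i + 1, h⟩
      · subst h2; simp
      · simp [h1, h2]
  | box h =>
    simp only [toBarred, root, Equiv.swap_apply_def, dotProduct_add, dotProduct_single, mul_one,
      Pi.sub_apply, Pi.add_apply, Pi.smul_apply, Pi.single_apply, smul_eq_mul]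
    by_cases h1 : j = ⟨0, by omega⟩
    · subst h1; simp
    · by_cases h2 : j = ⟨1, h⟩
      · subst h2; simp
      · have h3 : ¬ (j : ℕ) ≤ 1 := by
          simp only [Fin.ext_iff] at h1 h2
          omega
        simp [h1, h2, h3]

theorem toBarred_injective {s t : SimpleRefl n} (h : s.toBarred = t.toBarred) : s = t := by
  by_contra hne
  have h1 := s.vec_toBarred s.root
  rw [h, t.vec_toBarred, s.root_dot_root] at h1
  have h2 := congrArg (fun v => v ⬝ᵥ s.root) h1
  simp only [sub_dotProduct, smul_dotProduct, s.root_dot_root, smul_eq_mul] at h2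
  rw [dotProduct_comm t.root] at h2
  rcases s.root_dot_root_of_ne t hne with h3 | h3 <;> rw [h3] at h2 <;> omega

/-- If `g` carries one simple root to another, it conjugates the corresponding reflections. -/
theorem mul_toBarred_of_vec_root {g : BarredPerm n} {s t : SimpleRefl n}
    (h : g.vec s.root = t.root) : t.toBarred * g = g * s.toBarred := by
  refine BarredPerm.vec_injective fun v => ?_
  rw [BarredPerm.vec_mul, BarredPerm.vec_mul, vec_toBarred, vec_toBarred, BarredPerm.vec_sub,
    BarredPerm.vec_smul, h, ← h, BarredPerm.vec_dot]

/-- As the simple root has height 1, a change from positive to negative height forces `v ⬝ᵥ s.root ≥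
2`. Both vectors have square norm 2, so their difference has norm at most 0. Thus a simple
reflection makes only one positive root negative. -/
theorem eq_root_of_height (s : SimpleRefl n) {v : Fin n → ℤ} (hv : v ⬝ᵥ v = 2)
    (h1 : 0 < height v) (h2 : height (s.toBarred.vec v) < 0) : v = s.root := by
  rw [vec_toBarred, height_sub, height_smul, height_root] at h2
  have h3 : (v - s.root) ⬝ᵥ (v - s.root) ≤ 0 := by
    rw [sub_dotProduct, dotProduct_sub, dotProduct_sub, hv, root_dot_root,
      dotProduct_comm s.root v]
    omega
  have h4 : (v - s.root) ⬝ᵥ (v - s.root) = 0 :=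
    le_antisymm h3 (Finset.sum_nonneg fun i _ => mul_self_nonneg _)
  exact sub_eq_zero.mp (dotProduct_self_eq_zero.mp h4)

theorem commute_of_dot {s t : SimpleRefl n} (h : s.root ⬝ᵥ t.root = 0) :
    s.toBarred * t.toBarred = t.toBarred * s.toBarred := by
  refine (mul_toBarred_of_vec_root (g := s.toBarred) (s := t) (t := t) ?_).symm
  rw [vec_toBarred, dotProduct_comm, h, zero_smul, sub_zero]

theorem vec_of_dot {s t : SimpleRefl n} (h : s.root ⬝ᵥ t.root = -1) :
    s.toBarred.vec t.root = t.root + s.root := by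
  rw [vec_toBarred, dotProduct_comm, h, neg_smul, one_smul, sub_neg_eq_add]

theorem vec_self (s : SimpleRefl n) : s.toBarred.vec s.root = -s.root := by
  rw [vec_toBarred, root_dot_root, two_smul]
  abel

theorem braid_of_dot {s t : SimpleRefl n} (h : s.root ⬝ᵥ t.root = -1) :
    s.toBarred * t.toBarred * s.toBarred = t.toBarred * s.toBarred * t.toBarred := by
  have h' : t.root ⬝ᵥ s.root = -1 := by rw [dotProduct_comm, h]
  rw [mul_assoc t.toBarred]
  refine (mul_toBarred_of_vec_root (g := s.toBarred * t.toBarred) (s := s) (t := t) ?_).symm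
  rw [BarredPerm.vec_mul, vec_of_dot h', vec_toBarred, add_dotProduct, root_dot_root,
    dotProduct_comm t.root, h]
  ext j
  simp

end SimpleRefl

/-! ### The exchange condition -/

section Exchange

variable {n : ℕ}

theorem wordProd_cons (s : SimpleRefl n) (a : List (SimpleRefl n)) :
    wordProd (s :: a) = s.toBarred * wordProd a := by
  simp [wordProd]

theorem wordProd_concat (a : List (SimpleRefl n)) (s : SimpleRefl n) :
    wordProd (a ++ [s]) = wordProd a * s.toBarred := by
  simp [wordProd]

/-- The image of a simple root is `± e_a ± e_b` with `a ≠ b`, and `± a ± b` is not zero for distinct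
natural numbers. -/
theorem height_vec_root_ne_zero (w : BarredPerm n) (s : SimpleRefl n) :
    height (w.vec s.root) ≠ 0 := by
  have key : ∀ i j : Fin n, i ≠ j → ∀ c d : ℤ, (c = 1 ∨ c = -1) → (d = 1 ∨ d = -1) →
      height (w.vec (Pi.single i c + Pi.single j d)) ≠ 0 := by
    intro i j hij c d hc hd
    have h1 : height (w.vec (Pi.single i c + Pi.single j d)) =
        ((w.perm i : ℕ) : ℤ) * ((w.sign i : ℤ) * c) +
          ((w.perm j : ℕ) : ℤ) * ((w.sign j : ℤ) * d) := by
      rw [height, ← Equiv.sum_comp w.perm]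
      simp [BarredPerm.vec, BarredPerm.inv_sign, BarredPerm.inv_perm, Pi.single_apply, mul_add,
        Finset.sum_add_distrib]
    have h2 : (w.perm i : ℕ) ≠ (w.perm j : ℕ) := fun h => hij (w.perm.injective (Fin.ext h))
    rw [h1]
    rcases Int.units_eq_one_or (w.sign i) with h3 | h3 <;>
      rcases Int.units_eq_one_or (w.sign j) with h4 | h4 <;>
      rcases hc with rfl | rfl <;> rcases hd with rfl | rfl <;> rw [h3, h4] <;>
      simp only [Units.val_one, Units.val_neg] <;> omega
  cases s with
  | adj i h =>
    have h0 : (SimpleRefl.adj i h).root =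
        (Pi.single ⟨i + 1, h⟩ 1 + Pi.single ⟨i, by omega⟩ (-1) : Fin n → ℤ) := by
      rw [SimpleRefl.root, sub_eq_add_neg, Pi.single_neg]
    rw [h0]
    exact key _ _ (by simp) _ _ (Or.inl rfl) (Or.inr rfl)
  | box h => exact key _ _ (by simp) _ _ (Or.inl rfl) (Or.inl rfl)

theorem height_vec_mul_root (w : BarredPerm n) (s : SimpleRefl n) :
    height ((w * s.toBarred).vec s.root) = -height (w.vec s.root) := by
  rw [BarredPerm.vec_mul, s.vec_self, BarredPerm.vec_neg, height_neg]

/-- Applied from the right, the letters carry the positive root `s.root` to a negative one. At the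
letter `c` where the sign changes, the vector is the root of `c`, so the suffix `r` conjugates `s`
to `c`, and multiplying by `s` deletes `c`. -/
theorem exchange (a : List (SimpleRefl n)) (s : SimpleRefl n)
    (h : height ((wordProd a).vec s.root) < 0) :
    ∃ l c r, a = l ++ c :: r ∧ wordProd a * s.toBarred = wordProd (l ++ r) := by
  induction a with
  | nil =>
    rw [show wordProd ([] : List (SimpleRefl n)) = 1 from rfl, BarredPerm.vec_one,
      s.height_root] at h
    omega
  | cons c r ih =>
    rcases lt_or_gt_of_ne (height_vec_root_ne_zero (wordProd r) s) with h1 | h1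
    · obtain ⟨l, d, r', rfl, h2⟩ := ih h1
      exact ⟨c :: l, d, r', rfl, by
        rw [wordProd_cons, mul_assoc, h2, List.cons_append, wordProd_cons]⟩
    · refine ⟨[], c, r, rfl, ?_⟩
      rw [wordProd_cons, BarredPerm.vec_mul] at h
      have h2 := c.eq_root_of_height (by rw [BarredPerm.vec_dot, s.root_dot_root]) h1 h
      rw [wordProd_cons, mul_assoc, ← SimpleRefl.mul_toBarred_of_vec_root h2, ← mul_assoc,
        c.toBarred_mul_self, one_mul, List.nil_append]

/-- A word is reduced if no shorter word has the same product. -/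
def Reduced (a : List (SimpleRefl n)) : Prop :=
  ∀ b : List (SimpleRefl n), wordProd b = wordProd a → a.length ≤ b.length

/-- Multiplying a shorter word for the product by `s` once more would delete a further letter, and
`a` would have a word that is too short. -/
theorem reduced_concat {a : List (SimpleRefl n)} (ha : Reduced a) {s : SimpleRefl n}
    (hs : 0 < height ((wordProd a).vec s.root)) : Reduced (a ++ [s]) := by
  intro b hb
  by_contra hlt
  rw [wordProd_concat] at hb
  have h1 : height ((wordProd b).vec s.root) < 0 := by
    rw [hb, height_vec_mul_root]
    omega
  obtain ⟨l, c, r, rfl, h2⟩ := exchange b s h1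
  rw [hb, mul_assoc, s.toBarred_mul_self, mul_one] at h2
  have h3 := ha (l ++ r) h2.symm
  simp only [List.length_append, List.length_cons, List.length_nil] at hlt h3
  omega

theorem Reduced.of_append {a b : List (SimpleRefl n)} (h : Reduced (a ++ b)) : Reduced a := by
  intro c hc
  have := h (c ++ b) (by rw [wordProd_append, wordProd_append, hc])
  simpa using this

/-- Otherwise `a ++ [s, s]` would be reduced, although it has the same product as `a`. -/
theorem Reduced.height_neg {a : List (SimpleRefl n)} {s : SimpleRefl n}
    (h : Reduced (a ++ [s])) : height ((wordProd (a ++ [s])).vec s.root) < 0 := by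
  rcases lt_or_gt_of_ne (height_vec_root_ne_zero (wordProd (a ++ [s])) s) with h1 | h1
  · exact h1
  · have h2 := reduced_concat h h1 a (by
      rw [wordProd_concat, wordProd_concat, mul_assoc, s.toBarred_mul_self, mul_one])
    simp at h2

theorem Reduced.congr {a b : List (SimpleRefl n)} (h : Reduced a)
    (hp : wordProd b = wordProd a) (hl : b.length = a.length) : Reduced b := fun c hc => by
  rw [hl]
  exact h c (hc.trans hp)

end Exchange

/-! ### Divided differences -/

section Operators

variable {n : ℕ}

/-- The action of barred permutations on polynomials. -/
def bact (w : BarredPerm n) : PolyXY n →ₐ[ZHalf] PolyXY n :=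
  MvPolynomial.aeval (Sum.elim
    (fun j => ((w.sign j : ℤ) : PolyXY n) * xvar (w.perm j)) yvar)

theorem act_eq_bact (s : SimpleRefl n) : s.act = bact s.toBarred := rfl

theorem bact_xvar (w : BarredPerm n) (j : Fin n) :
    bact w (xvar j) = ((w.sign j : ℤ) : PolyXY n) * xvar (w.perm j) := by
  simp [bact, xvar]

theorem bact_yvar (w : BarredPerm n) (j : Fin n) : bact w (yvar j) = yvar j := by
  simp [bact, yvar]

theorem algHom_ext_vars {A : Type*} [CommRing A] [Algebra ZHalf A] {f g : PolyXY n →ₐ[ZHalf] A}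
    (hx : ∀ j, f (xvar j) = g (xvar j)) (hy : ∀ j, f (yvar j) = g (yvar j)) : f = g := by
  apply MvPolynomial.algHom_ext
  rintro (j | j)
  · exact hx j
  · exact hy j

theorem bact_mul (w u : BarredPerm n) (f : PolyXY n) : bact (w * u) f = bact w (bact u f) := by
  have h : bact (w * u) = (bact w).comp (bact u) := by
    refine algHom_ext_vars (fun j => ?_) (fun j => ?_)
    · simp [bact_xvar, BarredPerm.mul_sign, BarredPerm.mul_perm, mul_assoc]
    · simp [bact_yvar]
  rw [h, AlgHom.comp_apply]

theorem bact_one (f : PolyXY n) : bact 1 f = f := by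
  have h : bact (1 : BarredPerm n) = AlgHom.id ZHalf _ := by
    refine algHom_ext_vars (fun j => ?_) (fun j => ?_)
    · simp [bact_xvar, BarredPerm.one_sign, BarredPerm.one_perm]
    · simp [bact_yvar]
  rw [h, AlgHom.id_apply]

/-- The linear form with integer coefficients `v` in the variables `X`. -/
def linForm (v : Fin n → ℤ) : PolyXY n := ∑ j, ((v j : ℤ) : PolyXY n) * xvar j

theorem linForm_add (u v : Fin n → ℤ) : linForm (u + v) = linForm u + linForm v := by
  simp [linForm, add_mul, Finset.sum_add_distrib]

theorem linForm_neg (v : Fin n → ℤ) : linForm (-v) = -linForm v := by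
  simp [linForm]

theorem bact_linForm (w : BarredPerm n) (v : Fin n → ℤ) :
    bact w (linForm v) = linForm (w.vec v) := by
  rw [linForm, linForm, map_sum, ← Equiv.sum_comp w.perm (fun j => ((w.vec v j : ℤ) : PolyXY n) *
    xvar j)]
  refine Finset.sum_congr rfl fun j _ => ?_
  simp only [map_mul, map_intCast, bact_xvar, BarredPerm.vec, BarredPerm.inv_sign,
    BarredPerm.inv_perm, Equiv.Perm.coe_inv, Equiv.symm_apply_apply, Int.units_inv_eq_self, Int.cast_mul]
  ring

theorem linForm_ne_zero {v : Fin n → ℤ} (hv : v ≠ 0) : linForm v ≠ 0 := by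
  obtain ⟨i, hi⟩ := Function.ne_iff.mp hv
  intro h
  have h1 := congrArg (MvPolynomial.aeval (R := ZHalf)
    (Sum.elim (fun j : Fin n => if j = i then (1 : ZHalf) else 0) (fun _ => 0))) h
  simp [linForm, xvar] at h1
  exact hi h1

theorem SimpleRefl.linForm_root_ne_zero (s : SimpleRefl n) : linForm s.root ≠ 0 := by
  refine linForm_ne_zero fun h => ?_
  have := s.root_dot_root
  rw [h] at this
  simp at this

namespace SimpleRefl

theorem root_mul_divDiff' (s : SimpleRefl n) (f : PolyXY n) :
    linForm s.root * s.divDiff' f = f - s.act f := by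
  rw [← denom_mul_divDiff]
  cases s with
  | adj i h =>
    simp [linForm, root, divDiff', denom, Pi.single_apply, sub_mul, Finset.sum_sub_distrib]
  | box h =>
    simp [linForm, root, divDiff', denom, Pi.single_apply, add_mul, Finset.sum_add_distrib]
    ring

theorem act_act (s : SimpleRefl n) (f : PolyXY n) : s.act (s.act f) = f := by
  rw [act_eq_bact, ← bact_mul, s.toBarred_mul_self, bact_one]

theorem act_root (s : SimpleRefl n) : s.act (linForm s.root) = -linForm s.root := by
  rw [act_eq_bact, bact_linForm, s.vec_self, linForm_neg]

theorem divDiff'_unique (s : SimpleRefl n) {f g : PolyXY n}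
    (h : linForm s.root * g = f - s.act f) : s.divDiff' f = g :=
  mul_left_cancel₀ s.linForm_root_ne_zero ((s.root_mul_divDiff' f).trans h.symm)

theorem act_divDiff' (s : SimpleRefl n) (f : PolyXY n) :
    s.act (s.divDiff' f) = s.divDiff' f := by
  refine (s.divDiff'_unique ?_).symm
  have h := congrArg s.act (s.root_mul_divDiff' f)
  rw [map_mul, act_root, map_sub, act_act] at h
  linear_combination -h

theorem divDiff'_add (s : SimpleRefl n) (f g : PolyXY n) :
    s.divDiff' (f + g) = s.divDiff' f + s.divDiff' g :=
  s.divDiff'_unique (by rw [mul_add, root_mul_divDiff', root_mul_divDiff', map_add]; ring)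

theorem divDiff'_mul (s : SimpleRefl n) (f g : PolyXY n) :
    s.divDiff' (f * g) = s.divDiff' f * g + s.act f * s.divDiff' g :=
  s.divDiff'_unique (by
    have h1 := s.root_mul_divDiff' f
    have h2 := s.root_mul_divDiff' g
    rw [map_mul]
    linear_combination g * h1 + s.act f * h2)

theorem divDiff'_of_act_eq (s : SimpleRefl n) {f : PolyXY n} (h : s.act f = f) :
    s.divDiff' f = 0 :=
  s.divDiff'_unique (by rw [h]; ring)

theorem divDiff'_zero (s : SimpleRefl n) : s.divDiff' (0 : PolyXY n) = 0 :=
  s.divDiff'_of_act_eq (map_zero _)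

theorem divDiff'_divDiff' (s : SimpleRefl n) (f : PolyXY n) :
    s.divDiff' (s.divDiff' f) = 0 :=
  s.divDiff'_of_act_eq (s.act_divDiff' f)

theorem act_comm {s t : SimpleRefl n} (h : s.root ⬝ᵥ t.root = 0) (f : PolyXY n) :
    s.act (t.act f) = t.act (s.act f) := by
  simp only [act_eq_bact, ← bact_mul, commute_of_dot h]

theorem act_root_of_dot {s t : SimpleRefl n} (h : s.root ⬝ᵥ t.root = 0) :
    s.act (linForm t.root) = linForm t.root := by
  rw [act_eq_bact, bact_linForm, vec_toBarred, dotProduct_comm, h, zero_smul, sub_zero]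

theorem act_divDiff'_comm {s t : SimpleRefl n} (h : s.root ⬝ᵥ t.root = 0) (f : PolyXY n) :
    s.act (t.divDiff' f) = t.divDiff' (s.act f) := by
  refine (t.divDiff'_unique ?_).symm
  have h1 := congrArg s.act (t.root_mul_divDiff' f)
  rw [map_mul, act_root_of_dot h, map_sub, act_comm h] at h1
  exact h1

theorem divDiff'_comm {s t : SimpleRefl n} (h : s.root ⬝ᵥ t.root = 0) (f : PolyXY n) :
    s.divDiff' (t.divDiff' f) = t.divDiff' (s.divDiff' f) := by
  refine s.divDiff'_unique (mul_left_cancel₀ t.linForm_root_ne_zero ?_)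
  have h' : t.root ⬝ᵥ s.root = 0 := by rw [dotProduct_comm, h]
  have h1 := t.root_mul_divDiff' (s.divDiff' f)
  have h2 := s.root_mul_divDiff' f
  have h3 := t.root_mul_divDiff' f
  have h4 := s.root_mul_divDiff' (t.act f)
  have h5 := t.root_mul_divDiff' (s.act f)
  rw [act_divDiff'_comm h, act_comm h] at *
  rw [act_divDiff'_comm h'] at h1
  linear_combination linForm s.root * h1 + h2 - h4 - h3 + h5

/-- The right side is the alternating sum over the group of order six generated by `s` and `t`. It
is symmetric in `s` and `t`, as is the product of the three positive roots on the left, whence the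
braid relation. -/
theorem divDiff'_braid_expand {s t : SimpleRefl n} (h : s.root ⬝ᵥ t.root = -1) (f : PolyXY n) :
    linForm s.root * linForm t.root * (linForm s.root + linForm t.root) *
      s.divDiff' (t.divDiff' (s.divDiff' f)) =
    f - s.act f - t.act f + t.act (s.act f) + s.act (t.act f) - s.act (t.act (s.act f)) := by
  have h' : t.root ⬝ᵥ s.root = -1 := by rw [dotProduct_comm, h]
  set a := linForm s.root with ha
  set b := linForm t.root with hb
  have hsb : s.act b = a + b := by
    rw [hb, act_eq_bact, bact_linForm, vec_of_dot h, linForm_add, add_comm]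
  have hta : t.act a = a + b := by
    rw [ha, act_eq_bact, bact_linForm, vec_of_dot h', linForm_add]
  have hsa : s.act a = -a := s.act_root
  set g1 := s.divDiff' f with hg1
  set g2 := t.divDiff' g1 with hg2
  have e1 : a * g1 = f - s.act f := s.root_mul_divDiff' f
  have e2 : b * g2 = g1 - t.act g1 := t.root_mul_divDiff' g1
  have e3 : a * s.divDiff' g2 = g2 - s.act g2 := s.root_mul_divDiff' g2
  have e4 : s.act g1 = g1 := s.act_divDiff' f
  have e5 : (a + b) * s.act g2 = g1 - s.act (t.act g1) := by
    have := congrArg s.act e2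
    rwa [map_mul, map_sub, hsb, e4] at this
  have e6 : (a + b) * t.act g1 = t.act f - t.act (s.act f) := by
    have := congrArg t.act e1
    rwa [map_mul, map_sub, hta] at this
  have e7 : b * s.act (t.act g1) = s.act (t.act f) - s.act (t.act (s.act f)) := by
    have := congrArg s.act e6
    rw [map_mul, map_sub, map_add, hsa, hsb] at this
    linear_combination this
  linear_combination b * (a + b) * e3 + (a + b) * e2 - b * e5 + e1 - e6 + e7

theorem divDiff'_braid {s t : SimpleRefl n} (h : s.root ⬝ᵥ t.root = -1) (f : PolyXY n) :
    s.divDiff' (t.divDiff' (s.divDiff' f)) = t.divDiff' (s.divDiff' (t.divDiff' f)) := by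
  have h' : t.root ⬝ᵥ s.root = -1 := by rw [dotProduct_comm, h]
  have h1 := divDiff'_braid_expand h f
  have h2 := divDiff'_braid_expand h' f
  have h3 : s.act (t.act (s.act f)) = t.act (s.act (t.act f)) := by
    simp only [act_eq_bact, ← bact_mul]
    rw [← mul_assoc, ← mul_assoc, braid_of_dot h]
  have h4 : linForm s.root + linForm t.root ≠ 0 := by
    rw [← linForm_add]
    refine linForm_ne_zero fun h0 => ?_
    have := congrArg height h0
    rw [← sub_neg_eq_add, height_sub, height_neg, height_root, height_root] at this
    simp [height] at this
  refine mul_left_cancel₀ (mul_ne_zero (mul_ne_zero s.linForm_root_ne_zero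
    t.linForm_root_ne_zero) h4) ?_
  rw [h1, h3]
  linear_combination -h2

end SimpleRefl

/-! ### Reduced words and the vanishing criterion -/

theorem divDiffWord_append (a b : List (SimpleRefl n)) (f : PolyXY n) :
    divDiffWord (a ++ b) f = divDiffWord a (divDiffWord b f) := by
  simp [divDiffWord]

theorem divDiffWord_cons (s : SimpleRefl n) (a : List (SimpleRefl n)) (f : PolyXY n) :
    divDiffWord (s :: a) f = s.divDiff' (divDiffWord a f) := rfl

theorem divDiffWord_zero (a : List (SimpleRefl n)) : divDiffWord a (0 : PolyXY n) = 0 := by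
  induction a with
  | nil => rfl
  | cons s a ih => rw [divDiffWord_cons, ih, s.divDiff'_zero]

/-- The composite of divided differences along a reduced word depends only on the product of
the word. -/
theorem divDiffWord_eq_of_reduced (m : ℕ) : ∀ a b : List (SimpleRefl n), a.length = m →
    Reduced a → Reduced b → wordProd a = wordProd b → ∀ f, divDiffWord a f = divDiffWord b f := by
  induction m with
  | zero =>
    intro a b hm ha hb hab f
    have h1 := hb a hab
    rw [hm, Nat.le_zero, List.length_eq_zero_iff] at h1
    rw [List.length_eq_zero_iff] at hm
    rw [hm, h1]
  | succ m ih =>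
    intro a b hm ha hb hab f
    have hlen : b.length = m + 1 := by
      have h1 := hb a hab
      have h2 := ha b hab.symm
      omega
    -- Words with a common last letter: cancel it and use the induction hypothesis.
    have ih' : ∀ (c d : List (SimpleRefl n)) (s : SimpleRefl n), c.length = m →
        Reduced (c ++ [s]) → Reduced (d ++ [s]) → wordProd (c ++ [s]) = wordProd (d ++ [s]) →
        ∀ f, divDiffWord (c ++ [s]) f = divDiffWord (d ++ [s]) f := by
      intro c d s hc h1 h2 h3 f
      rw [wordProd_concat, wordProd_concat] at h3
      rw [divDiffWord_append, divDiffWord_append]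
      exact ih c d hc h1.of_append h2.of_append (mul_right_cancel h3) _
    obtain ⟨a', s, rfl⟩ := List.eq_nil_or_concat' a |>.resolve_left (by rintro rfl; simp at hm)
    obtain ⟨b', t, rfl⟩ := List.eq_nil_or_concat' b |>.resolve_left (by rintro rfl; simp at hlen)
    simp only [List.length_append, List.length_cons, List.length_nil, zero_add,
      Nat.add_right_cancel_iff] at hm hlen
    by_cases hst : s = t
    · subst hst
      exact ih' a' b' s hm ha hb hab f
    have hs := ha.height_neg
    have ht := hb.height_neg
    rw [← hab] at ht
    -- a reduced word ending in `s`, `t`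
    have key : ∃ a'', wordProd (a'' ++ [s, t]) = wordProd (a' ++ [s]) ∧ a''.length + 1 = m := by
      obtain ⟨l, c, r, h1, h2⟩ := exchange _ t ht
      rcases List.eq_nil_or_concat' r with rfl | ⟨r', d, rfl⟩
      -- The deleted letter is not the final `s`, for that would give `s = t`.
      · exfalso
        have h3 : l = a' := List.append_inj_left' h1 rfl |>.symm
        rw [List.append_nil, h3, wordProd_concat] at h2
        have h4 : s.toBarred * t.toBarred = 1 := by
          have : wordProd a' * (s.toBarred * t.toBarred) = wordProd a' := by
            rw [← mul_assoc]; exact h2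
          simpa using this
        exact hst (SimpleRefl.toBarred_injective
          ((eq_inv_of_mul_eq_one_left h4).trans t.toBarred_inv))
      · have h1' : a' ++ [s] = (l ++ c :: r') ++ [d] := by rw [h1]; simp
        have h3 : d = s := by
          have := List.append_inj_right' h1' rfl
          simpa using this.symm
        have h4 : a' = l ++ c :: r' := List.append_inj_left' h1' rfl
        subst h3
        refine ⟨l ++ r', ?_, ?_⟩
        · have h5 : wordProd (l ++ r' ++ [d, t]) = wordProd (l ++ (r' ++ [d])) * t.toBarred := by
            rw [← wordProd_concat]
            simp
          rw [h5, ← h2, mul_assoc, t.toBarred_mul_self, mul_one]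
        · rw [← hm, h4]
          simp
          omega
    obtain ⟨a'', hp, hl⟩ := key
    have hred : Reduced (a'' ++ [s, t]) := ha.congr hp (by simp; omega)
    have e1 : divDiffWord (a'' ++ [s, t]) f = divDiffWord (b' ++ [t]) f := by
      have h1 : a'' ++ [s, t] = (a'' ++ [s]) ++ [t] := by simp
      rw [h1] at hred hp ⊢
      exact ih' _ _ t (by simp; omega) hred hb (hp.trans hab) f
    rw [← e1]
    rcases s.root_dot_root_of_ne t hst with hd | hd
    · have hp2 : wordProd (a'' ++ [t] ++ [s]) = wordProd (a' ++ [s]) := by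
        rw [← hp, wordProd_concat, wordProd_concat, wordProd_append]
        simp only [wordProd, List.map_cons, List.map_nil, List.prod_cons, List.prod_nil, mul_one]
        rw [mul_assoc, SimpleRefl.commute_of_dot hd]
      rw [ih' a' (a'' ++ [t]) s hm ha (ha.congr hp2 (by simp; omega)) hp2.symm]
      simp only [divDiffWord_append]
      exact congrArg _ (SimpleRefl.divDiff'_comm (by rw [dotProduct_comm, hd]) f)
    -- When the roots do not commute, a second exchange produces a word ending in `s, t, s`, to
    -- which a braid move applies. The deleted letter lies in `a''`: deleting either of the last two
    -- would force `s = t`, in one case by the braid relation.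
    · have key2 : ∃ a₃, wordProd (a₃ ++ [s, t, s]) = wordProd (a' ++ [s]) ∧
          a₃.length + 2 = m := by
        have hs' := hs
        rw [← hp] at hs'
        obtain ⟨l, c, r, h1, h2⟩ := exchange _ s hs'
        rcases List.eq_nil_or_concat' r with rfl | ⟨r', d, rfl⟩
        · exfalso
          have h1' : (a'' ++ [s]) ++ [t] = l ++ [c] := by rw [← h1]; simp
          have h3 : l = a'' ++ [s] := (List.append_inj_left' h1' rfl).symm
          rw [List.append_nil, h3] at h2
          have h4 : wordProd (a'' ++ [s]) * (t.toBarred * s.toBarred) =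
              wordProd (a'' ++ [s]) := by
            rw [← mul_assoc, ← wordProd_concat]
            simpa using h2
          rw [mul_eq_left] at h4
          exact hst (SimpleRefl.toBarred_injective
            ((eq_inv_of_mul_eq_one_left h4).trans s.toBarred_inv)).symm
        · have h1' : (a'' ++ [s]) ++ [t] = (l ++ c :: r') ++ [d] := by
            rw [List.append_assoc, List.append_assoc]
            simpa using h1
          have h3 : d = t := by
            have := List.append_inj_right' h1' rfl
            simpa using this.symm
          have h4 : a'' ++ [s] = l ++ c :: r' := List.append_inj_left' h1' rfl
          subst h3
          rcases List.eq_nil_or_concat' r' with rfl | ⟨r'', d', rfl⟩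
          · exfalso
            have h5 : l = a'' := (List.append_inj_left' h4 rfl).symm
            subst h5
            simp only [wordProd_append, List.nil_append] at h2
            simp only [wordProd, List.map_cons, List.map_nil, List.prod_cons, List.prod_nil,
              mul_one, mul_assoc] at h2
            have h6 := mul_left_cancel h2
            have h7 := SimpleRefl.braid_of_dot hd
            rw [mul_assoc, h6, mul_assoc] at h7
            exact hst (SimpleRefl.toBarred_injective
              ((eq_inv_of_mul_eq_one_left (mul_eq_left.mp h7.symm)).trans d.toBarred_inv))
          · have h4' : a'' ++ [s] = (l ++ c :: r'') ++ [d'] := by rw [h4]; simp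
            have h5 : d' = s := by
              have := List.append_inj_right' h4' rfl
              simpa using this.symm
            have h6 : a'' = l ++ c :: r'' := List.append_inj_left' h4' rfl
            subst h5
            refine ⟨l ++ r'', ?_, ?_⟩
            · have h7 : wordProd (l ++ r'' ++ [d', d, d']) =
                  wordProd (l ++ (r'' ++ [d'] ++ [d])) * d'.toBarred := by
                rw [← wordProd_concat]
                simp
              rw [h7, ← h2, mul_assoc, d'.toBarred_mul_self, mul_one, hp]
            · rw [← hl, h6]
              simp
              omega
      obtain ⟨a₃, hp3, hl3⟩ := key2
      have hp3' : wordProd (a₃ ++ [s, t] ++ [s]) = wordProd (a' ++ [s]) := by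
        rw [← hp3]
        simp
      have hp4 : wordProd (a₃ ++ [t, s] ++ [t]) = wordProd (a' ++ [s]) := by
        rw [← hp3]
        simp only [wordProd, List.map_append, List.prod_append, List.map_cons, List.map_nil,
          List.prod_cons, List.prod_nil, mul_one, mul_assoc]
        rw [← mul_assoc t.toBarred, ← SimpleRefl.braid_of_dot hd, mul_assoc]
      rw [ih' a' (a₃ ++ [s, t]) s hm ha (ha.congr hp3' (by simp; omega)) hp3'.symm]
      have h1 : a'' ++ [s, t] = (a'' ++ [s]) ++ [t] := by simp
      rw [h1] at hred hp ⊢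
      rw [ih' (a'' ++ [s]) (a₃ ++ [t, s]) t (by simp; omega) hred
        (ha.congr hp4 (by simp; omega)) (hp.trans hp4.symm)]
      simp only [divDiffWord_append]
      exact congrArg _ (SimpleRefl.divDiff'_braid hd f)

/-- Take the first letter from the left at which reducedness fails. The reduced word before it can
be rewritten to end in the same letter, and divided differences have square zero. The letters to the
right only change the argument. -/
theorem divDiffWord_eq_zero_of_not_reduced (a : List (SimpleRefl n)) (h : ¬ Reduced a)
    (f : PolyXY n) : divDiffWord a f = 0 := by
  induction a using List.reverseRecOn generalizing f with
  | nil => exact absurd (fun b _ => Nat.zero_le _) h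
  | append_singleton a s ih =>
    by_cases ha : Reduced a
    · rw [divDiffWord_append]
      have h1 : height ((wordProd a).vec s.root) < 0 :=
        lt_of_not_ge fun h2 => h (reduced_concat ha
          (lt_of_le_of_ne h2 (height_vec_root_ne_zero _ _).symm))
      obtain ⟨l, c, r, h2, h3⟩ := exchange a s h1
      have h4 : wordProd (l ++ r ++ [s]) = wordProd a := by
        rw [wordProd_concat, ← h3, mul_assoc, s.toBarred_mul_self, mul_one]
      have h5 : Reduced (l ++ r ++ [s]) := ha.congr h4 (by rw [h2]; simp)
      rw [divDiffWord_eq_of_reduced _ a (l ++ r ++ [s]) rfl ha h5 h4.symm, divDiffWord_append]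
      simp only [divDiffWord, List.foldr_cons, List.foldr_nil, s.divDiff'_divDiff']
      exact divDiffWord_zero _
    · rw [divDiffWord_append, ih ha]

/-- The operator `∂'_w` may be computed along any word of `w` whose operator is not zero. -/
theorem divDiffWeyl_eq (w : WeylD n) {a : List (SimpleRefl n)}
    (ha : wordProd a = (w : BarredPerm n)) {g : PolyXY n} (hg : divDiffWord a g ≠ 0)
    (f : PolyXY n) : divDiffWeyl w f = divDiffWord a f := by
  have h1 : Reduced a := by
    by_contra h
    exact hg (divDiffWord_eq_zero_of_not_reduced a h g)
  have h2 := Classical.choose_spec (exists_reducedWord w)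
  refine divDiffWord_eq_of_reduced _ _ a rfl (fun b hb => h2.2 b (hb.trans h2.1)) h1
    (h2.1.trans ha.symm) f

end Operators

end TypeD

end

noncomputable section

namespace TypeD

open Finset

/-! ### Chains of divided differences -/

section Chains

variable {n : ℕ}

/-- The variable `x_{i+1}`, or `0` if `i ≥ n`. -/
def xn (i : ℕ) : PolyXY n := if h : i < n then xvar ⟨i, h⟩ else 0

theorem xn_of_lt {i : ℕ} (h : i < n) : (xn i : PolyXY n) = xvar ⟨i, h⟩ := dif_pos h

/-- The polynomials in `Y` alone. -/
def constRing (n : ℕ) : Subalgebra ZHalf (PolyXY n) :=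
  (MvPolynomial.rename (R := ZHalf) (Sum.inr : Fin n → Fin n ⊕ Fin n)).range

theorem yvar_mem_constRing (j : Fin n) : yvar j ∈ constRing n :=
  ⟨MvPolynomial.X j, by simp [yvar]⟩

theorem bact_of_mem_constRing {f : PolyXY n} (hf : f ∈ constRing n) (w : BarredPerm n) :
    bact w f = f := by
  obtain ⟨g, rfl⟩ := hf
  have h : (bact w).comp (MvPolynomial.rename Sum.inr) = MvPolynomial.rename Sum.inr := by
    apply MvPolynomial.algHom_ext
    intro j
    simp [bact, yvar]
  exact DFunLike.congr_fun h g

/-- The degree in the variable `x_{j+1}`. -/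
def degX (j : ℕ) (f : PolyXY n) : ℕ :=
  if h : j < n then f.degreeOf (Sum.inl ⟨j, h⟩) else 0

theorem degX_mul_le (j : ℕ) (f g : PolyXY n) : degX j (f * g) ≤ degX j f + degX j g := by
  unfold degX
  split_ifs
  · exact MvPolynomial.degreeOf_mul_le _ _ _
  · simp

theorem degX_sub_le (j : ℕ) (f g : PolyXY n) : degX j (f - g) ≤ max (degX j f) (degX j g) := by
  unfold degX
  split_ifs
  · exact MvPolynomial.degreeOf_sub_le _ _ _
  · simp

theorem degX_prod_le {ι : Type*} (j : ℕ) (S : Finset ι) (f : ι → PolyXY n) :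
    degX j (∏ i ∈ S, f i) ≤ ∑ i ∈ S, degX j (f i) := by
  unfold degX
  split_ifs
  · exact MvPolynomial.degreeOf_prod_le _ _ _
  · simp

theorem degX_mul_eq {j : ℕ} {f g : PolyXY n} (hf : f ≠ 0) (hg : g ≠ 0) :
    degX j (f * g) = degX j f + degX j g := by
  unfold degX
  split_ifs
  · exact MvPolynomial.degreeOf_mul_eq hf hg
  · simp

theorem degX_xn (i j : ℕ) : degX j (xn i : PolyXY n) ≤ if i = j then 1 else 0 := by
  unfold degX xn
  split_ifs with h1 h2 h3 h3
  · subst h3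
    rw [xvar, MvPolynomial.degreeOf_X, if_pos rfl]
  · rw [xvar, MvPolynomial.degreeOf_X, if_neg (by simpa using fun h => h3 h.symm)]
  all_goals simp

theorem degX_of_mem_constRing {f : PolyXY n} (hf : f ∈ constRing n) (j : ℕ) : degX j f = 0 := by
  classical
  obtain ⟨g, rfl⟩ := hf
  unfold degX
  split_ifs with h
  · change MvPolynomial.degreeOf _ (MvPolynomial.rename Sum.inr g) = 0
    rw [MvPolynomial.degreeOf_def, Multiset.count_eq_zero]
    intro hmem
    have h1 : (Sum.inl ⟨j, h⟩ : Fin n ⊕ Fin n) ∈ (MvPolynomial.rename Sum.inr g).vars := by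
      rw [MvPolynomial.vars_def, Multiset.mem_toFinset]
      exact hmem
    have h2 := MvPolynomial.vars_rename Sum.inr g h1
    simp at h2
  · rfl

/-- The transposition of `x_{i+1}` and `x_{i+2}`, or the identity if `i + 1 ≥ n`. -/
def sw (i : ℕ) : PolyXY n →ₐ[ZHalf] PolyXY n :=
  if h : i + 1 < n then (SimpleRefl.adj i h).act else AlgHom.id _ _

/-- The divided difference `∂'_{i+1}`, or `0` if `i + 1 ≥ n`. -/
def dd (i : ℕ) (f : PolyXY n) : PolyXY n :=
  if h : i + 1 < n then (SimpleRefl.adj i h).divDiff' f else 0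

theorem sw_of_lt {i : ℕ} (h : i + 1 < n) : (sw i : PolyXY n →ₐ[ZHalf] PolyXY n) =
    (SimpleRefl.adj i h).act := dif_pos h

theorem dd_of_lt {i : ℕ} (h : i + 1 < n) (f : PolyXY n) :
    dd i f = (SimpleRefl.adj i h).divDiff' f := dif_pos h

theorem sw_of_mem_constRing {f : PolyXY n} (hf : f ∈ constRing n) (i : ℕ) : sw i f = f := by
  unfold sw
  split_ifs
  · exact bact_of_mem_constRing hf _
  · rfl

theorem linForm_root_adj {i : ℕ} (h : i + 1 < n) :
    linForm (SimpleRefl.adj i h).root = xn (i + 1) - xn i := by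
  rw [xn_of_lt h, xn_of_lt (by omega : i < n)]
  simp [linForm, SimpleRefl.root, Pi.single_apply, sub_mul, Finset.sum_sub_distrib]

theorem sub_mul_dd {i : ℕ} (h : i + 1 < n) (f : PolyXY n) :
    (xn (i + 1) - xn i) * dd i f = f - sw i f := by
  rw [← linForm_root_adj h, dd_of_lt h, sw_of_lt h, SimpleRefl.root_mul_divDiff']

theorem xn_sub_ne_zero {i : ℕ} (h : i + 1 < n) : (xn (i + 1) - xn i : PolyXY n) ≠ 0 := by
  rw [← linForm_root_adj h]
  exact SimpleRefl.linForm_root_ne_zero _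

theorem dd_unique {i : ℕ} (h : i + 1 < n) {f g : PolyXY n}
    (hg : (xn (i + 1) - xn i) * g = f - sw i f) : dd i f = g :=
  mul_left_cancel₀ (xn_sub_ne_zero h) ((sub_mul_dd h f).trans hg.symm)

theorem dd_add (i : ℕ) (f g : PolyXY n) : dd i (f + g) = dd i f + dd i g := by
  unfold dd
  split_ifs
  · exact SimpleRefl.divDiff'_add _ _ _
  · simp

theorem dd_mul (i : ℕ) (f g : PolyXY n) : dd i (f * g) = dd i f * g + sw i f * dd i g := by
  unfold dd sw
  split_ifs
  · exact SimpleRefl.divDiff'_mul _ _ _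
  · simp

theorem dd_of_sw_eq {i : ℕ} {f : PolyXY n} (h : sw i f = f) : dd i f = 0 := by
  unfold dd
  unfold sw at h
  split_ifs with h1
  · rw [dif_pos h1] at h
    exact SimpleRefl.divDiff'_of_act_eq _ h
  · rfl

theorem dd_mul_of_sw_eq {i : ℕ} {f : PolyXY n} (h : sw i f = f) (g : PolyXY n) :
    dd i (f * g) = f * dd i g := by
  rw [dd_mul, dd_of_sw_eq h, h]
  ring

theorem dd_zero (i : ℕ) : dd i (0 : PolyXY n) = 0 := dd_of_sw_eq (map_zero _)

theorem sw_dd_of_sw_eq {i j : ℕ} (hij : i + 2 ≤ j) {f : PolyXY n} (h : sw j f = f) :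
    sw j (dd i f) = dd i f := by
  by_cases h2 : j + 1 < n
  · have h1 : i + 1 < n := by omega
    rw [sw_of_lt h2] at h ⊢
    rw [dd_of_lt h1, SimpleRefl.act_divDiff'_comm, h]
    simp only [SimpleRefl.root, sub_dotProduct, single_dotProduct, one_mul, Pi.sub_apply,
      Pi.single_apply, Fin.mk.injEq]
    split_ifs <;> omega
  · rw [sw, dif_neg h2]
    rfl

theorem act_adj_xn {i : ℕ} (h : i + 1 < n) (j : ℕ) :
    (SimpleRefl.adj i h).act (xn j) = xn (Equiv.swap i (i + 1) j) := by
  by_cases hj : j < n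
  · have h1 : Equiv.swap i (i + 1) j < n := by
      rw [Equiv.swap_apply_def]
      split_ifs <;> omega
    rw [xn_of_lt hj, xn_of_lt h1, act_eq_bact, bact_xvar]
    simp only [SimpleRefl.toBarred, Units.val_one, Int.cast_one, one_mul]
    congr 1
    ext
    simp only [Equiv.swap_apply_def, Fin.ext_iff]
    split_ifs <;> rfl
  · rw [Equiv.swap_apply_of_ne_of_ne (by omega) (by omega)]
    simp [xn, hj]

theorem sw_xn {i : ℕ} (h : i + 1 < n) (j : ℕ) :
    sw i (xn j : PolyXY n) = xn (Equiv.swap i (i + 1) j) := by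
  rw [sw_of_lt h, act_adj_xn]

theorem degX_sw {i : ℕ} (h : i + 1 < n) (j : ℕ) (f : PolyXY n) :
    degX j (sw i f) = degX (Equiv.swap i (i + 1) j) f := by
  have h0 : sw i f = MvPolynomial.rename
      (Sum.map (Equiv.swap (⟨i, by omega⟩ : Fin n) ⟨i + 1, h⟩) id) f := by
    have h1 : (sw i : PolyXY n →ₐ[ZHalf] PolyXY n) = MvPolynomial.rename
        (Sum.map (Equiv.swap (⟨i, by omega⟩ : Fin n) ⟨i + 1, h⟩) id) := by
      rw [sw_of_lt h, act_eq_bact]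
      refine algHom_ext_vars (fun j => ?_) (fun j => ?_)
      · rw [bact_xvar]
        simp [xvar, SimpleRefl.toBarred]
      · rw [bact_yvar]
        simp [yvar]
    rw [h1]
  have hinj : Function.Injective
      (Sum.map (Equiv.swap (⟨i, by omega⟩ : Fin n) ⟨i + 1, h⟩) (id : Fin n → Fin n)) :=
    (Equiv.injective _).sumMap Function.injective_id
  rw [h0]
  unfold degX
  by_cases hj : j < n
  · have h1 : Equiv.swap i (i + 1) j < n := by
      rw [Equiv.swap_apply_def]
      split_ifs <;> omega
    rw [dif_pos hj, dif_pos h1, ← MvPolynomial.degreeOf_rename_of_injective (p := f) hinj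
      (Sum.inl ⟨_, h1⟩)]
    congr 1
    simp only [Sum.map_inl, Sum.inl.injEq]
    rw [eq_comm, ← Equiv.eq_symm_apply, Equiv.symm_swap]
    ext
    simp only [Equiv.swap_apply_def, Fin.ext_iff]
    split_ifs <;> rfl
  · rw [Equiv.swap_apply_of_ne_of_ne (by omega) (by omega), dif_neg hj, dif_neg hj]

theorem degX_xn_sub {i : ℕ} (h : i + 1 < n) {j : ℕ} (hj : j = i ∨ j = i + 1) :
    1 ≤ degX j (xn (i + 1) - xn i : PolyXY n) := by
  by_contra hlt
  have h1 : degX j (xn (i + 1) - xn i : PolyXY n) = 0 := by omega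
  have key : ∀ a b : ℕ, ∀ ha : a < n, b < n → a ≠ b →
      degX a (xn a - xn b : PolyXY n) = 0 → False := by
    intro a b ha hb hab h0
    have h2 : (xn a - xn b : PolyXY n) = xn a + -(xn b) := by ring
    unfold degX at h0
    rw [dif_pos ha, h2, MvPolynomial.degreeOf_add_eq_of_degreeOf_lt, xn_of_lt ha] at h0
    · simp [xvar] at h0
    · rw [MvPolynomial.degreeOf_neg, xn_of_lt ha, xn_of_lt hb, xvar, xvar,
        MvPolynomial.degreeOf_X_self, MvPolynomial.degreeOf_X_of_ne (by simpa using hab)]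
      exact one_pos
  rcases hj with rfl | rfl
  · refine key j (j + 1) (by omega) h (by omega) ?_
    have h3 : (xn j - xn (j + 1) : PolyXY n) = -(xn (j + 1) - xn j) := by ring
    unfold degX at h1 ⊢
    split_ifs at h1 ⊢
    · rwa [h3, MvPolynomial.degreeOf_neg]
    · rfl
  · exact key (i + 1) i h (by omega) (by omega) h1

theorem degX_dd_le {i : ℕ} (j : ℕ) (hj : j ≠ i) (hj' : j ≠ i + 1) (f : PolyXY n) :
    degX j (dd i f) ≤ degX j f := by
  by_cases h : i + 1 < n
  · by_cases h0 : dd i f = 0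
    · rw [h0]
      simp [degX]
    · have h1 := degX_mul_eq (j := j) (xn_sub_ne_zero h) h0
      rw [sub_mul_dd h] at h1
      have h2 := degX_sub_le j f (sw i f)
      rw [degX_sw h, Equiv.swap_apply_of_ne_of_ne hj hj', max_self] at h2
      omega
  · rw [dd, dif_neg h]
    simp [degX]

/-- Multiplying by the denominator raises the degree in either of its variables by at least one, and
the result `f - s f` still has degree at most `d`. -/
theorem degX_dd_lt {i d : ℕ} (h : i + 1 < n) {f : PolyXY n} (h0 : dd i f ≠ 0)
    (h1 : degX i f ≤ d) (h2 : degX (i + 1) f ≤ d) {j : ℕ} (hj : j = i ∨ j = i + 1) :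
    degX j (dd i f) + 1 ≤ d := by
  have h3 := degX_mul_eq (j := j) (xn_sub_ne_zero h) h0
  rw [sub_mul_dd h] at h3
  have h4 := degX_sub_le j f (sw i f)
  rw [degX_sw h] at h4
  have h5 := degX_xn_sub h hj
  rcases hj with rfl | rfl
  · rw [Equiv.swap_apply_left] at h4
    have := max_le h1 h2
    omega
  · rw [Equiv.swap_apply_right] at h4
    have := max_le h2 h1
    omega

/-- The composite `∂'_{i+m} ⋯ ∂'_{i+1}`. -/
def chain : ℕ → ℕ → PolyXY n → PolyXY n
  | _, 0, f => f
  | i, m + 1, f => chain (i + 1) m (dd i f)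

theorem chain_succ' (i m : ℕ) (f : PolyXY n) : chain i (m + 1) f = dd (i + m) (chain i m f) := by
  induction m generalizing i f with
  | zero => rfl
  | succ m ih =>
    rw [chain, ih, chain]
    congr 1
    omega

theorem chain_zero (i m : ℕ) : chain i m (0 : PolyXY n) = 0 := by
  induction m generalizing i with
  | zero => rfl
  | succ m ih => rw [chain, dd_zero, ih]

theorem chain_add (i m : ℕ) (f g : PolyXY n) :
    chain i m (f + g) = chain i m f + chain i m g := by
  induction m generalizing i f g with
  | zero => rfl
  | succ m ih => rw [chain, dd_add, ih, chain, chain]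

theorem chain_sum {ι : Type*} (i m : ℕ) (S : Finset ι) (f : ι → PolyXY n) :
    chain i m (∑ j ∈ S, f j) = ∑ j ∈ S, chain i m (f j) := by
  classical
  induction S using Finset.induction_on with
  | empty => simp [chain_zero]
  | insert j S hj ih => rw [Finset.sum_insert hj, Finset.sum_insert hj, chain_add, ih]

theorem chain_mul_of_sw_eq (i m : ℕ) {f : PolyXY n}
    (h : ∀ j, i ≤ j → j < i + m → sw j f = f) (g : PolyXY n) :
    chain i m (f * g) = f * chain i m g := by
  induction m generalizing i g with
  | zero => rfl
  | succ m ih =>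
    rw [chain, dd_mul_of_sw_eq (h i le_rfl (by omega)), ih _ fun j h1 h2 => h j (by omega) (by omega),
      chain]

theorem sw_chain {i m j : ℕ} (hj : i + m + 1 ≤ j) {f : PolyXY n} (h : sw j f = f) :
    sw j (chain i m f) = chain i m f := by
  induction m generalizing i f with
  | zero => exact h
  | succ m ih => exact ih (by omega) (sw_dd_of_sw_eq (by omega) h)

/-- A chain of divided differences annihilates polynomials of small degrees. -/
theorem chain_eq_zero_of_degX {i m : ℕ} (hm : i + m + 1 < n) {f : PolyXY n}
    (h0 : degX i f ≤ m) (h1 : ∀ j ≤ m, degX (i + 1 + j) f ≤ m - j) : chain i (m + 1) f = 0 := by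
  induction m generalizing i f with
  | zero =>
    rw [chain, chain]
    by_contra h
    have := degX_dd_lt (by omega) h h0 (h1 0 le_rfl) (Or.inl rfl)
    omega
  | succ m ih =>
    rw [chain]
    by_cases hd : dd i f = 0
    · rw [hd, chain_zero]
    -- The degree in the variable shared with the next operator drops by one, so the bounds hold
    -- again for the shorter chain.
    · have h2 := degX_dd_lt (j := i + 1) (by omega) hd h0 (h1 0 (Nat.zero_le _)) (Or.inr rfl)
      refine ih (by omega) (by omega) fun j hj => ?_
      refine (degX_dd_le _ (by omega) (by omega) f).trans ?_
      have h3 := h1 (j + 1) (by omega)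
      rw [show i + 1 + 1 + j = i + 1 + (j + 1) by omega]
      omega

theorem xn_pow_succ_dd {i : ℕ} (h : i + 1 < n) (a : ℕ) :
    dd i (xn i ^ a : PolyXY n) = -∑ c ∈ range a, xn i ^ (a - 1 - c) * xn (i + 1) ^ c := by
  refine dd_unique h ?_
  rw [map_pow, sw_xn h, Equiv.swap_apply_left]
  have h1 := Commute.geom_sum₂_mul (Commute.all (xn (i + 1) : PolyXY n) (xn i)) a
  have h2 : ∑ c ∈ range a, (xn i : PolyXY n) ^ (a - 1 - c) * xn (i + 1) ^ c =
      ∑ c ∈ range a, (xn (i + 1) : PolyXY n) ^ c * xn i ^ (a - 1 - c) :=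
    Finset.sum_congr rfl fun _ _ => mul_comm _ _
  rw [h2]
  linear_combination -h1

theorem sw_xn_of_ne {i j : ℕ} (h1 : j ≠ i) (h2 : j ≠ i + 1) : sw i (xn j : PolyXY n) = xn j := by
  by_cases h : i + 1 < n
  · rw [sw_xn h, Equiv.swap_apply_of_ne_of_ne h1 h2]
  · rw [sw, dif_neg h]
    rfl

theorem degX_pow_xn_le (i j a : ℕ) : degX j (xn i ^ a : PolyXY n) ≤ if i = j then a else 0 := by
  have h := degX_prod_le j (range a) (fun _ => (xn i : PolyXY n))
  rw [Finset.prod_const, Finset.sum_const, card_range, smul_eq_mul] at h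
  have h1 := degX_xn (n := n) i j
  split_ifs at h1 ⊢ with h2
  · nlinarith
  · have : degX j (xn i : PolyXY n) = 0 := by omega
    rw [this] at h
    omega

theorem chain_xn_pow_of_lt {i m a : ℕ} (hm : i + m < n) (ha : a < m) :
    chain i m (xn i ^ a : PolyXY n) = 0 := by
  obtain ⟨m, rfl⟩ : ∃ k, m = k + 1 := ⟨m - 1, by omega⟩
  refine chain_eq_zero_of_degX (by omega) ?_ fun j hj => ?_
  · have := degX_pow_xn_le (n := n) i i a
    rw [if_pos rfl] at this
    omega
  · have := degX_pow_xn_le (n := n) i (i + 1 + j) a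
    rw [if_neg (by omega)] at this
    omega

/-- The first operator gives minus the complete homogeneous polynomial in two variables. Only its
top power of `xn (i + 1)` survives the rest of the chain, so each operator contributes a factor
`-1`. -/
theorem chain_xn_pow_self {i m : ℕ} (hm : i + m < n) :
    chain i m (xn i ^ m : PolyXY n) = (-1) ^ m := by
  induction m generalizing i with
  | zero => simp [chain]
  | succ m ih =>
    rw [chain, xn_pow_succ_dd (by omega), ← neg_one_mul, chain_mul_of_sw_eq _ _
      (fun j _ _ => by simp), chain_sum, Finset.sum_range_succ, Finset.sum_eq_zero, zero_add]
    · rw [chain_mul_of_sw_eq _ _ (fun j h1 h2 => by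
        rw [map_pow, sw_xn_of_ne (by omega) (by omega)]), ih (by omega)]
      simp
      ring
    · intro c hc
      rw [chain_mul_of_sw_eq _ _ (fun j h1 h2 => by
        rw [map_pow, sw_xn_of_ne (by omega) (by omega)]), chain_xn_pow_of_lt (by omega)
        (mem_range.mp hc), mul_zero]

end Chains

/-! ### Staircase products -/

section Staircase

variable {n : ℕ} (z : ℕ → PolyXY n)

/-- `(x_{i+1} - z_1) ⋯ (x_{i+1} - z_d)`. -/
def rowProd (d i : ℕ) : PolyXY n := ∏ l ∈ range d, (xn i - z l)

/-- `∏_i (x_{i+1} - z_1) ⋯ (x_{i+1} - z_{d-i})`. -/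
def stairProd (d : ℕ) : PolyXY n := ∏ j ∈ range n, rowProd z (d - j) j

theorem rowProd_zero (i : ℕ) : rowProd z 0 i = 1 := by simp [rowProd]

theorem stairProd_zero : stairProd z 0 = 1 := by
  simp [stairProd, rowProd_zero]

variable {z}

theorem sw_rowProd (hz : ∀ l, z l ∈ constRing n) {i : ℕ} (h : i + 1 < n) (d j : ℕ) :
    sw i (rowProd z d j) = rowProd z d (Equiv.swap i (i + 1) j) := by
  simp only [rowProd, map_prod, map_sub, sw_xn h, sw_of_mem_constRing (hz _)]

theorem degX_rowProd (hz : ∀ l, z l ∈ constRing n) (d i j : ℕ) :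
    degX j (rowProd z d i) ≤ if i = j then d else 0 := by
  refine (degX_prod_le _ _ _).trans ?_
  have h : ∀ l ∈ range d, degX j (xn i - z l) ≤ if i = j then 1 else 0 := fun l _ =>
    (degX_sub_le _ _ _).trans (max_le (degX_xn i j) (by rw [degX_of_mem_constRing (hz l)]; simp))
  refine (Finset.sum_le_sum h).trans ?_
  split_ifs <;> simp

/-- The staircase product without its first row, the first `i` of the other rows being shifted. -/
def shiftedStair (z : ℕ → PolyXY n) (e i : ℕ) : PolyXY n :=
  (∏ j ∈ range i, rowProd z (e - (j + 1)) j) * ∏ j ∈ Ico (i + 1) n, rowProd z (e - j) j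

theorem sw_shiftedStair (hz : ∀ l, z l ∈ constRing n) (e : ℕ) {i : ℕ} (h : i + 1 < n) :
    sw i (shiftedStair z e i) = shiftedStair z e (i + 1) := by
  rw [shiftedStair, shiftedStair, map_mul, map_prod, map_prod,
    Finset.prod_eq_prod_Ico_succ_bot h, sw_rowProd hz h, Equiv.swap_apply_right,
    Finset.prod_range_succ, mul_assoc]
  refine congrArg₂ (· * ·) ?_ (congrArg₂ (· * ·) rfl ?_)
  · refine Finset.prod_congr rfl fun j hj => ?_
    have := mem_range.mp hj
    rw [sw_rowProd hz h, Equiv.swap_apply_of_ne_of_ne (by omega) (by omega)]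
  · refine Finset.prod_congr rfl fun j hj => ?_
    have := mem_Ico.mp hj
    rw [sw_rowProd hz h, Equiv.swap_apply_of_ne_of_ne (by omega) (by omega)]

theorem degX_shiftedStair (hz : ∀ l, z l ∈ constRing n) (e i j : ℕ) (hj : i ≤ j) :
    degX j (shiftedStair z e i) ≤ if j = i then 0 else e - j := by
  refine (degX_mul_le _ _ _).trans ?_
  have h1 : degX j (∏ j ∈ range i, rowProd z (e - (j + 1)) j) ≤ 0 := by
    refine (degX_prod_le _ _ _).trans (le_of_eq (Finset.sum_eq_zero fun a ha => ?_))
    have h2 := degX_rowProd hz (e - (a + 1)) a j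
    have := mem_range.mp ha
    rw [if_neg (by omega)] at h2
    omega
  have h2 : degX j (∏ j ∈ Ico (i + 1) n, rowProd z (e - j) j) ≤ if j = i then 0 else e - j := by
    refine (degX_prod_le _ _ _).trans ((Finset.sum_le_sum fun a _ =>
      degX_rowProd hz (e - a) a j).trans ?_)
    rw [Finset.sum_ite_eq' (Ico (i + 1) n) j (fun a => e - a), ]
    split_ifs with h3 h4 h4
    · rw [mem_Ico] at h3
      omega
    all_goals omega
  omega

/-- Divided differences of a staircase product times a symmetric polynomial only shift the rows
beyond the first. -/
theorem chain_shiftedStair_mul (hz : ∀ l, z l ∈ constRing n) {e m : ℕ} (he : e ≤ m) (hm : m < n)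
    {h : PolyXY n} (hs : ∀ j, 1 ≤ j → j < m → sw j h = h) :
    chain 0 m (shiftedStair z e 0 * h) = stairProd z (e - 1) * chain 0 m h := by
  -- After `i` operators, the staircase rows have moved past `i` variables, and the operators have
  -- acted on `h` alone.
  have key : ∀ i ≤ m, chain 0 m (shiftedStair z e 0 * h) =
      chain i (m - i) (shiftedStair z e i * chain 0 i h) := by
    intro i hi
    induction i with
    | zero => rfl
    | succ i ih =>
      have hsw : ∀ j, i < j → j < m → sw j (chain 0 i h) = chain 0 i h := fun j h1 h2 =>
        sw_chain (by omega) (hs j (by omega) h2)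
      rw [ih (by omega), show m - i = (m - (i + 1)) + 1 by omega, chain, dd_mul, chain_add,
        sw_shiftedStair hz e (by omega), chain_succ' 0 i h, zero_add, mul_comm (dd i _),
        chain_mul_of_sw_eq _ _ (fun j h1 h2 => hsw j (by omega) (by omega))]
      -- The Leibniz term in which the operator hits the staircase. That staircase has degree `0` in
      -- `xn i` and at most `e - j` in `xn j` for `j > i`, which is too small to survive the chain.
      have h0 : chain (i + 1) (m - (i + 1)) (dd i (shiftedStair z e i)) = 0 := by
        have h1 := chain_eq_zero_of_degX (i := i) (m := m - (i + 1)) (by omega)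
          (f := shiftedStair z e i)
          (by
            have := degX_shiftedStair hz e i i le_rfl
            rw [if_pos rfl] at this
            omega)
          (fun j hj => by
            have := degX_shiftedStair hz e i (i + 1 + j) (by omega)
            rw [if_neg (by omega)] at this
            omega)
        rwa [chain] at h1
      rw [h0, mul_zero, zero_add]
  rw [key m le_rfl, Nat.sub_self, chain]
  congr 1
  rw [shiftedStair, stairProd, Finset.range_eq_Ico, Finset.range_eq_Ico,
    ← Finset.prod_Ico_consecutive _ (Nat.zero_le m) hm.le]
  congr 1
  · exact Finset.prod_congr rfl fun j _ => by rw [Nat.sub_sub, add_comm 1 j]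
  · rw [Finset.prod_eq_one, Finset.prod_eq_one]
    · intro j hj
      have := mem_Ico.mp hj
      rw [show e - 1 - j = 0 by omega, rowProd_zero]
    · intro j hj
      have := mem_Ico.mp hj
      rw [show e - j = 0 by omega, rowProd_zero]

theorem stairProd_eq (hn : 0 < n) (e : ℕ) :
    stairProd z e = shiftedStair z e 0 * rowProd z e 0 := by
  rw [stairProd, shiftedStair, Finset.range_eq_Ico, Finset.prod_eq_prod_Ico_succ_bot hn,
    mul_comm]
  simp

/-- Only the leading power of `xn 0` counts: replacing a factor `xn 0 - z d` by `xn 0` changes the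
row by terms of degree below `m`, which the chain kills. -/
theorem chain_rowProd (hz : ∀ l, z l ∈ constRing n) {m : ℕ} (hm : m < n) :
    chain 0 m (rowProd z m 0) = (-1) ^ m := by
  have key : ∀ d ≤ m, chain 0 m (xn 0 ^ (m - d) * rowProd z d 0) = (-1) ^ m := by
    intro d
    induction d with
    | zero =>
      intro _
      rw [rowProd_zero, mul_one, Nat.sub_zero, chain_xn_pow_self (by omega)]
    | succ d ih =>
      intro hd
      have h1 : xn 0 ^ (m - (d + 1)) * rowProd z (d + 1) 0 = xn 0 ^ (m - d) * rowProd z d 0 +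
          -z d * (xn 0 ^ (m - (d + 1)) * rowProd z d 0) := by
        rw [rowProd, Finset.prod_range_succ, show m - d = m - (d + 1) + 1 by omega, rowProd]
        ring
      rw [h1, chain_add, ih (by omega), chain_mul_of_sw_eq _ _ (fun j _ _ => by
        rw [map_neg, sw_of_mem_constRing (hz d)])]
      have h2 : chain 0 m (xn 0 ^ (m - (d + 1)) * rowProd z d 0) = 0 := by
        obtain ⟨k, rfl⟩ : ∃ k, m = k + 1 := ⟨m - 1, by omega⟩
        refine chain_eq_zero_of_degX (by omega) ?_ fun j hj => ?_
        · refine (degX_mul_le _ _ _).trans ?_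
          have h3 := degX_pow_xn_le (n := n) 0 0 (k + 1 - (d + 1))
          have h4 := degX_rowProd hz d 0 0
          rw [if_pos rfl] at h3 h4
          omega
        · refine (degX_mul_le _ _ _).trans ?_
          have h3 := degX_pow_xn_le (n := n) 0 (0 + 1 + j) (k + 1 - (d + 1))
          have h4 := degX_rowProd hz d 0 (0 + 1 + j)
          rw [if_neg (by omega)] at h3 h4
          omega
      rw [h2, mul_zero, add_zero]
  have := key m le_rfl
  rwa [Nat.sub_self, pow_zero, one_mul] at this

/-- Invariance under permutations of the variables `X`. -/
def IsSymmX (f : PolyXY n) : Prop := ∀ i, sw i f = f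

/-- The step that removes the first row of a staircase product. -/
theorem chain_stairProd_mul (hz : ∀ l, z l ∈ constRing n) {e : ℕ} (he : e < n) {Q : PolyXY n}
    (hQ : IsSymmX Q) : chain 0 e (stairProd z e * Q) = (-1) ^ e * (stairProd z (e - 1) * Q) := by
  have h1 : stairProd z e * Q = Q * (shiftedStair z e 0 * rowProd z e 0) := by
    rw [stairProd_eq (by omega)]
    ring
  rw [h1, chain_mul_of_sw_eq _ _ fun j _ _ => hQ j, chain_shiftedStair_mul hz le_rfl he,
    chain_rowProd hz he]
  · ring
  · intro j h1 h2
    rw [sw_rowProd hz (by omega), Equiv.swap_apply_of_ne_of_ne (by omega) (by omega)]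

end Staircase

/-! ### The sign change of the first variable -/

section Flip

variable {n : ℕ}

/-- The barred permutation `(1̄, 2, …, n)`. -/
def flipOne (n : ℕ) : BarredPerm n := ⟨1, fun j => if (j : ℕ) = 0 then -1 else 1⟩

theorem flipOne_mul_self : flipOne n * flipOne n = 1 := by
  ext j
  · simp [flipOne, BarredPerm.mul_perm, BarredPerm.one_perm]
  · simp only [flipOne, BarredPerm.mul_sign, BarredPerm.one_sign, Equiv.Perm.one_apply]
    by_cases h : (j : ℕ) = 0 <;> simp [h]

theorem bact_flipOne_xn (j : ℕ) :
    bact (flipOne n) (xn j) = if j = 0 then -xn j else xn j := by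
  unfold xn
  by_cases hj : j < n
  · rw [dif_pos hj, bact_xvar]
    by_cases h0 : j = 0
    · simp [flipOne, h0]
    · simp [flipOne, h0]
  · rw [dif_neg hj]
    simp

/-- The exchange of `s_1` and `s_□`. -/
def SimpleRefl.twist : SimpleRefl n → SimpleRefl n
  | adj i h => if i = 0 then box (by omega) else adj i h
  | box h => adj 0 h

theorem flipOne_vec_root (s : SimpleRefl n) : (flipOne n).vec s.root = s.twist.root := by
  have hinv : (flipOne n)⁻¹ = flipOne n := inv_eq_of_mul_eq_one_left flipOne_mul_self
  ext j
  rw [BarredPerm.vec, hinv]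
  cases s with
  | adj i h =>
    by_cases h0 : i = 0
    · subst h0
      simp only [flipOne, SimpleRefl.twist, if_pos, SimpleRefl.root, Equiv.Perm.one_apply,
        Pi.sub_apply, Pi.add_apply, Pi.single_apply, Fin.ext_iff]
      split_ifs <;> simp_all
    · simp only [flipOne, SimpleRefl.twist, h0, if_false, SimpleRefl.root, Equiv.Perm.one_apply,
        Pi.sub_apply, Pi.single_apply, Fin.ext_iff]
      split_ifs <;> simp_all
  | box h =>
    simp only [flipOne, SimpleRefl.twist, SimpleRefl.root, Equiv.Perm.one_apply,
      Pi.sub_apply, Pi.add_apply, Pi.single_apply, Fin.ext_iff]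
    split_ifs <;> simp_all

/-- Whatever carries one simple root to another conjugates the divided differences along with the
reflections. The sign change of `x_1` does so without belonging to the Weyl group. -/
theorem SimpleRefl.bact_divDiff' {g : BarredPerm n} {s t : SimpleRefl n}
    (h : g.vec s.root = t.root) (f : PolyXY n) :
    bact g (s.divDiff' f) = t.divDiff' (bact g f) := by
  refine (t.divDiff'_unique ?_).symm
  have h1 := congrArg (bact g) (s.root_mul_divDiff' f)
  rw [map_mul, bact_linForm, h, map_sub] at h1
  rw [h1, act_eq_bact, act_eq_bact, ← bact_mul, ← bact_mul, mul_toBarred_of_vec_root h]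

end Flip

end TypeD

end

noncomputable section

namespace TypeD

open Finset

/-! ### Ranks in finite sets of natural numbers -/

section Rank

/-- The number of elements of `s` larger than `b`. -/
def rank (s : Finset ℕ) (b : ℕ) : ℕ := #{c ∈ s | b < c}

/-- Stated for a general relation because both decreasing lists (parts) and increasing ones (the
final entries of `w_λ`) occur. -/
theorem getElem?_countP_of_pairwise {α : Type*} {r : α → α → Prop} [DecidableRel r]
    (hr : ∀ a b, r a b → ¬ r b a) : ∀ {L : List α}, L.Pairwise r → ∀ {b : α}, b ∈ L →
      L[L.countP (fun c => decide (r c b))]? = some b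
  | [], _, b, hb => absurd hb List.not_mem_nil
  | a :: L, hL, b, hb => by
    rw [List.pairwise_cons] at hL
    have hbb : ∀ c, ¬ r c c := fun c h => hr c c h h
    rcases List.mem_cons.mp hb with rfl | hb'
    · have h1 : (b :: L).countP (fun c => decide (r c b)) = 0 := by
        rw [List.countP_eq_zero]
        intro c hc
        rcases List.mem_cons.mp hc with rfl | hc'
        · simpa using hbb c
        · simpa using hr _ _ (hL.1 c hc')
      rw [h1]
      rfl
    · rw [List.countP_cons_of_pos (by simpa using hL.1 b hb'), List.getElem?_cons_succ]
      exact getElem?_countP_of_pairwise hr hL.2 hb'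

theorem countP_sort (s : Finset ℕ) (r : ℕ → ℕ → Prop) [DecidableRel r] [Std.Antisymm r]
    [Std.Total r] [IsTrans ℕ r] (p : ℕ → Prop) [DecidablePred p] :
    (s.sort r).countP (fun c => decide (p c)) = #{c ∈ s | p c} := by
  rw [Finset.card_def, Finset.filter_val, ← Multiset.countP_eq_card_filter,
    ← Finset.sort_eq s r, Multiset.coe_countP]

theorem part_rank {s : Finset ℕ} {b : ℕ} (hb : b ∈ s) : part s (rank s b) = b := by
  have h1 : (s.sort (· ≥ ·)).Pairwise (· > ·) := s.sortedGT_sort.pairwise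
  have h2 := getElem?_countP_of_pairwise (r := (· > ·)) (fun a b h => by omega) h1
    (b := b) (by simpa using hb)
  rw [countP_sort s (· ≥ ·) (fun c => c > b)] at h2
  rw [part, List.getD_eq_getElem?_getD, rank, h2]
  rfl

theorem rank_lt_card {s : Finset ℕ} {b : ℕ} (hb : b ∈ s) : rank s b < #s :=
  Finset.card_lt_card ⟨Finset.filter_subset _ _, fun h => by
    have := h hb
    simp at this⟩

theorem rank_lt_rank {s : Finset ℕ} {b c : ℕ} (hc : c ∈ s) (h : b < c) : rank s c < rank s b :=
  Finset.card_lt_card ⟨fun d hd => by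
      simp only [mem_filter] at hd ⊢
      exact ⟨hd.1, by omega⟩, fun h' => by
      have := h' (mem_filter.mpr ⟨hc, h⟩)
      simp at this⟩

theorem rank_injOn (s : Finset ℕ) : Set.InjOn (rank s) s := by
  intro a ha b hb hab
  rcases lt_trichotomy a b with h | h | h
  · have := rank_lt_rank hb h
    omega
  · exact h
  · have := rank_lt_rank ha h
    omega

theorem image_rank (s : Finset ℕ) : s.image (rank s) = range #s := by
  refine Finset.eq_of_subset_of_card_le (fun i hi => ?_) ?_
  · obtain ⟨b, hb, rfl⟩ := Finset.mem_image.mp hi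
    exact mem_range.mpr (rank_lt_card hb)
  · rw [card_range, Finset.card_image_of_injOn (rank_injOn s)]

theorem exists_rank_eq {s : Finset ℕ} {i : ℕ} (hi : i < #s) : ∃ b ∈ s, rank s b = i := by
  have := mem_range.mpr hi
  rwa [← image_rank, Finset.mem_image] at this

theorem part_mem {s : Finset ℕ} {i : ℕ} (hi : i < #s) : part s i ∈ s := by
  obtain ⟨b, hb, rfl⟩ := exists_rank_eq hi
  rwa [part_rank hb]

theorem rank_part {s : Finset ℕ} {i : ℕ} (hi : i < #s) : rank s (part s i) = i := by
  obtain ⟨b, hb, rfl⟩ := exists_rank_eq hi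
  rw [part_rank hb]

theorem part_of_card_le {s : Finset ℕ} {i : ℕ} (hi : #s ≤ i) : part s i = 0 := by
  rw [part, List.getD_eq_default]
  simpa using hi

theorem part_lt_part {s : Finset ℕ} {i j : ℕ} (hij : i < j) (hj : j < #s) :
    part s j < part s i := by
  by_contra h
  rcases (not_lt.mp h).eq_or_lt with h1 | h1
  · have h2 := rank_part (hij.trans hj)
    rw [h1, rank_part hj] at h2
    omega
  · have := rank_lt_rank (part_mem hj) h1
    rw [rank_part hj, rank_part (hij.trans hj)] at this
    omega

theorem sum_range_card_part {M : Type*} [AddCommMonoid M] (s : Finset ℕ) (g : ℕ → ℕ → M) :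
    ∑ i ∈ range #s, g i (part s i) = ∑ b ∈ s, g (rank s b) b := by
  rw [← image_rank, Finset.sum_image (rank_injOn s)]
  exact Finset.sum_congr rfl fun b hb => by rw [part_rank hb]

theorem part_insert_zero {s : Finset ℕ} {M : ℕ} (h : ∀ c ∈ s, c < M) :
    part (insert M s) 0 = M := by
  have h1 : rank (insert M s) M = 0 := by
    rw [rank, Finset.card_eq_zero, Finset.filter_eq_empty_iff]
    intro c hc
    rcases Finset.mem_insert.mp hc with rfl | hc
    · omega
    · have := h c hc
      omega
  rw [← h1, part_rank (mem_insert_self _ _)]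

theorem rank_insert_self {s : Finset ℕ} {M : ℕ} (h : ∀ c ∈ s, c < M) :
    rank (insert M s) M = 0 := by
  have h1 := rank_part (s := insert M s) (i := 0) (by simp)
  rwa [part_insert_zero h] at h1

theorem rank_insert_of_lt {s : Finset ℕ} {M b : ℕ} (h : M ∉ s) (hb : b < M) :
    rank (insert M s) b = rank s b + 1 := by
  rw [rank, Finset.filter_insert, if_pos hb, Finset.card_insert_of_notMem (by simp [h]), rank]

theorem part_insert_succ {s : Finset ℕ} {M : ℕ} (h : ∀ c ∈ s, c < M) (i : ℕ) :
    part (insert M s) (i + 1) = part s i := by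
  have hM : M ∉ s := fun h' => lt_irrefl _ (h M h')
  by_cases hi : i < #s
  · have h1 : rank (insert M s) (part s i) = i + 1 := by
      rw [rank_insert_of_lt hM (h _ (part_mem hi)), rank_part hi]
    rw [← h1, part_rank (mem_insert_of_mem (part_mem hi))]
  · rw [part_of_card_le (by rw [card_insert_of_notMem hM]; omega), part_of_card_le (by omega)]

theorem rank_erase_of_lt {s : Finset ℕ} {b c : ℕ} (hb : b ∈ s) (h : c < b) :
    rank (s.erase b) c + 1 = rank s c := by
  rw [rank, rank, Finset.filter_erase, Finset.card_erase_add_one (by simp [hb, h])]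

theorem rank_erase_of_le {s : Finset ℕ} {b c : ℕ} (h : b ≤ c) :
    rank (s.erase b) c = rank s c := by
  rw [rank, rank, Finset.filter_erase, Finset.erase_eq_of_notMem (by simp; omega)]

theorem part_erase {s : Finset ℕ} {b : ℕ} (hb : b ∈ s) (k : ℕ) :
    part (s.erase b) k = if k < rank s b then part s k else part s (k + 1) := by
  have hcard := Finset.card_erase_of_mem hb
  have hr := rank_lt_card hb
  have hb' := part_rank hb
  split_ifs with hk
  · have h1 : b < part s k := by
      rw [← hb']
      have := part_lt_part hk hr
      rwa [hb'] at this ⊢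
    have h2 : rank (s.erase b) (part s k) = k := by
      rw [rank_erase_of_le h1.le, rank_part (by omega)]
    have h3 := part_rank (s := s.erase b) (b := part s k)
      (mem_erase.mpr ⟨h1.ne', part_mem (by omega)⟩)
    rwa [h2] at h3
  · by_cases hk' : k + 1 < #s
    · have h1 : part s (k + 1) < b := by
        have := part_lt_part (s := s) (i := rank s b) (j := k + 1) (by omega) hk'
        rwa [hb'] at this
      have h2 := rank_erase_of_lt hb h1
      rw [rank_part hk'] at h2
      have h3 := part_rank (s := s.erase b) (b := part s (k + 1))
        (mem_erase.mpr ⟨h1.ne, part_mem hk'⟩)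
      rwa [show rank (s.erase b) (part s (k + 1)) = k by omega] at h3
    · rw [part_of_card_le (by omega), part_of_card_le (by omega)]

end Rank

/-! ### Pfaffians -/

section Pfaffian

variable {R : Type*} [CommRing R]

theorem map_pfaffian {S : Type*} [CommRing S] (φ : R →+* S) (m : ℕ)
    (A : Fin (2 * m) → Fin (2 * m) → R) :
    φ (pfaffian m A) = pfaffian m (fun i j => φ (A i j)) := by
  induction m with
  | zero => simp [pfaffian]
  | succ m ih => simp [pfaffian, map_sum, map_mul, ih]

/-- The Pfaffian of the array `g (u i) (u j)`, `i < j < 2 m`. -/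
def pfaffianSeq (g : ℕ → ℕ → R) (m : ℕ) (u : ℕ → ℕ) : R :=
  pfaffian m (fun i j => g (u i) (u j))

theorem pfaffianSeq_congr (g : ℕ → ℕ → R) {m : ℕ} {u v : ℕ → ℕ} (h : ∀ i < 2 * m, u i = v i) :
    pfaffianSeq g m u = pfaffianSeq g m v := by
  rw [pfaffianSeq, pfaffianSeq]
  congr 1
  funext i j
  rw [h i i.2, h j j.2]

theorem pfaffianSeq_succ (g : ℕ → ℕ → R) (m : ℕ) (u : ℕ → ℕ) :
    pfaffianSeq g (m + 1) u = ∑ j ∈ range (2 * m + 1), (-1) ^ j * g (u 0) (u (j + 1)) *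
      pfaffianSeq g m (fun a => u ((if a < j then a else a + 1) + 1)) := by
  rw [pfaffianSeq, pfaffian, Finset.sum_range]
  refine Finset.sum_congr rfl fun j _ => ?_
  congr 1
  rw [pfaffianSeq]
  have h : ∀ a : Fin (2 * m), ((j.succAbove a).succ : ℕ) =
      (if (a : ℕ) < j then (a : ℕ) else a + 1) + 1 := by
    intro a
    rw [Fin.val_succ]
    congr 1
    simp only [Fin.succAbove, Fin.lt_def, Fin.val_castSucc]
    split_ifs <;> rfl
  congr 1
  funext a b
  rw [h a, h b]

/-- The expansion of Pfaffians indexed by finite sets along the largest element. -/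
structure IsPfaffian (q : ℕ → ℕ → R) (e : ℕ → R) (F : Finset ℕ → R) : Prop where
  empty : F ∅ = 1
  insert_max : ∀ (M : ℕ) (s : Finset ℕ), (∀ c ∈ s, c < M) → 0 ∉ insert M s →
    F (insert M s) = ∑ b ∈ s, (-1) ^ rank s b * q M b * F (s.erase b) +
      if Even #s then e M * F s else 0

theorem isPfaffian_pfaffianSeq (g : ℕ → ℕ → R) :
    IsPfaffian g (fun p => g p 0) (fun s => pfaffianSeq g ((#s + 1) / 2) (part s)) where
  empty := rfl
  insert_max := by
    intro M s hM _
    have hMs : M ∉ s := fun h' => lt_irrefl _ (hM M h')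
    rw [card_insert_of_notMem hMs]
    have hterm : ∀ m : ℕ, ∀ b ∈ s, (#(s.erase b) + 1) / 2 = m →
        pfaffianSeq g m (fun a => part (insert M s) ((if a < rank s b then a else a + 1) + 1)) =
          pfaffianSeq g ((#(s.erase b) + 1) / 2) (part (s.erase b)) := by
      intro m b hb hm
      rw [hm]
      refine pfaffianSeq_congr g fun a _ => ?_
      rw [part_insert_succ hM, part_erase hb]
      split_ifs <;> rfl
    rcases Nat.even_or_odd #s with he | ho
    -- Now `insert M s` has an odd number of parts, and the last column of the Pfaffian belongs to
    -- the padding part `0`; it yields the term `e M * F s`.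
    · obtain ⟨m, hm⟩ := he
      rw [if_pos ⟨m, hm⟩, show (#s + 1 + 1) / 2 = m + 1 by omega, pfaffianSeq_succ,
        Finset.sum_range_succ, show 2 * m = #s by omega]
      congr 1
      · simp only [part_insert_zero hM]
        simp_rw [part_insert_succ hM (_ : ℕ)]
        rw [sum_range_card_part s (fun i b => (-1) ^ i * g M b * pfaffianSeq g m
          (fun a => part s (if a < i then a else a + 1)))]
        refine Finset.sum_congr rfl fun b hb => ?_
        rw [← hterm m b hb (by rw [card_erase_of_mem hb]; have := card_pos.mpr ⟨b, hb⟩; omega)]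
        simp_rw [part_insert_succ hM]
      · rw [part_insert_zero hM, part_insert_succ hM, part_of_card_le le_rfl, Even.neg_one_pow ⟨m, hm⟩,
          one_mul, show (#s + 1) / 2 = m by omega]
        congr 1
        refine pfaffianSeq_congr g fun a ha => ?_
        rw [if_pos (by omega), part_insert_succ hM]
    · have ho' := ho
      obtain ⟨m, hm⟩ := ho
      rw [if_neg (Nat.not_even_iff_odd.mpr ho'), add_zero, show (#s + 1 + 1) / 2 = m + 1 by omega,
        pfaffianSeq_succ, ← hm]
      simp only [part_insert_zero hM]
      simp_rw [part_insert_succ hM (_ : ℕ)]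
      rw [sum_range_card_part s (fun i b => (-1) ^ i * g M b * pfaffianSeq g m
        (fun a => part s (if a < i then a else a + 1)))]
      refine Finset.sum_congr rfl fun b hb => ?_
      rw [← hterm m b hb (by rw [card_erase_of_mem hb]; have := card_pos.mpr ⟨b, hb⟩; omega)]
      simp_rw [part_insert_succ hM]

/-- Once the larger element is gone, the rank of the smaller one drops by one, so the two orders of
removal have opposite signs. -/
theorem neg_one_pow_rank_erase {t : Finset ℕ} {a b : ℕ} (ha : a ∈ t) (hb : b ∈ t) (hab : a ≠ b) :
    (-1 : R) ^ rank t b * (-1) ^ rank (t.erase b) a =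
      -((-1) ^ rank t a * (-1) ^ rank (t.erase a) b) := by
  rcases lt_or_gt_of_ne hab with h | h
  · rw [← rank_erase_of_lt hb h, rank_erase_of_le h.le, pow_succ]
    ring
  · rw [← rank_erase_of_lt ha h, rank_erase_of_le h.le, pow_succ]
    ring

/-- Alternating double sums over ordered pairs of distinct elements are antisymmetric. -/
theorem sum_sum_erase_antisymm (t : Finset ℕ) (H : ℕ → ℕ → R) :
    ∑ b ∈ t, ∑ a ∈ t.erase b, (-1) ^ rank t b * (-1) ^ rank (t.erase b) a * H b a =
      -∑ b ∈ t, ∑ a ∈ t.erase b, (-1) ^ rank t b * (-1) ^ rank (t.erase b) a * H a b := by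
  rw [Finset.sum_comm' (t' := t) (s' := fun a => t.erase a), ← Finset.sum_neg_distrib]
  · refine Finset.sum_congr rfl fun a ha => ?_
    rw [← Finset.sum_neg_distrib]
    refine Finset.sum_congr rfl fun b hb => ?_
    rw [mem_erase] at hb
    rw [neg_one_pow_rank_erase ha hb.2 hb.1.symm]
    ring
  · intro x y
    simp only [mem_erase]
    tauto

theorem sum_sum_erase_eq_zero {t : Finset ℕ} {H : ℕ → ℕ → R}
    (hH : ∀ a b, H a b = H b a) :
    ∑ b ∈ t, ∑ a ∈ t.erase b, (-1) ^ rank t b * (-1) ^ rank (t.erase b) a * H b a = 0 := by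
  rw [Finset.sum_sigma']
  refine Finset.sum_involution (fun p _ => ⟨p.2, p.1⟩) ?_ ?_ ?_ ?_
  · rintro ⟨b, a⟩ h
    simp only [mem_sigma, mem_erase] at h
    simp only
    rw [neg_one_pow_rank_erase h.2.2 h.1 h.2.1, hH a b]
    ring
  · rintro ⟨b, a⟩ h _ heq
    simp only [mem_sigma, mem_erase] at h
    simp only [Sigma.mk.injEq] at heq
    exact h.2.1 heq.1
  · rintro ⟨b, a⟩ h
    simp only [mem_sigma, mem_erase] at h ⊢
    tauto
  · rintro ⟨b, a⟩ _
    rfl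

/-- The effect on Pfaffians of adding an alternating array `X_p e_r - X_r e_p`. -/
theorem IsPfaffian.add_wedge {q : ℕ → ℕ → R} {e : ℕ → R} {F : Finset ℕ → R}
    (hF : IsPfaffian q e F) (m : ℕ) : ∀ (q' : ℕ → ℕ → R) (X : ℕ → R) (F' : Finset ℕ → R),
      IsPfaffian q' X F' → (∀ p r, q' p r = q p r + X p * e r - X r * e p) →
      ∀ s : Finset ℕ, #s = m → 0 ∉ s →
        F' s = (if Even #s then F s else 0) +
          ∑ a ∈ s, (-1) ^ rank s a * X a * F (s.erase a) := by
  -- A wedge has rank two, so it enters a Pfaffian at most once. For even `s` the linear term is the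
  -- Pfaffian bordered by `X` and `e`. For odd `s` the array is already bordered by `X`, which
  -- clears the wedge by row and column operations and leaves the expansion along `X`.
  induction m using Nat.strong_induction_on with
  | _ m ih =>
    intro q' X F' hF' hq s hs h0
    rcases s.eq_empty_or_nonempty with rfl | hne
    · simp [hF.empty, hF'.empty]
    obtain ⟨M, t, hM, rfl⟩ : ∃ M t, (∀ c ∈ t, c < M) ∧ insert M t = s :=
      ⟨s.max' hne, s.erase (s.max' hne), fun c hc => s.lt_max'_of_mem_erase_max' hne hc,
        insert_erase (s.max'_mem hne)⟩
    have hMt : M ∉ t := fun h' => lt_irrefl _ (hM M h')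
    rw [card_insert_of_notMem hMt] at hs
    have h0t : 0 ∉ t := fun h => h0 (mem_insert_of_mem h)
    -- The case `X = e`, in which the wedge vanishes.
    have hself : ∀ u : Finset ℕ, #u < m → 0 ∉ u →
        ∑ a ∈ u, (-1) ^ rank u a * e a * F (u.erase a) = if Even #u then 0 else F u := by
      intro u hu hu0
      have h1 := ih #u hu q e F hF (fun p r => by ring) u rfl hu0
      split_ifs at h1 ⊢
      · linear_combination -h1
      · linear_combination -h1
    have hIH : ∀ u : Finset ℕ, #u < m → 0 ∉ u → F' u = (if Even #u then F u else 0) +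
        ∑ a ∈ u, (-1) ^ rank u a * X a * F (u.erase a) := fun u hu hu0 =>
      ih #u hu q' X F' hF' hq u rfl hu0
    have herase : ∀ a ∈ t, #(t.erase a) + 1 = #t := fun a ha => card_erase_add_one ha
    have heven : ∀ a ∈ t, (Even #(t.erase a) ↔ ¬ Even #t) := by
      intro a ha
      rw [← herase a ha, Nat.even_add_one, not_not]
    have h0e : ∀ a, 0 ∉ t.erase a := fun a h => h0t (mem_of_mem_erase h)
    have hsum : ∑ a ∈ insert M t, (-1) ^ rank (insert M t) a * X a * F ((insert M t).erase a) =
        X M * F t - ∑ a ∈ t, (-1) ^ rank t a * X a * F (insert M (t.erase a)) := by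
      rw [Finset.sum_insert hMt, rank_insert_self hM, erase_insert hMt, pow_zero, one_mul,
        sub_eq_add_neg, ← Finset.sum_neg_distrib]
      congr 1
      refine Finset.sum_congr rfl fun a ha => ?_
      rw [rank_insert_of_lt hMt (hM a ha), erase_insert_of_ne (by rintro rfl; exact hMt ha),
        pow_succ]
      ring
    have hins : ∀ a ∈ t, F (insert M (t.erase a)) =
        ∑ b ∈ t.erase a, (-1) ^ rank (t.erase a) b * q M b * F ((t.erase a).erase b) +
          if Even #t then 0 else e M * F (t.erase a) := by
      intro a ha
      rw [hF.insert_max M _ (fun c hc => hM c (mem_of_mem_erase hc))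
        (fun h => h0 (insert_subset_insert _ (erase_subset _ _) h))]
      congr 1
      by_cases h : Even #t
      · rw [if_neg (by rw [heven a ha]; simpa using h), if_pos h]
      · rw [if_pos (by rw [heven a ha]; exact h), if_neg h]
    have hins' : ∀ a ∈ t, F' (t.erase a) = (if Even #t then 0 else F (t.erase a)) +
        ∑ b ∈ t.erase a, (-1) ^ rank (t.erase a) b * X b * F ((t.erase a).erase b) := by
      intro a ha
      have := herase a ha
      rw [hIH _ (by omega) (h0e a)]
      congr 1
      by_cases h : Even #t
      · rw [if_neg (by rw [heven a ha]; simpa using h), if_pos h]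
      · rw [if_pos (by rw [heven a ha]; exact h), if_neg h]
    have hsymm : ∀ a b, F ((t.erase a).erase b) = F ((t.erase b).erase a) := fun a b => by
      rw [erase_right_comm]
    -- Expansion along the largest element `M` leaves signed double sums over ordered pairs in `t`.
    -- Exchanging the pair reverses the sign, so these sums either match up or cancel.
    have A1 := sum_sum_erase_antisymm t (fun b a => q M b * X a * F ((t.erase b).erase a))
    have A2 := sum_sum_erase_antisymm t (fun b a => e b * X a * F ((t.erase b).erase a))
    have A3 := sum_sum_erase_eq_zero (t := t)
      (H := fun b a => X b * X a * F ((t.erase b).erase a)) (fun a b => by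
        rw [hsymm]; ring)
    have A4 : ∑ b ∈ t, ∑ a ∈ t.erase b, (-1) ^ rank t b * (-1) ^ rank (t.erase b) a *
        (e a * X b * F ((t.erase a).erase b)) =
          ∑ b ∈ t, (-1) ^ rank t b * X b * (if Even #t then F (t.erase b) else 0) := by
      refine Finset.sum_congr rfl fun b hb => ?_
      have h1 := hself (t.erase b) (by have := herase b hb; omega) (h0e b)
      have h2 : (if Even #(t.erase b) then (0 : R) else F (t.erase b)) =
          if Even #t then F (t.erase b) else 0 := by
        by_cases h : Even #t
        · rw [if_neg (by rw [heven b hb]; simpa using h), if_pos h]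
        · rw [if_pos (by rw [heven b hb]; exact h), if_neg h]
      rw [← h2, ← h1, Finset.mul_sum]
      refine Finset.sum_congr rfl fun a _ => ?_
      rw [hsymm]
      ring
    have A5 := hself t (by omega) h0t
    have A6 := hIH t (by omega) h0t
    rw [hsum, hF'.insert_max M t hM h0, hF.insert_max M t hM h0, card_insert_of_notMem hMt]
    have B1 : ∑ b ∈ t, (-1) ^ rank t b * q' M b * F' (t.erase b) =
        (∑ b ∈ t, (-1) ^ rank t b * (q M b + X M * e b - X b * e M) *
          (if Even #t then 0 else F (t.erase b))) +
        (∑ b ∈ t, ∑ a ∈ t.erase b, (-1) ^ rank t b * (-1) ^ rank (t.erase b) a *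
          (q M b * X a * F ((t.erase b).erase a))) +
        X M * (∑ b ∈ t, ∑ a ∈ t.erase b, (-1) ^ rank t b * (-1) ^ rank (t.erase b) a *
          (e b * X a * F ((t.erase b).erase a))) -
        e M * (∑ b ∈ t, ∑ a ∈ t.erase b, (-1) ^ rank t b * (-1) ^ rank (t.erase b) a *
          (X b * X a * F ((t.erase b).erase a))) := by
      simp only [Finset.mul_sum, ← Finset.sum_add_distrib, ← Finset.sum_sub_distrib]
      refine Finset.sum_congr rfl fun b hb => ?_
      have h1 : ∑ a ∈ t.erase b, (-1) ^ rank t b * (q M b + X M * e b - X b * e M) *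
          ((-1) ^ rank (t.erase b) a * X a * F ((t.erase b).erase a)) =
          ∑ a ∈ t.erase b, (-1) ^ rank t b * (-1) ^ rank (t.erase b) a *
            (q M b * X a * F ((t.erase b).erase a)) +
          ∑ a ∈ t.erase b, X M * ((-1) ^ rank t b * (-1) ^ rank (t.erase b) a *
            (e b * X a * F ((t.erase b).erase a))) -
          ∑ a ∈ t.erase b, e M * ((-1) ^ rank t b * (-1) ^ rank (t.erase b) a *
            (X b * X a * F ((t.erase b).erase a))) := by
        rw [← Finset.sum_add_distrib, ← Finset.sum_sub_distrib]
        refine Finset.sum_congr rfl fun a _ => ?_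
        ring
      rw [hq, hins' b hb, mul_add, Finset.mul_sum, h1]
      ring
    have B2 : ∑ a ∈ t, (-1) ^ rank t a * X a * F (insert M (t.erase a)) =
        (∑ b ∈ t, ∑ a ∈ t.erase b, (-1) ^ rank t b * (-1) ^ rank (t.erase b) a *
          (q M a * X b * F ((t.erase a).erase b))) +
        ∑ a ∈ t, (-1) ^ rank t a * X a * (if Even #t then 0 else e M * F (t.erase a)) := by
      rw [← Finset.sum_add_distrib]
      refine Finset.sum_congr rfl fun a ha => ?_
      rw [hins a ha, mul_add, Finset.mul_sum]
      congr 1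
      refine Finset.sum_congr rfl fun b _ => ?_
      rw [hsymm]
      ring
    rw [B1, B2, A1, A2, A3, A4, A6]
    by_cases h : Even #t
    · simp only [h, if_true, Nat.even_add_one, not_true, if_false, mul_zero, Finset.sum_const_zero]
      ring
    · simp only [h, if_false, Nat.even_add_one, not_false_iff, if_true, mul_zero,
        Finset.sum_const_zero] at A5 ⊢
      have C1 : ∑ b ∈ t, (-1) ^ rank t b * (q M b + X M * e b - X b * e M) * F (t.erase b) =
          ∑ b ∈ t, (-1) ^ rank t b * q M b * F (t.erase b) +
          X M * (∑ b ∈ t, (-1) ^ rank t b * e b * F (t.erase b)) -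
          ∑ b ∈ t, (-1) ^ rank t b * X b * (e M * F (t.erase b)) := by
        rw [Finset.mul_sum, ← Finset.sum_add_distrib, ← Finset.sum_sub_distrib]
        refine Finset.sum_congr rfl fun b _ => ?_
        ring
      rw [C1, A5]
      ring

end Pfaffian

end TypeD

end

noncomputable section

namespace TypeD

open Finset

/-! ### Elementary symmetric polynomials -/

section Esymm

theorem esymm_cons_succ {R : Type*} [CommRing R] (a : R) (s : Multiset R) (k : ℕ) :
    (a ::ₘ s).esymm (k + 1) = s.esymm (k + 1) + a * s.esymm k := by
  rw [Multiset.esymm, Multiset.powersetCard_cons, Multiset.map_add, Multiset.sum_add,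
    Multiset.map_map, Multiset.esymm, Multiset.esymm, ← Multiset.sum_map_mul_left]
  congr 2
  exact Multiset.map_congr rfl fun t _ => by simp

theorem esymm_zero_right {R : Type*} [CommRing R] (s : Multiset R) : s.esymm 0 = 1 := by
  simp [Multiset.esymm]

theorem map_multiset_esymm {R S : Type*} [CommRing R] [CommRing S] (φ : R →+* S) (s : Multiset R)
    (k : ℕ) : φ (s.esymm k) = (s.map φ).esymm k := by
  rw [Multiset.esymm, Multiset.esymm, Multiset.powersetCard_map, map_multiset_sum,
    Multiset.map_map, Multiset.map_map]
  congr 1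
  exact Multiset.map_congr rfl fun t _ => map_multiset_prod φ t

theorem esymm_eq_zero {R : Type*} [CommRing R] {s : Multiset R} {k : ℕ}
    (h : Multiset.card s < k) : s.esymm k = 0 := by
  rw [Multiset.esymm, Multiset.powersetCard_eq_empty k h]
  simp

theorem map_Qone {R S : Type*} [CommRing R] [CommRing S] (φ : R →+* S) {n : ℕ} (v : Fin n → R)
    (i : ℕ) : φ (Qone v i) = Qone (fun j => φ (v j)) i := by
  rw [Qone, Qone, map_multiset_esymm, Multiset.map_map]
  rfl

theorem map_Qtwo {R S : Type*} [CommRing R] [CommRing S] (φ : R →+* S) {n : ℕ} (v : Fin n → R)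
    (i j : ℕ) : φ (Qtwo v i j) = Qtwo (fun j => φ (v j)) i j := by
  simp only [Qtwo, map_add, map_mul, map_sum, map_pow, map_neg, map_one, map_ofNat, map_Qone]

theorem map_Qtilde {R S : Type*} [CommRing R] [CommRing S] (φ : R →+* S) {n : ℕ} (v : Fin n → R)
    (μ : Finset ℕ) : φ (Qtilde v μ) = Qtilde (fun j => φ (v j)) μ := by
  simp only [Qtilde, map_pfaffian, map_Qtwo]

theorem Qone_comp_perm {R : Type*} [CommRing R] {n : ℕ} (v : Fin n → R)
    (σ : Equiv.Perm (Fin n)) (i : ℕ) : Qone (fun j => v (σ j)) i = Qone v i := by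
  rw [Qone, Qone]
  congr 1
  have h : (univ : Finset (Fin n)).val.map σ = univ.val :=
    congrArg Finset.val (Finset.map_univ_equiv σ)
  conv_rhs => rw [← h, Multiset.map_map]
  rfl

theorem Qtilde_comp_perm {R : Type*} [CommRing R] {n : ℕ} (v : Fin n → R)
    (σ : Equiv.Perm (Fin n)) (μ : Finset ℕ) : Qtilde (fun j => v (σ j)) μ = Qtilde v μ := by
  simp only [Qtilde, Qtwo, Qone_comp_perm]

theorem Qone_zero {R : Type*} [CommRing R] {n : ℕ} (v : Fin n → R) : Qone v 0 = 1 :=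
  esymm_zero_right _

theorem Qtwo_zero_right {R : Type*} [CommRing R] {n : ℕ} (v : Fin n → R) (p : ℕ) :
    Qtwo v p 0 = Qone v p := by
  simp [Qtwo, Qone_zero]

/-- After a shift of `k` the two alternating sums cancel, except for the term `k = 1` of the first.
-/
theorem Qtwo_succ_add {R : Type*} [CommRing R] {n : ℕ} (v : Fin n → R) (i j : ℕ) :
    Qtwo v i (j + 1) + Qtwo v (i + 1) j = Qone v i * Qone v (j + 1) - Qone v (i + 1) * Qone v j := by
  have h : ∑ k ∈ Icc 1 (j + 1), (-1) ^ k * (Qone v (i + k) * Qone v (j + 1 - k)) =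
      -(Qone v (i + 1) * Qone v j) -
        ∑ k ∈ Icc 1 j, (-1) ^ k * (Qone v (i + 1 + k) * Qone v (j - k)) := by
    rw [← Finset.add_sum_Ioc_eq_sum_Icc (by omega : 1 ≤ j + 1), sub_eq_add_neg,
      ← Finset.sum_neg_distrib]
    congr 1
    · simp
    · have h1 : Ioc 1 (j + 1) = (Icc 1 j).map (addRightEmbedding 1) := by
        rw [Finset.map_add_right_Icc]
        ext a
        simp only [mem_Ioc, mem_Icc]
        omega
      rw [h1, Finset.sum_map]
      refine Finset.sum_congr rfl fun k _ => ?_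
      simp only [addRightEmbedding_apply, pow_succ, Nat.add_sub_add_right]
      rw [show i + (k + 1) = i + 1 + k by omega]
      ring
  rw [Qtwo, Qtwo, h]
  ring

/-- Meant for `v = X`, `w` its image under `x_1 ↦ -x_1`, `x = x_1` and `a` the elementary symmetric
polynomials of the other variables. The recursion `Qtwo_succ_add` moves a unit from the second index
to the first, which gives the induction. -/
theorem Qtwo_wedge {R : Type*} [CommRing R] {n : ℕ} {v w : Fin n → R} {a : ℕ → R} {x : R}
    (h0 : ∀ i, Qone w i + Qone v i = 2 * a i)
    (h1 : ∀ i, Qone v (i + 1) - Qone w (i + 1) = 2 * x * a i) (i j : ℕ) :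
    Qtwo w i j = Qtwo v i j + Qone w i * Qone v j - Qone w j * Qone v i := by
  induction j generalizing i with
  | zero =>
    rw [Qtwo_zero_right, Qtwo_zero_right, Qone_zero, Qone_zero]
    ring
  | succ j ih =>
    have e1 := Qtwo_succ_add v i j
    have e2 := Qtwo_succ_add w i j
    rw [ih (i + 1)] at e2
    linear_combination e2 - e1 - (Qone v (j + 1) - Qone w (j + 1)) * h0 i - 2 * a i * h1 j
      + 2 * a j * h1 i + (Qone v (i + 1) - Qone w (i + 1)) * h0 j

theorem isPfaffian_Qtilde {R : Type*} [CommRing R] {n : ℕ} (v : Fin n → R) :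
    IsPfaffian (Qtwo v) (Qone v) (Qtilde v) := by
  have h := isPfaffian_pfaffianSeq (Qtwo v)
  simp only [Qtwo_zero_right] at h
  exact h

end Esymm

/-! ### The sign change of `x_1` and the removal of a part -/

section Lower

variable {n : ℕ}

theorem sw_Qtilde (i : ℕ) (μ : Finset ℕ) : sw i (Qtilde (xvar (n := n)) μ) = Qtilde xvar μ := by
  unfold sw
  split_ifs with h
  · have h1 := map_Qtilde ((SimpleRefl.adj i h).act : PolyXY n →+* PolyXY n) xvar μ
    refine h1.trans ?_
    rw [← Qtilde_comp_perm xvar (SimpleRefl.adj i h).toBarred.perm]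
    congr 1
    funext j
    change bact _ (xvar j) = _
    rw [bact_xvar]
    simp [SimpleRefl.toBarred]
  · rfl

theorem sw_Qone (i r : ℕ) : sw i (Qone (xvar (n := n)) r) = Qone xvar r := by
  unfold sw
  split_ifs with h
  · have h1 := map_Qone ((SimpleRefl.adj i h).act : PolyXY n →+* PolyXY n) xvar r
    refine h1.trans ?_
    rw [← Qone_comp_perm xvar (SimpleRefl.adj i h).toBarred.perm]
    congr 1
    funext j
    change bact _ (xvar j) = _
    rw [bact_xvar]
    simp [SimpleRefl.toBarred]
  · rfl

/-- The elementary symmetric polynomials in `x_2, …, x_n`. -/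
def restE (n r : ℕ) : PolyXY n :=
  (({i : Fin n | (i : ℕ) ≠ 0} : Finset (Fin n)).val.map xvar).esymm r

theorem univ_val_eq_cons (hn : 0 < n) : (univ : Finset (Fin n)).val =
    ⟨0, hn⟩ ::ₘ ({i : Fin n | (i : ℕ) ≠ 0} : Finset (Fin n)).val := by
  have h : (univ : Finset (Fin n)) =
      cons ⟨0, hn⟩ ({i : Fin n | (i : ℕ) ≠ 0} : Finset (Fin n)) (by simp) := by
    ext i
    simp only [mem_univ, mem_cons, mem_filter, true_and, true_iff, Fin.ext_iff]
    omega
  exact (congrArg Finset.val h).trans (cons_val _)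

theorem Qone_xvar_succ (hn : 0 < n) (r : ℕ) :
    Qone (xvar (n := n)) (r + 1) = restE n (r + 1) + xn 0 * restE n r := by
  rw [Qone, univ_val_eq_cons hn, Multiset.map_cons, esymm_cons_succ, xn_of_lt hn]
  rfl

theorem restE_zero : restE n 0 = 1 := esymm_zero_right _

theorem restE_eq_zero (hn : 0 < n) {r : ℕ} (hr : n ≤ r) : restE n r = 0 := by
  refine esymm_eq_zero ?_
  have h := congrArg Multiset.card (univ_val_eq_cons hn)
  simp only [Finset.card_val, card_univ, Fintype.card_fin, Multiset.card_cons] at h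
  rw [Multiset.card_map]
  change #_ < r
  omega

theorem flip_restE (r : ℕ) : bact (flipOne n) (restE n r) = restE n r := by
  have h := map_multiset_esymm (bact (flipOne n) : PolyXY n →+* PolyXY n)
    (({i : Fin n | (i : ℕ) ≠ 0} : Finset (Fin n)).val.map xvar) r
  refine h.trans ?_
  rw [restE, Multiset.map_map]
  congr 1
  refine Multiset.map_congr rfl fun j hj => ?_
  have hj' : (j : ℕ) ≠ 0 := by simpa using hj
  change bact _ (xvar j) = _
  rw [bact_xvar]
  simp [flipOne, hj']

theorem flip_Qone_succ (hn : 0 < n) (r : ℕ) :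
    bact (flipOne n) (Qone xvar (r + 1)) = restE n (r + 1) - xn 0 * restE n r := by
  rw [Qone_xvar_succ hn, map_add, map_mul, flip_restE, flip_restE, bact_flipOne_xn, if_pos rfl]
  ring

theorem flip_Qone_add (hn : 0 < n) (r : ℕ) :
    bact (flipOne n) (Qone xvar r) + Qone xvar r = 2 * restE n r := by
  cases r with
  | zero =>
    rw [Qone_zero, restE_zero, map_one]
    norm_num
  | succ r =>
    rw [flip_Qone_succ hn, Qone_xvar_succ hn]
    ring

/-- The sign change alters the array by a wedge, so the result is linear in the changed `Qone xvar
a`, and all the coefficients are symmetric in `X`. -/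
theorem flip_Qtilde (hn : 0 < n) {s : Finset ℕ} (hs : 0 ∉ s) :
    bact (flipOne n) (Qtilde xvar s) = (if Even #s then Qtilde xvar s else 0) +
      ∑ a ∈ s, (-1) ^ rank s a * bact (flipOne n) (Qone xvar a) * Qtilde xvar (s.erase a) := by
  have hw : ∀ r, Qone (fun j => bact (flipOne n) (xvar j)) r = bact (flipOne n) (Qone xvar r) :=
    fun r => (map_Qone (bact (flipOne n) : PolyXY n →+* PolyXY n) xvar r).symm
  have h := (isPfaffian_Qtilde (xvar (n := n))).add_wedge #s _ _ _
    (isPfaffian_Qtilde (fun j => bact (flipOne n) (xvar j)))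
    (Qtwo_wedge (a := restE n) (x := xn 0) (fun i => by rw [hw, flip_Qone_add hn])
      (fun i => by
        rw [hw, flip_Qone_succ hn, Qone_xvar_succ hn]
        ring)) s rfl hs
  simp only [hw] at h
  rw [← h]
  exact map_Qtilde (bact (flipOne n) : PolyXY n →+* PolyXY n) xvar s

/-- This is `add_wedge` for the zero wedge `X = e`. -/
theorem sum_rank_Qone_mul {s : Finset ℕ} (hs : 0 ∉ s) :
    ∑ a ∈ s, (-1) ^ rank s a * Qone (xvar (n := n)) a * Qtilde xvar (s.erase a) =
      if Even #s then 0 else Qtilde xvar s := by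
  have h := (isPfaffian_Qtilde (xvar (n := n))).add_wedge #s _ _ _ (isPfaffian_Qtilde xvar)
    (fun p r => by ring) s rfl hs
  split_ifs at h ⊢
  · linear_combination -h
  · linear_combination -h

/-- By `Qone_xvar_succ` a degree of `restE` is traded for a power of `x_1`. The symmetric term drops
out, since it leaves the chain and the remaining power of `x_1` is below `n - 1`. -/
theorem chain_pow_mul_restE_of_le (hn : 0 < n) (q : ℕ) : ∀ m, m + q ≤ n - 1 →
    chain 0 (n - 1) (xn 0 ^ m * restE n q) =
      (-1) ^ q * chain 0 (n - 1) (xn 0 ^ (m + q) : PolyXY n) := by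
  induction q with
  | zero =>
    intro m _
    rw [restE_zero]
    simp
  | succ q ih =>
    intro m hm
    have h1 : (xn 0 : PolyXY n) ^ m * restE n (q + 1) =
        Qone xvar (q + 1) * xn 0 ^ m + (-1) * (xn 0 ^ (m + 1) * restE n q) := by
      rw [Qone_xvar_succ hn]
      ring
    rw [h1, chain_add, chain_mul_of_sw_eq _ _ (fun j _ _ => sw_Qone j _),
      chain_mul_of_sw_eq _ _ (fun j _ _ => by simp), chain_xn_pow_of_lt (by omega) (by omega),
      ih _ (by omega), show m + 1 + q = m + (q + 1) by omega]
    ring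

/-- The same trade in the other direction, down to an elementary symmetric polynomial of degree at
least `n` in `n - 1` variables. -/
theorem chain_pow_mul_restE_of_lt (hn : 0 < n) (m : ℕ) : ∀ q, m ≤ n - 1 → n ≤ m + q →
    chain 0 (n - 1) (xn 0 ^ m * restE n q) = 0 := by
  induction m with
  | zero =>
    intro q _ hq
    rw [restE_eq_zero hn (by omega), mul_zero, chain_zero]
  | succ m ih =>
    intro q hm hq
    have h1 : (xn 0 : PolyXY n) ^ (m + 1) * restE n q =
        Qone xvar (q + 1) * xn 0 ^ m + (-1) * (xn 0 ^ m * restE n (q + 1)) := by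
      rw [Qone_xvar_succ hn]
      ring
    rw [h1, chain_add, chain_mul_of_sw_eq _ _ (fun j _ _ => sw_Qone j _),
      chain_mul_of_sw_eq _ _ (fun j _ _ => by simp), chain_xn_pow_of_lt (by omega) (by omega),
      ih _ (by omega) (by omega)]
    ring

theorem chain_pow (m : ℕ) (hn : 0 < n) (hm : m ≤ n - 1) :
    chain 0 (n - 1) (xn 0 ^ m : PolyXY n) = if m = n - 1 then (-1) ^ (n - 1) else 0 := by
  split_ifs with h
  · rw [h, chain_xn_pow_self (by omega)]
  · exact chain_xn_pow_of_lt (by omega) (by omega)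

theorem chain_pow_mul_restE (hn : 0 < n) {m q : ℕ} (hm : m ≤ n - 1) :
    chain 0 (n - 1) (xn 0 ^ m * restE n q) =
      if m + q = n - 1 then (-1) ^ q * (-1) ^ (n - 1) else 0 := by
  by_cases h : m + q ≤ n - 1
  · rw [chain_pow_mul_restE_of_le hn q m h, chain_pow _ hn h]
    split_ifs <;> simp
  · rw [chain_pow_mul_restE_of_lt hn m q hm (by omega), if_neg (by omega)]

/-- The operator `Q ↦ ± ∂'_{n-1} ⋯ ∂'_1 (x_1^{n-1-b} Q(-x_1, x_2, …, x_n))`, which removes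
the part `b` from the indices of the polynomials `P̃`. -/
def lowerOp (b : ℕ) (Q : PolyXY n) : PolyXY n :=
  (-1) ^ (n - 1) * chain 0 (n - 1) (xn 0 ^ (n - 1 - b) * bact (flipOne n) Q)

theorem neg_one_pow_mul_self {R : Type*} [CommRing R] (m : ℕ) : (-1 : R) ^ m * (-1) ^ m = 1 := by
  rw [← mul_pow]
  simp

/-- Write `e_a(-x_1, x_2, …) = 2 e_a(x_2, …) - e_a(X)`. Against `x_1^{n-1-b}`, the first term is
detected only for `a = b`, and the second, being symmetric, only for `b = 0`. -/
theorem lowerOp_Qone (hn : 0 < n) {a b : ℕ} (hb : b ≤ n - 1) :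
    lowerOp b (Qone (xvar (n := n)) a) =
      (if a = b then 2 * (-1) ^ b else 0) - if b = 0 then Qone xvar a else 0 := by
  have h1 : (xn 0 : PolyXY n) ^ (n - 1 - b) * bact (flipOne n) (Qone xvar a) =
      2 * (xn 0 ^ (n - 1 - b) * restE n a) + (-Qone xvar a) * xn 0 ^ (n - 1 - b) := by
    linear_combination xn 0 ^ (n - 1 - b) * flip_Qone_add hn a
  have e1 := chain_mul_of_sw_eq 0 (n - 1) (f := (2 : PolyXY n)) (fun j _ _ => map_ofNat _ 2)
    (xn 0 ^ (n - 1 - b) * restE n a)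
  have e2 := chain_mul_of_sw_eq 0 (n - 1) (f := -Qone (xvar (n := n)) a)
    (fun j _ _ => by rw [map_neg, sw_Qone]) (xn 0 ^ (n - 1 - b))
  rw [lowerOp, h1, chain_add, e1, e2, chain_pow_mul_restE hn (by omega), chain_pow _ hn (by omega)]
  have hs := neg_one_pow_mul_self (R := PolyXY n) (n - 1)
  have c1 : (n - 1 - b + a = n - 1) ↔ a = b := by omega
  have c2 : (n - 1 - b = n - 1) ↔ b = 0 := by omega
  simp only [c1, c2]
  split_ifs with h2 h3 h3
  · subst h2
    linear_combination (2 * (-1) ^ a - Qone xvar a) * hs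
  · subst h2
    linear_combination (2 * (-1) ^ a) * hs
  · linear_combination (- Qone xvar a) * hs
  · ring

theorem lowerOp_one (hn : 0 < n) {b : ℕ} (hb : b ≤ n - 1) :
    lowerOp b (1 : PolyXY n) = if b = 0 then 1 else 0 := by
  rw [lowerOp, map_one, mul_one, chain_pow _ hn (by omega)]
  have c2 : (n - 1 - b = n - 1) ↔ b = 0 := by omega
  simp only [c2]
  split_ifs
  · exact neg_one_pow_mul_self _
  · ring

theorem lowerOp_sum {ι : Type*} (b : ℕ) (S : Finset ι) (f : ι → PolyXY n) :
    lowerOp b (∑ j ∈ S, f j) = ∑ j ∈ S, lowerOp b (f j) := by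
  rw [lowerOp, map_sum, Finset.mul_sum, chain_sum, Finset.mul_sum]
  rfl

theorem lowerOp_const_mul (b : ℕ) {c : PolyXY n} (hc : c ∈ constRing n) (f : PolyXY n) :
    lowerOp b (c * f) = c * lowerOp b f := by
  rw [lowerOp, lowerOp, map_mul, bact_of_mem_constRing hc, mul_left_comm,
    chain_mul_of_sw_eq _ _ (fun j _ _ => sw_of_mem_constRing hc j), mul_left_comm]

/-- For `b > 0` only `a = b` survives in `flip_Qtilde`. For `b = 0` every `a` contributes `-Qone
xvar a`, and `sum_rank_Qone_mul` evaluates the sum; the two parities of `#s` give the sign. -/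
theorem lowerOp_Qtilde (hn : 0 < n) {b : ℕ} (hb : b ≤ n - 1) {s : Finset ℕ} (hs : 0 ∉ s) :
    lowerOp b (Qtilde (xvar (n := n)) s) =
      if b = 0 then (-1) ^ #s * Qtilde xvar s
      else if b ∈ s then 2 * (-1) ^ (b + rank s b) * Qtilde xvar (s.erase b) else 0 := by
  have hsign : ∀ (a : ℕ) (j : ℕ), sw j ((-1 : PolyXY n) ^ rank s a * Qtilde xvar (s.erase a)) =
      (-1) ^ rank s a * Qtilde xvar (s.erase a) := fun a j => by
    rw [map_mul, sw_Qtilde]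
    simp
  have h1 : lowerOp b (Qtilde (xvar (n := n)) s) =
      (if Even #s then Qtilde xvar s else 0) * lowerOp b 1 +
      ∑ a ∈ s, (-1) ^ rank s a * Qtilde xvar (s.erase a) * lowerOp b (Qone xvar a) := by
    rw [lowerOp, flip_Qtilde hn hs, mul_add, chain_add, Finset.mul_sum, chain_sum, mul_add,
      Finset.mul_sum]
    congr 1
    · rw [mul_comm (xn 0 ^ _), chain_mul_of_sw_eq _ _ (fun j _ _ => by
        split_ifs
        · exact sw_Qtilde _ _
        · exact map_zero _), lowerOp, map_one, mul_one]
      ring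
    · refine Finset.sum_congr rfl fun a _ => ?_
      have h2 : xn 0 ^ (n - 1 - b) * ((-1) ^ rank s a * bact (flipOne n) (Qone xvar a) *
          Qtilde xvar (s.erase a)) = ((-1) ^ rank s a * Qtilde xvar (s.erase a)) *
            (xn 0 ^ (n - 1 - b) * bact (flipOne n) (Qone xvar a)) := by ring
      rw [h2, chain_mul_of_sw_eq _ _ (fun j _ _ => hsign a j), lowerOp]
      ring
  rw [h1, lowerOp_one hn hb]
  simp only [lowerOp_Qone hn hb]
  by_cases h0 : b = 0
  · subst h0
    have h2 : ∑ a ∈ s, (-1) ^ rank s a * Qtilde xvar (s.erase a) *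
        ((if a = 0 then 2 * (-1) ^ 0 else 0) - if (0 : ℕ) = 0 then Qone (xvar (n := n)) a else 0) =
        -∑ a ∈ s, (-1) ^ rank s a * Qone (xvar (n := n)) a * Qtilde xvar (s.erase a) := by
      rw [← Finset.sum_neg_distrib]
      refine Finset.sum_congr rfl fun a ha => ?_
      rw [if_neg (by rintro rfl; exact hs ha), if_pos rfl]
      ring
    rw [h2, sum_rank_Qone_mul hs, if_pos rfl, if_pos rfl]
    by_cases he : Even #s
    · rw [if_pos he, if_pos he, he.neg_one_pow]
      ring
    · rw [if_neg he, if_neg he, (Nat.not_even_iff_odd.mp he).neg_one_pow]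
      ring
  · simp only [h0, if_false, mul_zero, zero_add, sub_zero]
    simp only [mul_ite, mul_zero, Finset.sum_ite_eq']
    split_ifs
    · rw [pow_add]
      ring
    · rfl

/-- The polynomials `P̃_μ(X)` are lowered by removing a part. -/
theorem lowerOp_Ptilde (hn : 0 < n) {b : ℕ} (hb : b ≤ n - 1) {s : Finset ℕ} (hs : 0 ∉ s) :
    lowerOp b (Ptilde (xvar (n := n)) s) =
      if b ∈ insert 0 s then (-1) ^ (b + rank s b) * Ptilde xvar (s.erase b) else 0 := by
  have hC : ∀ c : ZHalf, MvPolynomial.C c ∈ constRing n := fun c =>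
    (constRing n).algebraMap_mem c
  rw [Ptilde, lowerOp_const_mul _ (hC _), lowerOp_Qtilde hn hb hs]
  by_cases h0 : b = 0
  · subst h0
    -- This puts the sign for `b = 0` into the common form, so that `0` behaves like a part that can
    -- be removed.
    have h1 : rank s 0 = #s := by
      rw [rank, Finset.filter_true_of_mem]
      intro c hc
      rcases Nat.eq_zero_or_pos c with rfl | h
      · exact absurd hc hs
      · exact h
    rw [if_pos rfl, if_pos (mem_insert_self _ _), erase_eq_of_notMem hs, h1, Ptilde, zero_add]
    ring
  · rw [if_neg h0]
    simp only [mem_insert, h0, false_or]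
    split_ifs with h
    -- The factor `2` makes up for the change of `2^{-ℓ}` when a part is lost.
    · have h2 : (MvPolynomial.C (IsLocalization.Away.invSelf (S := ZHalf) (2 : ℤ)) : PolyXY n) * 2 = 1 := by
        have h3 := IsLocalization.Away.mul_invSelf (S := ZHalf) (2 : ℤ)
        have h4 := congrArg (MvPolynomial.C (σ := Fin n ⊕ Fin n)) h3
        rw [map_mul, map_one] at h4
        rw [mul_comm, ← h4]
        congr 1
        exact ((congrArg _ (map_ofNat (algebraMap ℤ ZHalf) 2)).trans
          (map_ofNat MvPolynomial.C 2)).symm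
      rw [Ptilde, ← card_erase_add_one h, pow_succ, map_mul]
      linear_combination (MvPolynomial.C (IsLocalization.Away.invSelf (S := ZHalf) (2 : ℤ) ^ #(s.erase b)) *
        (-1) ^ (b + rank s b) * Qtilde xvar (s.erase b)) * h2
    · ring

theorem isSymmX_Ptilde (s : Finset ℕ) : IsSymmX (Ptilde (xvar (n := n)) s) := fun i => by
  rw [Ptilde, map_mul, sw_Qtilde]
  congr 1
  exact sw_of_mem_constRing ((constRing n).algebraMap_mem _) i

end Lower

end TypeD

end

noncomputable section

namespace TypeD

open Finset

/-! ### Composites of chains and sign changes as divided differences -/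

section SignChanges

variable {n : ℕ}

/-- Up to a power of the sign change of the first variable, the operator `T` is a composite of
divided differences along a word of `g`. -/
def IsRealized (q : ℕ) (g : BarredPerm n) (T : PolyXY n → PolyXY n) : Prop :=
  ∃ a : List (SimpleRefl n), wordProd a = flipOne n ^ q * g ∧
    ∀ f, divDiffWord a f = bact (flipOne n ^ q) (T f)

theorem isRealized_id : IsRealized 0 (1 : BarredPerm n) id :=
  ⟨[], by simp [wordProd], fun f => by simp [divDiffWord, bact_one]⟩

/-- The word stays the same: the sign change is an involution and is absorbed by the power of
`flipOne`. -/
theorem IsRealized.flip {q : ℕ} {g : BarredPerm n} {T : PolyXY n → PolyXY n}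
    (h : IsRealized q g T) :
    IsRealized (q + 1) (flipOne n * g) (fun f => bact (flipOne n) (T f)) := by
  obtain ⟨a, h1, h2⟩ := h
  refine ⟨a, ?_, fun f => ?_⟩
  · rw [h1, pow_succ, mul_assoc, ← mul_assoc (flipOne n) (flipOne n), flipOne_mul_self, one_mul]
  · rw [h2, ← bact_mul, pow_succ, mul_assoc, flipOne_mul_self, mul_one]

theorem exists_flipOne_pow_vec_root (q : ℕ) (s : SimpleRefl n) :
    ∃ t : SimpleRefl n, (flipOne n ^ q).vec s.root = t.root := by
  induction q with
  | zero => exact ⟨s, by rw [pow_zero, BarredPerm.vec_one]⟩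
  | succ q ih =>
    obtain ⟨t, ht⟩ := ih
    exact ⟨t.twist, by rw [pow_succ', BarredPerm.vec_mul, ht, flipOne_vec_root]⟩

/-- Moving the operator past the accumulated sign changes replaces `s` by `s` or its twist, again a
simple reflection, which becomes the new first letter. -/
theorem IsRealized.divDiff' {q : ℕ} {g : BarredPerm n} {T : PolyXY n → PolyXY n}
    (h : IsRealized q g T) (s : SimpleRefl n) :
    IsRealized q (s.toBarred * g) (fun f => s.divDiff' (T f)) := by
  obtain ⟨a, h1, h2⟩ := h
  obtain ⟨t, ht⟩ := exists_flipOne_pow_vec_root q s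
  refine ⟨t :: a, ?_, fun f => ?_⟩
  · rw [wordProd_cons, h1, ← mul_assoc, SimpleRefl.mul_toBarred_of_vec_root ht, mul_assoc]
  · rw [divDiffWord_cons, h2, SimpleRefl.bact_divDiff' ht]

/-- The cyclic permutation `s_m ⋯ s_1`. -/
def cycle (n : ℕ) : ℕ → BarredPerm n
  | 0 => 1
  | m + 1 => (if h : m + 1 < n then (SimpleRefl.adj m h).toBarred else 1) * cycle n m

theorem IsRealized.chain {q : ℕ} {g : BarredPerm n} {T : PolyXY n → PolyXY n}
    (h : IsRealized q g T) {m : ℕ} (hm : m < n) :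
    IsRealized q (cycle n m * g) (fun f => TypeD.chain 0 m (T f)) := by
  induction m with
  | zero =>
    rw [cycle, one_mul]
    exact h
  | succ m ih =>
    have h1 := (ih (by omega)).divDiff' (SimpleRefl.adj m hm)
    simp only [cycle, dif_pos hm, chain_succ', Nat.zero_add, dd_of_lt hm, mul_assoc]
    exact h1

theorem cycle_sign (m : ℕ) (j : Fin n) : (cycle n m).sign j = 1 := by
  induction m with
  | zero => rfl
  | succ m ih =>
    rw [cycle, BarredPerm.mul_sign, ih, one_mul]
    split_ifs <;> rfl

theorem cycle_perm {m : ℕ} (hm : m < n) (j : Fin n) : (((cycle n m).perm j : Fin n) : ℕ) =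
    if (j : ℕ) = 0 then m else if (j : ℕ) ≤ m then j - 1 else j := by
  induction m with
  | zero =>
    simp only [cycle, BarredPerm.one_perm, Equiv.Perm.one_apply]
    split_ifs <;> omega
  | succ m ih =>
    have ih := ih (by omega)
    rw [cycle, dif_pos hm, BarredPerm.mul_perm, Equiv.Perm.mul_apply, SimpleRefl.toBarred,
      Equiv.swap_apply_def]
    have hsplit : ∀ x : Fin n, ((if x = ⟨m, by omega⟩ then ⟨m + 1, hm⟩ else
        if x = ⟨m + 1, hm⟩ then ⟨m, by omega⟩ else x : Fin n) : ℕ) =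
        if (x : ℕ) = m then m + 1 else if (x : ℕ) = m + 1 then m else x := fun x => by
      simp only [Fin.ext_iff]
      split_ifs <;> rfl
    rw [hsplit, ih]
    split_ifs <;> omega

/-- The operator that runs through `p = 0, …, P - 1`, changing the sign of the first variable
for `p ∈ M`. -/
def process (M : Finset ℕ) : ℕ → PolyXY n → PolyXY n
  | 0, f => f
  | p + 1, f => if p ∈ M then chain 0 (n - 1) (bact (flipOne n) (process M p f))
      else chain 0 (n - 1 - p) (process M p f)

/-- The barred permutation attached to `process M`. -/
def processElt (n : ℕ) (M : Finset ℕ) : ℕ → BarredPerm n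
  | 0 => 1
  | p + 1 => if p ∈ M then cycle n (n - 1) * (flipOne n * processElt n M p)
      else cycle n (n - 1 - p) * processElt n M p

theorem filter_lt_succ (M : Finset ℕ) (p : ℕ) : {i ∈ M | i < p + 1} =
    if p ∈ M then insert p {i ∈ M | i < p} else {i ∈ M | i < p} := by
  ext i
  split_ifs with h
  · simp only [mem_filter, mem_insert]
    constructor
    · rintro ⟨h2, h3⟩
      exact (eq_or_ne i p).imp id fun h4 => ⟨h2, by omega⟩
    · rintro (rfl | h2)
      · exact ⟨h, by omega⟩
      · exact ⟨h2.1, by omega⟩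
  · simp only [mem_filter]
    refine and_congr_right fun h2 => ?_
    have : i ≠ p := fun h3 => h (h3 ▸ h2)
    omega

theorem isRealized_process (hn : 0 < n) (M : Finset ℕ) (p : ℕ) :
    IsRealized #{i ∈ M | i < p} (processElt n M p) (process M p) := by
  induction p with
  | zero =>
    rw [filter_false_of_mem fun i _ => Nat.not_lt_zero i]
    exact isRealized_id
  | succ p ih =>
    rw [filter_lt_succ]
    by_cases h : p ∈ M
    · have h2 := ih.flip.chain (m := n - 1) (by omega)
      rw [if_pos h, card_insert_of_notMem (by simp), processElt, if_pos h]
      simpa only [process, h, if_true] using h2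
    · have h2 := ih.chain (m := n - 1 - p) (by omega)
      rw [if_neg h, processElt, if_neg h]
      simpa only [process, h, if_false] using h2

theorem card_between_succ (M : Finset ℕ) {j P : ℕ} (hj : j < P) :
    #{i ∈ M | j < i ∧ i < P + 1} = #{i ∈ M | j < i ∧ i < P} + if P ∈ M then 1 else 0 := by
  split_ifs with h
  · have h1 : {i ∈ M | j < i ∧ i < P + 1} = insert P {i ∈ M | j < i ∧ i < P} := by
      ext i
      simp only [mem_filter, mem_insert]
      constructor
      · rintro ⟨h2, h3⟩
        exact (eq_or_ne i P).imp id fun h4 => ⟨h2, by omega⟩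
      · rintro (rfl | h2)
        · exact ⟨h, by omega⟩
        · exact ⟨h2.1, by omega⟩
    rw [h1, card_insert_of_notMem (by simp)]
  · rw [add_zero]
    congr 1
    ext i
    simp only [mem_filter]
    refine and_congr_right fun h2 => ?_
    have : i ≠ P := fun h3 => h (h3 ▸ h2)
    omega

theorem card_between_le (M : Finset ℕ) (j P : ℕ) : #{i ∈ M | j < i ∧ i < P} ≤ P - 1 - j := by
  have h1 : {i ∈ M | j < i ∧ i < P} ⊆ Ico (j + 1) P := fun i hi => by
    simp only [mem_filter] at hi
    exact mem_Ico.mpr ⟨by omega, by omega⟩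
  have := card_le_card h1
  rw [Nat.card_Ico] at this
  omega

/-- Steps before step `j` lower the image of `j` by one each, so it is `0` when step `j` sends it to
`n - 1` or `n - 1 - j`. Afterwards only the steps with a sign change lower it, by one each. -/
theorem processElt_spec (M : Finset ℕ) {P : ℕ} (hP : P ≤ n) (j : Fin n) :
    ((j : ℕ) < P → ((processElt n M P).perm j : ℕ) + #{i ∈ M | (j : ℕ) < i ∧ i < P} =
      if (j : ℕ) ∈ M then n - 1 else n - 1 - j) ∧
    (P ≤ (j : ℕ) → ((processElt n M P).perm j : ℕ) + P = j) ∧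
    (processElt n M P).sign j = if (j : ℕ) ∈ M ∧ (j : ℕ) < P then -1 else 1 := by
  induction P with
  | zero => simp [processElt, BarredPerm.one_perm, BarredPerm.one_sign]
  | succ P ih =>
    obtain ⟨h1, h2, h3⟩ := ih (by omega)
    have hj := j.2
    -- This bound keeps the images of the `j < P` at `n - P` or more, out of reach of the shorter
    -- chain and of the sign change.
    have hle := card_between_le M j P
    by_cases hM : P ∈ M
    · rw [processElt, if_pos hM]
      simp only [BarredPerm.mul_perm, BarredPerm.mul_sign, Equiv.Perm.mul_apply, cycle_sign,
        mul_one, h3, flipOne, Equiv.Perm.one_apply]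
      rw [cycle_perm (by omega)]
      set r : ℕ := ((processElt n M P).perm j : ℕ)
      have hr : r < n := Fin.is_lt _
      rcases lt_trichotomy (j : ℕ) P with h | h | h
      · have h1 := h1 h
        rw [card_between_succ M h, if_pos hM]
        refine ⟨fun _ => ?_, fun h' => by omega, ?_⟩
        · split_ifs at h1 ⊢ <;> omega
        · have h5 : r ≠ 0 := by split_ifs at h1 <;> omega
          simp [h, h5, show (j : ℕ) < P + 1 by omega]
      · have h2 := h2 h.ge
        have h4 : #{i ∈ M | (j : ℕ) < i ∧ i < P + 1} = 0 := by
          have := card_between_le M j (P + 1)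
          omega
        rw [h4]
        refine ⟨fun _ => ?_, fun h' => by omega, ?_⟩
        · rw [if_pos (by omega), h, if_pos hM]
          rfl
        · simp [h, hM, show r = 0 by omega]
      · have h2 := h2 h.le
        refine ⟨fun h' => by omega, fun _ => ?_, ?_⟩
        · split_ifs <;> omega
        · rw [if_neg (by omega), if_neg (by omega), if_neg (by omega), one_mul]
    · rw [processElt, if_neg hM]
      simp only [BarredPerm.mul_perm, BarredPerm.mul_sign, Equiv.Perm.mul_apply, cycle_sign,
        mul_one, h3]
      rw [cycle_perm (by omega)]
      set r : ℕ := ((processElt n M P).perm j : ℕ)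
      have hr : r < n := Fin.is_lt _
      rcases lt_trichotomy (j : ℕ) P with h | h | h
      · have h1 := h1 h
        rw [card_between_succ M h, if_neg hM]
        refine ⟨fun _ => ?_, fun h' => by omega, ?_⟩
        · split_ifs at h1 ⊢ <;> omega
        · simp [h, show (j : ℕ) < P + 1 by omega]
      · have h2 := h2 h.ge
        have h4 : #{i ∈ M | (j : ℕ) < i ∧ i < P + 1} = 0 := by
          have := card_between_le M j (P + 1)
          omega
        rw [h4]
        refine ⟨fun _ => ?_, fun h' => by omega, ?_⟩
        · rw [if_pos (by omega), h, if_neg hM]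
          rfl
        · simp [h, hM]
      · have h2 := h2 h.le
        refine ⟨fun h' => by omega, fun _ => ?_, ?_⟩
        · split_ifs <;> omega
        · rw [if_neg (by omega), if_neg (by omega)]

theorem process_add (M : Finset ℕ) (p : ℕ) (f g : PolyXY n) :
    process M p (f + g) = process M p f + process M p g := by
  induction p with
  | zero => rfl
  | succ p ih =>
    simp only [process, ih, map_add, chain_add]
    split_ifs <;> rfl

theorem process_zero (M : Finset ℕ) (p : ℕ) : process M p (0 : PolyXY n) = 0 := by
  induction p with
  | zero => rfl
  | succ p ih => simp only [process, ih, map_zero, chain_zero, ite_self]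

theorem process_sum {ι : Type*} (M : Finset ℕ) (p : ℕ) (S : Finset ι) (f : ι → PolyXY n) :
    process M p (∑ j ∈ S, f j) = ∑ j ∈ S, process M p (f j) := by
  classical
  induction S using Finset.induction_on with
  | empty => simp [process_zero]
  | insert j S hj ih => rw [Finset.sum_insert hj, Finset.sum_insert hj, process_add, ih]

theorem process_const_mul (M : Finset ℕ) (p : ℕ) {c : PolyXY n} (hc : c ∈ constRing n)
    (f : PolyXY n) : process M p (c * f) = c * process M p f := by
  induction p with
  | zero => rfl
  | succ p ih =>
    simp only [process, ih, map_mul, bact_of_mem_constRing hc,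
      chain_mul_of_sw_eq _ _ fun j _ _ => sw_of_mem_constRing hc j]
    split_ifs <;> rfl

end SignChanges

/-! ### The word of a maximal Grassmannian element -/

section Grassmannian

variable {n : ℕ}

/-- The steps at which a sign is changed: the dual partition, completed by `0` to a set of even
cardinality. -/
def flipSet (n : ℕ) (lam : Finset ℕ) : Finset ℕ :=
  if n ≡ #lam [MOD 2] then insert 0 (dual (n - 1) lam) else dual (n - 1) lam

theorem zero_notMem_dual (m : ℕ) (s : Finset ℕ) : 0 ∉ dual m s := by
  simp [dual]

theorem mem_flipSet_of_ne {lam : Finset ℕ} {p : ℕ} (hp : p ≠ 0) :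
    p ∈ flipSet n lam ↔ p ∈ dual (n - 1) lam := by
  rw [flipSet]
  split_ifs <;> simp [hp]

theorem zero_mem_flipSet {lam : Finset ℕ} : 0 ∈ flipSet n lam ↔ n ≡ #lam [MOD 2] := by
  rw [flipSet]
  split_ifs with h <;> simp [h, zero_notMem_dual]

theorem rank_flipSet (lam : Finset ℕ) (p : ℕ) :
    rank (flipSet n lam) p = rank (dual (n - 1) lam) p := by
  rw [rank, rank]
  congr 1
  ext c
  simp only [mem_filter]
  exact and_congr_left fun h => mem_flipSet_of_ne (by omega)

theorem card_dual {lam : Finset ℕ} (hlam : lam ∈ strictPartitions (n - 1)) :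
    #(dual (n - 1) lam) + #lam = n - 1 := by
  have h := Finset.card_sdiff_add_card_eq_card (Finset.mem_powerset.mp hlam)
  rwa [Nat.card_Icc, Nat.add_sub_cancel] at h

theorem card_flipSet {lam : Finset ℕ} (hn : 1 ≤ n) (hlam : lam ∈ strictPartitions (n - 1)) :
    #(flipSet n lam) = evenColength n lam := by
  have h := card_dual hlam
  rw [flipSet, evenColength]
  split_ifs
  · rw [card_insert_of_notMem (zero_notMem_dual _ _)]
    omega
  · omega

theorem even_evenColength {lam : Finset ℕ} (hlam : lam ∈ strictPartitions (n - 1)) :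
    Even (evenColength n lam) := by
  have h := card_dual hlam
  rw [evenColength, Nat.even_iff]
  split_ifs with h1
  · rw [Nat.ModEq] at h1
    omega
  · rw [Nat.ModEq] at h1
    omega

theorem flipSet_lt {lam : Finset ℕ} (hn : 0 < n) {p : ℕ} (hp : p ∈ flipSet n lam) : p < n := by
  rcases Nat.eq_zero_or_pos p with rfl | h
  · omega
  · rw [mem_flipSet_of_ne h.ne', dual, mem_sdiff, mem_Icc] at hp
    omega

theorem flipOne_pow_of_even {k : ℕ} (hk : Even k) : flipOne n ^ k = 1 := by
  obtain ⟨m, rfl⟩ := hk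
  rw [← two_mul, pow_mul, pow_two, flipOne_mul_self, one_pow]

theorem rank_add_rank_dual {m : ℕ} {lam : Finset ℕ} (hlam : lam ∈ strictPartitions m) (p : ℕ) :
    rank lam p + rank (dual m lam) p = m - p := by
  have h1 : #{c ∈ Icc 1 m | p < c} = m - p := by
    have h2 : {c ∈ Icc 1 m | p < c} = Ioc p m := by
      ext c
      simp only [mem_filter, mem_Icc, mem_Ioc]
      omega
    rw [h2, Nat.card_Ioc]
  have h3 : {c ∈ Icc 1 m | p < c} = {c ∈ lam | p < c} ∪ {c ∈ dual m lam | p < c} := by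
    rw [← filter_union, dual, union_sdiff_of_subset (mem_powerset.mp hlam)]
  rw [rank, rank, ← card_union_of_disjoint, ← h3, h1]
  exact disjoint_filter_filter disjoint_sdiff

theorem grassLine_of_mem {lam : Finset ℕ} {p : ℕ} (hp : p ∈ lam) :
    (grassLine n lam)[rank lam p]? = some (-((p : ℤ) + 1)) := by
  have h1 : (lam.sort (· ≥ ·)).Pairwise (· > ·) := lam.sortedGT_sort.pairwise
  have h2 := getElem?_countP_of_pairwise (r := (· > ·)) (fun a b h => by omega) h1
    (b := p) (by simpa using hp)
  rw [countP_sort lam (· ≥ ·) (fun c => c > p)] at h2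
  have h3 := rank_lt_card hp
  rw [grassLine, List.append_assoc, List.getElem?_append_left (by simpa using h3),
    List.getElem?_map, rank]
  simp only [gt_iff_lt] at h2
  rw [h2]
  rfl

theorem grassLine_card {lam : Finset ℕ} :
    (grassLine n lam)[#lam]? = some ((-1) ^ #lam) := by
  rw [grassLine, List.append_assoc, List.getElem?_append_right (by simp)]
  simp

theorem grassLine_of_mem_dual {lam : Finset ℕ} (hlam : lam ∈ strictPartitions (n - 1)) {p : ℕ}
    (hp : p ∈ dual (n - 1) lam) :
    (grassLine n lam)[n - 1 - rank (dual (n - 1) lam) p]? = some ((p : ℤ) + 1) := by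
  set S := Icc 1 n \ insert 1 (lam.image (· + 1)) with hS
  have hlam' : ∀ p ∈ lam, 1 ≤ p ∧ p ≤ n - 1 := fun p hp =>
    Finset.mem_Icc.mp (Finset.mem_powerset.mp hlam hp)
  have hSd : S = (dual (n - 1) lam).image (· + 1) := by
    ext c
    simp only [hS, dual, mem_sdiff, mem_Icc, mem_insert, mem_image, not_or, not_exists, not_and]
    constructor
    · rintro ⟨h1, h2, h3⟩
      exact ⟨c - 1, ⟨by omega, fun h => h3 _ h (by omega)⟩, by omega⟩
    · rintro ⟨d, ⟨h1, h2⟩, rfl⟩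
      exact ⟨by omega, by omega, fun e he h => h2 (by rwa [← Nat.add_right_cancel h])⟩
  have h1 : (S.sort (· ≤ ·)).Pairwise (· < ·) := S.sortedLT_sort.pairwise
  have h2 := getElem?_countP_of_pairwise (r := (· < ·)) (fun a b h => by omega) h1
    (b := p + 1) (by rw [Finset.mem_sort, hSd]; exact mem_image_of_mem _ hp)
  rw [countP_sort S (· ≤ ·) (fun c => c < p + 1)] at h2
  have h3 : #{c ∈ S | c < p + 1} = #{c ∈ dual (n - 1) lam | c < p} := by
    rw [hSd, filter_image, card_image_of_injective _ (add_left_injective 1)]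
    simp
  have h4 : #{c ∈ dual (n - 1) lam | c < p} + 1 + rank (dual (n - 1) lam) p =
      #(dual (n - 1) lam) := by
    have h5 : #{c ∈ dual (n - 1) lam | c < p} + 1 = #{c ∈ dual (n - 1) lam | ¬ p < c} := by
      have h6 : {c ∈ dual (n - 1) lam | ¬ p < c} =
          insert p {c ∈ dual (n - 1) lam | c < p} := by
        ext c
        simp only [mem_filter, mem_insert]
        constructor
        · rintro ⟨h7, h8⟩
          exact (eq_or_ne c p).imp id fun h9 => ⟨h7, by omega⟩
        · rintro (rfl | h7)
          · exact ⟨hp, by omega⟩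
          · exact ⟨h7.1, by omega⟩
      rw [h6, card_insert_of_notMem (by simp)]
    rw [h5, rank, add_comm, card_filter_add_card_filter_not]
  have h5 := card_dual hlam
  rw [show n - 1 - rank (dual (n - 1) lam) p = #lam + 1 + #{c ∈ S | c < p + 1} by omega,
    grassLine, List.getElem?_append_right (by simp)]
  simp only [List.length_append, List.length_map, Finset.length_sort, List.length_singleton,
    Nat.add_sub_cancel_left, List.getElem?_map, ← hS]
  rw [h2]
  simp

theorem ofOneLine_of_getElem? {L : List ℤ} (h : (L.map Int.natAbs).Perm (List.range' 1 n))
    {i : Fin n} {c : ℤ} (hi : L[(i : ℕ)]? = some c) :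
    ((ofOneLine L h).perm i : ℕ) = c.natAbs - 1 ∧
      (ofOneLine L h).sign i = if c < 0 then -1 else 1 := by
  obtain ⟨h1, h2⟩ := List.getElem?_eq_some_iff.mp hi
  subst h2
  exact ⟨rfl, rfl⟩

/-- By `processElt_spec`, `0` goes to the place of the entry `± 1` in `w_λ`, a part `j` of `λ` to
that of the barred `j + 1`, and a part `j` of `λ'` to that of the unbarred `j + 1`. The sign changes
occur exactly for the last kind, and for `0` as parity requires. -/
theorem maxGrass_mul_processElt (hn : 1 ≤ n) {lam : Finset ℕ}
    (hlam : lam ∈ strictPartitions (n - 1)) :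
    (maxGrass hn hlam : BarredPerm n) * processElt n (flipSet n lam) n = longest n := by
  have hcard := card_dual hlam
  have key : ∀ j : Fin n, (((maxGrass hn hlam : BarredPerm n) *
      processElt n (flipSet n lam) n).perm j : ℕ) = j ∧ ((maxGrass hn hlam : BarredPerm n) *
      processElt n (flipSet n lam) n).sign j = if Odd n ∧ (j : ℕ) = 0 then 1 else -1 := by
    intro j
    obtain ⟨h1, -, h3⟩ := processElt_spec (flipSet n lam) le_rfl j
    have h1 := h1 j.2
    have hj := j.2
    have h4 : #{i ∈ flipSet n lam | (j : ℕ) < i ∧ i < n} = rank (dual (n - 1) lam) j := by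
      rw [← rank_flipSet, rank]
      congr 1
      ext i
      simp only [mem_filter]
      exact and_congr_right fun h => and_iff_left (flipSet_lt hn h)
    rw [h4] at h1
    rw [BarredPerm.mul_perm, BarredPerm.mul_sign, Equiv.Perm.mul_apply, h3]
    simp only [hj, and_true]
    have hrk := rank_add_rank_dual hlam j
    rcases Nat.eq_zero_or_pos (j : ℕ) with h0 | h0
    · have h5 : rank (dual (n - 1) lam) 0 = #(dual (n - 1) lam) := by
        rw [rank, filter_true_of_mem]
        intro c hc
        rcases Nat.eq_zero_or_pos c with rfl | h
        · exact absurd hc (zero_notMem_dual _ _)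
        · exact h
      rw [h0, h5] at h1
      have h6 : ((processElt n (flipSet n lam) n).perm j : ℕ) = #lam := by
        split_ifs at h1 <;> omega
      obtain ⟨e1, e2⟩ := ofOneLine_of_getElem? (grassLine_perm hn hlam)
        (i := (processElt n (flipSet n lam) n).perm j) (by rw [h6]; exact grassLine_card)
      refine ⟨e1.trans ?_, ?_⟩
      · simp [h0, Int.natAbs_pow]
      · rw [show (maxGrass hn hlam : BarredPerm n).sign _ = _ from e2]
        simp only [h0, zero_mem_flipSet, and_true, Nat.ModEq]
        rcases Nat.even_or_odd #lam with h | h <;> rcases Nat.even_or_odd n with h' | h'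
        · simp [h.neg_one_pow, Nat.not_odd_iff_even.mpr h', Nat.even_iff.mp h, Nat.even_iff.mp h']
        · simp [h.neg_one_pow, h', Nat.even_iff.mp h, Nat.odd_iff.mp h']
        · simp [h.neg_one_pow, Nat.not_odd_iff_even.mpr h', Nat.odd_iff.mp h, Nat.even_iff.mp h']
        · simp [h.neg_one_pow, h', Nat.odd_iff.mp h, Nat.odd_iff.mp h']
    · rw [if_neg (by omega : ¬ (Odd n ∧ (j : ℕ) = 0))]
      simp only [mem_flipSet_of_ne h0.ne'] at h1 ⊢
      by_cases hd : (j : ℕ) ∈ dual (n - 1) lam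
      · rw [if_pos hd] at h1 ⊢
        have h6 : ((processElt n (flipSet n lam) n).perm j : ℕ) =
          n - 1 - rank (dual (n - 1) lam) j := by omega
        obtain ⟨e1, e2⟩ := ofOneLine_of_getElem? (grassLine_perm hn hlam)
          (i := (processElt n (flipSet n lam) n).perm j)
          (by rw [h6]; exact grassLine_of_mem_dual hlam hd)
        refine ⟨e1.trans (by omega), ?_⟩
        rw [show (maxGrass hn hlam : BarredPerm n).sign _ = _ from e2, if_neg (by omega), mul_one]
      · rw [if_neg hd] at h1 ⊢
        have hl : (j : ℕ) ∈ lam := by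
          by_contra h
          exact hd (mem_sdiff.mpr ⟨mem_Icc.mpr ⟨h0, by omega⟩, h⟩)
        have h6 : ((processElt n (flipSet n lam) n).perm j : ℕ) = rank lam j := by omega
        obtain ⟨e1, e2⟩ := ofOneLine_of_getElem? (grassLine_perm hn hlam)
          (i := (processElt n (flipSet n lam) n).perm j)
          (by rw [h6]; exact grassLine_of_mem hl)
        refine ⟨e1.trans (by omega), ?_⟩
        rw [show (maxGrass hn hlam : BarredPerm n).sign _ = _ from e2, if_pos (by omega), one_mul]
  refine BarredPerm.ext (Equiv.ext fun j => Fin.ext (key j).1) (funext fun j => (key j).2)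

/-- The divided difference operator that defines `𝔇_λ`. -/
theorem divDiffWeyl_maxGrass (hn : 1 ≤ n) {lam : Finset ℕ}
    (hlam : lam ∈ strictPartitions (n - 1)) {g : PolyXY n}
    (hg : process (flipSet n lam) n g ≠ 0) (f : PolyXY n) :
    divDiffWeyl ((maxGrass hn hlam)⁻¹ * longest n) f = process (flipSet n lam) n f := by
  obtain ⟨a, h1, h2⟩ := isRealized_process hn (flipSet n lam) n
  have h3 : {i ∈ flipSet n lam | i < n} = flipSet n lam :=
    filter_true_of_mem fun i hi => flipSet_lt hn hi
  -- The number of sign changes is even, so the power of `flipOne` disappears.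
  rw [h3, card_flipSet hn hlam, flipOne_pow_of_even (even_evenColength hlam)] at h1 h2
  simp only [one_mul, bact_one] at h1 h2
  rw [← h2 f]
  refine divDiffWeyl_eq _ ?_ (g := g) (by rwa [h2]) f
  rw [h1, Subgroup.coe_mul, ← maxGrass_mul_processElt hn hlam, Subgroup.coe_inv,
    inv_mul_cancel_left]

end Grassmannian

end TypeD

end

noncomputable section

namespace TypeD

open Finset

/-! ### Determinants indexed by sets of parts -/

section PartDet

variable {R : Type*} [CommRing R]

/-- The determinant with rows indexed by the parts of `β` and columns by those of `s`. -/
def partDet (c : ℕ → ℕ → R) (k : ℕ) (s β : Finset ℕ) : R :=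
  Matrix.det (Matrix.of fun i j : Fin k => c (part s j) (part β i))

/-- The new part is the largest, so it gives the first column; Laplace expansion along it deletes
one part of `β` at a time. -/
theorem partDet_insert (c : ℕ → ℕ → R) {k p : ℕ} {s β : Finset ℕ} (hp : ∀ i ∈ s, i < p)
    (hβ : #β = k + 1) : partDet c (k + 1) (insert p s) β =
      ∑ b ∈ β, (-1) ^ rank β b * c p b * partDet c k s (β.erase b) := by
  rw [partDet, Matrix.det_succ_column_zero,
    ← sum_range_card_part β fun i b => (-1) ^ i * c p b * partDet c k s (β.erase b), hβ,
    Finset.sum_range]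
  refine Finset.sum_congr rfl fun i _ => ?_
  rw [Matrix.of_apply, Fin.val_zero, part_insert_zero hp, partDet]
  congr 2
  ext a j
  have hi : (i : ℕ) < #β := by omega
  rw [Matrix.submatrix_apply, Matrix.of_apply, Matrix.of_apply, Fin.val_succ,
    part_insert_succ hp, part_erase (part_mem hi), rank_part hi, Fin.succAbove]
  congr 1
  split_ifs with h1 h2 h2
  · rfl
  · exact absurd h1 h2
  · exact absurd h2 h1
  · rfl

theorem partDet_mem {A : Type*} [CommRing A] [Algebra A R] (S : Subalgebra A R) {c : ℕ → ℕ → R}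
    (hc : ∀ p b, c p b ∈ S) (k : ℕ) (s β : Finset ℕ) : partDet c k s β ∈ S := by
  rw [partDet, Matrix.det_apply]
  refine sum_mem fun σ _ => ?_
  rw [Units.smul_def]
  exact zsmul_mem (prod_mem fun i _ => hc _ _) _

/-- A permutation avoiding the block would inject the columns up to `i` into the rows before `i`. -/
theorem det_eq_zero_of_zero_block {k : ℕ} (A : Matrix (Fin k) (Fin k) R) (i : Fin k)
    (h : ∀ r c, i ≤ r → c ≤ i → A r c = 0) : A.det = 0 := by
  rw [Matrix.det_apply]
  refine Finset.sum_eq_zero fun σ _ => ?_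
  suffices h1 : ∃ j, A (σ j) j = 0 by
    obtain ⟨j, hj⟩ := h1
    have h2 : ∏ j, A (σ j) j = 0 := Finset.prod_eq_zero (mem_univ j) hj
    exact (congrArg _ h2).trans (smul_zero _)
  by_contra! h1
  have h2 := Finset.card_le_card_of_injOn (s := Iic i) (t := Iio i) σ
    (fun j hj => by
      rw [coe_Iio, Set.mem_Iio]
      by_contra h3
      exact h1 j (h _ _ (not_lt.mp h3) (by simpa using hj))) σ.injective.injOn
  rw [Fin.card_Iic, Fin.card_Iio] at h2
  omega

theorem rank_anti {s : Finset ℕ} {a b : ℕ} (h : a ≤ b) : rank s b ≤ rank s a :=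
  card_le_card fun c hc => by
    simp only [mem_filter] at hc ⊢
    exact ⟨hc.1, by omega⟩

theorem lt_part_iff {s : Finset ℕ} {b i : ℕ} : b < part s i ↔ i < rank s b := by
  by_cases hi : i < #s
  · constructor
    · intro h
      have := rank_lt_rank (part_mem hi) h
      rwa [rank_part hi] at this
    · intro h
      by_contra h'
      have := rank_anti (s := s) (not_lt.mp h')
      rw [rank_part hi] at this
      omega
  · rw [part_of_card_le (by omega)]
    have : rank s b ≤ #s := card_filter_le _ _
    omega

theorem part_anti {s : Finset ℕ} {i j : ℕ} (h : i ≤ j) : part s j ≤ part s i := by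
  by_contra h'
  have h1 := lt_part_iff.mp (not_le.mp h')
  have h2 : ¬ i < rank s (part s i) := fun h3 => lt_irrefl _ (lt_part_iff.mpr h3)
  omega

/-- If the diagrams fail to be contained at `i`, then monotonicity of the parts gives a zero block
in the rows from `i` on and the columns up to `i`. -/
theorem partDet_eq_zero {c : ℕ → ℕ → R} (hc : ∀ p b, b < p → c p b = 0) {k : ℕ} {s β : Finset ℕ}
    (hs : #s ≤ k) (h : ¬ DiagramLE s β) : partDet c k s β = 0 := by
  simp only [DiagramLE, not_forall, not_le] at h
  obtain ⟨i, hi⟩ := h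
  have hik : i < k := by
    by_contra h1
    rw [part_of_card_le (s := s) (by omega)] at hi
    omega
  refine det_eq_zero_of_zero_block _ ⟨i, hik⟩ fun r j hr hj => hc _ _ ?_
  have h1 := part_anti (s := β) (Fin.le_def.mp hr)
  have h2 := part_anti (s := s) (Fin.le_def.mp hj)
  exact h1.trans_lt (hi.trans_le h2)

theorem partDet_ite {s β : Finset ℕ} (hβ : #β = #s) :
    partDet (fun p b => if b = p then (1 : R) else 0) #s s β = if β = s then 1 else 0 := by
  split_ifs with h
  · subst h
    refine (congrArg Matrix.det ?_).trans Matrix.det_one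
    ext i j
    have h1 : part β i = part β j ↔ i = j := ⟨fun h => by
      rw [Fin.ext_iff, ← rank_part i.2, h, rank_part j.2], fun h => by rw [h]⟩
    simp only [Matrix.of_apply, Matrix.one_apply, h1]
  · obtain ⟨b, hb, hb'⟩ : ∃ b ∈ β, b ∉ s := by
      by_contra! h1
      exact h (eq_of_subset_of_card_le h1 hβ.ge)
    have hr := rank_lt_card hb
    rw [partDet]
    refine Matrix.det_eq_zero_of_row_eq_zero ⟨rank β b, by omega⟩ fun j => ?_
    rw [Matrix.of_apply, if_neg]
    rw [part_rank hb]
    rintro rfl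
    exact hb' (part_mem j.2)

end PartDet

/-! ### Signs -/

section Signs

/-- An element `b` lies in the gap below the `i`-th part of `α` exactly when `i` parts exceed it, so
its contribution is its rank. -/
theorem intertwine_eq (α β : Finset ℕ) : intertwine α β = ∑ b ∈ β, rank α b := by
  simp only [intertwine, card_filter, Finset.mul_sum]
  rw [Finset.sum_comm]
  refine Finset.sum_congr rfl fun b _ => ?_
  have h1 : ∀ i, (b < part α i ∧ part α (i + 1) ≤ b) ↔ i + 1 = rank α b := fun i => by
    rw [← not_lt, lt_part_iff, lt_part_iff]
    omega
  simp only [h1, mul_ite, mul_one, mul_zero]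
  have h2 : rank α b ≤ #α := card_filter_le _ _
  rcases Nat.eq_zero_or_pos (rank α b) with h | h
  · rw [h]
    exact Finset.sum_eq_zero fun i _ => if_neg (by omega)
  · rw [Finset.sum_eq_single (rank α b - 1)]
    · rw [if_pos (by omega)]
      omega
    · intro i _ hi
      exact if_neg (by omega)
    · intro hi
      exact absurd (mem_range.mpr (by omega)) hi

/-- The exponent of the sign in the removal of the parts `β` from `γ`. -/
def removalExponent (γ β : Finset ℕ) : ℕ :=
  weight β + ∑ b ∈ β, rank (γ \ β) b + (#β).choose 2

/-- The summand `b + rank (γ \ β) b` is the sign from `lowerOp`, and `rank β b` that from the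
Laplace expansion. Removing `b` lowers the ranks of the smaller elements of `β`; the growth of the
binomial coefficient compensates for this. -/
theorem removalExponent_insert {γ β : Finset ℕ} {b : ℕ} (hb : b ∈ insert 0 γ) (hβ : b ∉ β) :
    removalExponent γ (insert b β) =
      removalExponent γ β + (b + rank (γ \ β) b) + rank β b := by
  have h1 : ∑ c ∈ β, rank (γ \ β) c =
      ∑ c ∈ β, rank ((γ \ β).erase b) c + #{c ∈ β | c < b} := by
    rw [card_filter, ← Finset.sum_add_distrib]
    refine Finset.sum_congr rfl fun c _ => ?_
    split_ifs with h
    · rcases mem_insert.mp hb with rfl | hb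
      · omega
      · exact (rank_erase_of_lt (mem_sdiff.mpr ⟨hb, hβ⟩) h).symm
    · exact (rank_erase_of_le (not_lt.mp h)).symm
  have h2 : #β = rank β b + #{c ∈ β | c < b} := by
    rw [rank, ← card_filter_add_card_filter_not (s := β) fun c => b < c]
    congr 2
    ext c
    simp only [mem_filter]
    refine and_congr_right fun hc => ?_
    have : c ≠ b := fun h => hβ (h ▸ hc)
    omega
  have h3 : rank ((γ \ β).erase b) b = rank (γ \ β) b := rank_erase_of_le le_rfl
  rw [removalExponent, removalExponent, weight, Finset.sum_insert hβ, Finset.sum_insert hβ,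
    card_insert_of_notMem hβ, sdiff_insert, Nat.choose_succ_succ' #β 1, Nat.choose_one_right, h3,
    weight]
  simp only [Nat.reduceAdd]
  omega

theorem choose_two_succ (a : ℕ) : (a + 1).choose 2 = a.choose 2 + a := by
  rw [Nat.choose_succ_succ' a 1, Nat.choose_one_right, add_comm]

theorem choose_two_add (a b : ℕ) : (a + b).choose 2 = a.choose 2 + b.choose 2 + a * b := by
  induction b with
  | zero => simp
  | succ b ih => rw [← add_assoc, choose_two_succ, choose_two_succ, ih, mul_add_one]; omega

theorem weight_Icc (m : ℕ) : weight (Icc 1 m) = (m + 1).choose 2 := by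
  induction m with
  | zero => rfl
  | succ m ih =>
    rw [choose_two_succ, ← ih, weight, weight, Finset.sum_Icc_succ_top (by omega)]

theorem choose_two_le_weight {s : Finset ℕ} (hs : 0 ∉ s) : (#s + 1).choose 2 ≤ weight s := by
  induction s using Finset.induction_on_max with
  | empty => simp
  | insert a s h ih =>
    have ha : a ∉ s := fun h' => lt_irrefl _ (h a h')
    have ih := ih fun h' => hs (mem_insert_of_mem h')
    have h1 : s ⊆ Ico 1 a := fun c hc => by
      have : c ≠ 0 := by
        rintro rfl
        exact hs (mem_insert_of_mem hc)
      exact mem_Ico.mpr ⟨by omega, h c hc⟩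
    have h2 := card_le_card h1
    have h3 : a ≠ 0 := by
      rintro rfl
      exact hs (mem_insert_self _ _)
    rw [Nat.card_Ico] at h2
    rw [card_insert_of_notMem ha, choose_two_succ, weight, Finset.sum_insert ha]
    rw [weight] at ih
    omega

/-- The weights of `λ` and `λ'` add up to `n.choose 2`. Splitting `n` as `ℓ + k` or `(ℓ + 1) + k`
leaves `k.choose 2` and a cross term, which is even because `k` is. -/
theorem neg_one_pow_signExponent {R : Type*} [CommRing R] {n : ℕ} (hn : 1 ≤ n) {lam : Finset ℕ}
    (hlam : lam ∈ strictPartitions (n - 1)) :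
    (-1 : R) ^ (signExponent n lam + weight (dual (n - 1) lam)) =
      (-1) ^ (evenColength n lam).choose 2 := by
  have h0 : 0 ∉ lam := fun h => by simpa using mem_powerset.mp hlam h
  have h1 := choose_two_le_weight h0
  have h2 : weight (dual (n - 1) lam) + weight lam = n.choose 2 := by
    have h3 := weight_Icc (n - 1)
    rw [Nat.sub_add_cancel hn] at h3
    rw [← h3, weight, weight, weight, dual]
    exact Finset.sum_sdiff (mem_powerset.mp hlam)
  have h3 : excess lam + (#lam + 1).choose 2 = weight lam := by
    have := weight_Icc #lam
    rw [weight] at this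
    rw [excess, this, Nat.sub_add_cancel h1]
  have h4 := even_evenColength hlam
  have h5 := card_dual hlam
  obtain ⟨t, ht⟩ := h4
  suffices h6 : ∃ u, signExponent n lam + weight (dual (n - 1) lam) =
      (evenColength n lam).choose 2 + 2 * u by
    obtain ⟨u, hu⟩ := h6
    rw [hu, pow_add, pow_mul, neg_one_sq, one_pow, mul_one]
  rw [signExponent]
  rw [evenColength] at ht ⊢
  split_ifs at ht ⊢ with h7
  -- Half of the cross term `ℓ k`, where `k = 2 t`.
  · refine ⟨#lam * t, ?_⟩
    have h8 := choose_two_add #lam (n - #lam)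
    rw [show #lam + (n - #lam) = n by omega] at h8
    rw [choose_two_succ] at h3
    have h9 : #lam * (n - #lam) = 2 * (#lam * t) := by rw [ht]; ring
    omega
  · refine ⟨(#lam + 1) * t, ?_⟩
    have h8 := choose_two_add (#lam + 1) (n - #lam - 1)
    rw [show #lam + 1 + (n - #lam - 1) = n by omega] at h8
    have h9 : (#lam + 1) * (n - #lam - 1) = 2 * ((#lam + 1) * t) := by rw [ht]; ring
    omega

end Signs

/-! ### The process on the polynomials `P̃` -/

section Expansion

variable {n : ℕ} {z : ℕ → PolyXY n}

/-- The elementary symmetric polynomial of degree `b - p` in `z_1, …, z_{n-1-p}`. -/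
def stairCoeff (z : ℕ → PolyXY n) (p b : ℕ) : PolyXY n :=
  if p ≤ b then ((range (n - 1 - p)).val.map z).esymm (b - p) else 0

theorem stairCoeff_mem (hz : ∀ l, z l ∈ constRing n) (p b : ℕ) :
    stairCoeff z p b ∈ constRing n := by
  rw [stairCoeff]
  split_ifs
  · rw [Multiset.esymm]
    refine multiset_sum_mem _ fun x hx => ?_
    obtain ⟨t, ht, rfl⟩ := Multiset.mem_map.mp hx
    refine multiset_prod_mem _ fun y hy => ?_
    have h1 := Multiset.mem_of_le (Multiset.mem_powersetCard.mp ht).1 hy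
    obtain ⟨l, -, rfl⟩ := Multiset.mem_map.mp h1
    exact hz l
  · exact zero_mem _

/-- The exponents are written `n - 1 - (p + j)` to match `lowerOp b` with `b = p + j`. -/
theorem bact_flipOne_rowProd (hz : ∀ l, z l ∈ constRing n) {p : ℕ} :
    bact (flipOne n) (rowProd z (n - 1 - p) 0) = (-1) ^ (n - 1 - p) *
      ∑ j ∈ range (n - 1 - p + 1),
        ((range (n - 1 - p)).val.map z).esymm j * xn 0 ^ (n - 1 - (p + j)) := by
  have h1 := congrArg (Polynomial.eval (xn 0))
    (Multiset.prod_X_add_C_eq_sum_esymm ((range (n - 1 - p)).val.map z))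
  rw [Multiset.map_map, Polynomial.eval_multiset_prod, Multiset.map_map,
    Polynomial.eval_finsetSum, Multiset.card_map, card_val, card_range] at h1
  simp only [Function.comp_apply, Polynomial.eval_add, Polynomial.eval_X, Polynomial.eval_C,
    Polynomial.eval_mul, Polynomial.eval_pow] at h1
  rw [rowProd, map_prod]
  have h2 : ∀ l ∈ range (n - 1 - p), bact (flipOne n) (xn 0 - z l) = (-1) * (xn 0 + z l) :=
    fun l _ => by
      rw [map_sub, bact_flipOne_xn, if_pos rfl, bact_of_mem_constRing (hz l)]
      ring
  rw [Finset.prod_congr rfl h2, Finset.prod_mul_distrib, Finset.prod_const, card_range]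
  congr 1
  refine (Eq.trans ?_ h1).trans ?_
  · rfl
  · exact Finset.sum_congr rfl fun j _ => by
      rw [show n - 1 - (p + j) = n - 1 - p - j by omega]

theorem bact_flipOne_shiftedStair (hz : ∀ l, z l ∈ constRing n) (e : ℕ) :
    bact (flipOne n) (shiftedStair z e 0) = shiftedStair z e 0 := by
  rw [shiftedStair, map_mul, range_zero, prod_empty, map_one, map_prod]
  congr 1
  refine Finset.prod_congr rfl fun j hj => ?_
  have := mem_Ico.mp hj
  simp only [rowProd, map_prod, map_sub, bact_flipOne_xn, bact_of_mem_constRing (hz _)]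
  rw [if_neg (by omega)]

theorem sw_bact_flipOne {j : ℕ} (hj : 1 ≤ j) {f : PolyXY n} (h : sw j f = f) :
    sw j (bact (flipOne n) f) = bact (flipOne n) f := by
  by_cases hj' : j + 1 < n
  · have h1 := flipOne_vec_root (SimpleRefl.adj j hj')
    rw [SimpleRefl.twist, if_neg (by omega)] at h1
    rw [sw_of_lt hj', act_eq_bact] at h ⊢
    rw [← bact_mul, SimpleRefl.mul_toBarred_of_vec_root h1, bact_mul, h]
  · rw [sw, dif_neg hj']
    rfl

/-- The step that removes the first row of a staircase product after a sign change. -/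
theorem chain_flip_stairProd_mul (hz : ∀ l, z l ∈ constRing n) {p : ℕ} (hp : p < n)
    {Q : PolyXY n} (hQ : IsSymmX Q) :
    chain 0 (n - 1) (bact (flipOne n) (stairProd z (n - 1 - p) * Q)) =
      (-1) ^ (n - 1 - p + (n - 1)) * (stairProd z (n - 1 - (p + 1)) *
        ∑ b ∈ range n, stairCoeff z p b * lowerOp b Q) := by
  have hn : 0 < n := by omega
  -- Only the first row and `Q` involve `x_1`.
  have h1 : bact (flipOne n) (stairProd z (n - 1 - p) * Q) = shiftedStair z (n - 1 - p) 0 *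
      bact (flipOne n) (rowProd z (n - 1 - p) 0 * Q) := by
    rw [stairProd_eq hn, map_mul, map_mul, map_mul, bact_flipOne_shiftedStair hz, mul_assoc]
  have h2 : ∀ j, 1 ≤ j → j < n - 1 → sw j (bact (flipOne n) (rowProd z (n - 1 - p) 0 * Q)) =
      bact (flipOne n) (rowProd z (n - 1 - p) 0 * Q) := fun j hj hj' => by
    refine sw_bact_flipOne hj ?_
    rw [map_mul, hQ j, sw_rowProd hz (by omega), Equiv.swap_apply_of_ne_of_ne (by omega) (by omega)]
  have h3 : ∑ b ∈ range n, stairCoeff z p b * lowerOp b Q = ∑ j ∈ range (n - 1 - p + 1),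
      ((range (n - 1 - p)).val.map z).esymm j * lowerOp (p + j) Q := by
    have h4 : range n = range (p + (n - 1 - p + 1)) := by
      congr 1
      omega
    rw [h4, Finset.sum_range_add, Finset.sum_eq_zero, zero_add]
    · refine Finset.sum_congr rfl fun j _ => ?_
      rw [stairCoeff, if_pos (by omega), Nat.add_sub_cancel_left]
    · intro b hb
      rw [stairCoeff, if_neg (by simpa using hb), zero_mul]
  have hmem : ∀ j, ((range (n - 1 - p)).val.map z).esymm j ∈ constRing n := fun j => by
    have := stairCoeff_mem hz p (p + j)
    rwa [stairCoeff, if_pos (by omega), Nat.add_sub_cancel_left] at this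
  rw [h1, chain_shiftedStair_mul hz (by omega) (by omega) h2, map_mul, bact_flipOne_rowProd hz,
    h3, Nat.sub_sub]
  have h5 : (-1) ^ (n - 1 - p) * (∑ j ∈ range (n - 1 - p + 1),
      ((range (n - 1 - p)).val.map z).esymm j * xn 0 ^ (n - 1 - (p + j))) * bact (flipOne n) Q =
      ∑ j ∈ range (n - 1 - p + 1), ((-1) ^ (n - 1 - p) *
        ((range (n - 1 - p)).val.map z).esymm j) *
          (xn 0 ^ (n - 1 - (p + j)) * bact (flipOne n) Q) := by
    rw [mul_assoc, Finset.sum_mul, Finset.mul_sum]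
    exact Finset.sum_congr rfl fun j _ => by ring
  rw [h5, chain_sum]
  have h6 : ∀ j ∈ range (n - 1 - p + 1), chain 0 (n - 1) (((-1) ^ (n - 1 - p) *
        ((range (n - 1 - p)).val.map z).esymm j) *
          (xn 0 ^ (n - 1 - (p + j)) * bact (flipOne n) Q)) = (-1) ^ (n - 1 - p + (n - 1)) *
          (((range (n - 1 - p)).val.map z).esymm j * lowerOp (p + j) Q) := fun j _ => by
    rw [chain_mul_of_sw_eq _ _ fun i _ _ => sw_of_mem_constRing
      (mul_mem (pow_mem (neg_mem (one_mem _)) _) (hmem j)) i, lowerOp, pow_add]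
    linear_combination -((-1) ^ (n - 1 - p) * ((range (n - 1 - p)).val.map z).esymm j *
      chain 0 (n - 1) (xn 0 ^ (n - 1 - (p + j)) * bact (flipOne n) Q)) *
        neg_one_pow_mul_self (R := PolyXY n) (n - 1)
  rw [Finset.sum_congr rfl h6, ← Finset.mul_sum]
  ring

theorem sum_stairCoeff_lowerOp {p : ℕ} {s : Finset ℕ} (hs : s ∈ strictPartitions (n - 1))
    (hn : 0 < n) : ∑ b ∈ range n, stairCoeff z p b * lowerOp b (Ptilde xvar s) =
      ∑ b ∈ insert 0 s, stairCoeff z p b * ((-1) ^ (b + rank s b) * Ptilde xvar (s.erase b)) := by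
  have hs0 : 0 ∉ s := fun h => by simpa using mem_powerset.mp hs h
  have h1 : ∀ b ∈ range n, stairCoeff z p b * lowerOp b (Ptilde xvar s) =
      if b ∈ insert 0 s then
        stairCoeff z p b * ((-1) ^ (b + rank s b) * Ptilde xvar (s.erase b)) else 0 :=
    fun b hb => by
      have := mem_range.mp hb
      rw [lowerOp_Ptilde hn (by omega) hs0]
      split_ifs
      · rfl
      · rw [mul_zero]
  rw [Finset.sum_congr rfl h1, Finset.sum_ite_mem, inter_eq_right.mpr]
  intro b hb
  rcases mem_insert.mp hb with rfl | hb
  · exact mem_range.mpr hn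
  · have := mem_Icc.mp (mem_powerset.mp hs hb)
    exact mem_range.mpr (by omega)

/-- A set with a marked element amounts to a smaller set with an element chosen outside it. -/
theorem sum_powersetCard_succ {M : Type*} [AddCommMonoid M] (U : Finset ℕ) (q : ℕ)
    (F : Finset ℕ → ℕ → M) : ∑ β ∈ powersetCard (q + 1) U, ∑ b ∈ β, F (β.erase b) b =
      ∑ β ∈ powersetCard q U, ∑ b ∈ U \ β, F β b := by
  rw [Finset.sum_sigma', Finset.sum_sigma']
  refine Finset.sum_nbij' (fun x => ⟨x.1.erase x.2, x.2⟩) (fun x => ⟨insert x.2 x.1, x.2⟩)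
    ?_ ?_ ?_ ?_ ?_
  · rintro ⟨β, b⟩ h
    simp only [mem_sigma, mem_powersetCard, mem_sdiff] at h ⊢
    refine ⟨⟨(erase_subset _ _).trans h.1.1, ?_⟩, h.1.1 h.2, notMem_erase _ _⟩
    rw [card_erase_of_mem h.2]
    omega
  · rintro ⟨β, b⟩ h
    simp only [mem_sigma, mem_powersetCard, mem_sdiff] at h ⊢
    refine ⟨⟨insert_subset h.2.1 h.1.1, ?_⟩, mem_insert_self _ _⟩
    rw [card_insert_of_notMem h.2.2, h.1.2]
  · rintro ⟨β, b⟩ h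
    simp only [mem_sigma] at h
    simp only [insert_erase h.2]
  · rintro ⟨β, b⟩ h
    simp only [mem_sigma, mem_sdiff] at h
    simp only [erase_insert h.2.2]
  · intro x _
    rfl

theorem isSymmX_sum {ι : Type*} (S : Finset ι) {f : ι → PolyXY n} (h : ∀ i ∈ S, IsSymmX (f i)) :
    IsSymmX (∑ i ∈ S, f i) := fun j => by
  rw [map_sum]
  exact Finset.sum_congr rfl fun i hi => h i hi j

theorem IsSymmX.const_mul {c f : PolyXY n} (hc : c ∈ constRing n) (hf : IsSymmX f) :
    IsSymmX (c * f) := fun j => by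
  rw [map_mul, hf j, sw_of_mem_constRing hc]

/-- The coefficients of the expansion of the process on `P̃_γ(X)`. -/
def processCoeff (z : ℕ → PolyXY n) (s γ β : Finset ℕ) : PolyXY n :=
  partDet (stairCoeff z) #s s β * (-1) ^ removalExponent γ β

theorem processCoeff_mem (hz : ∀ l, z l ∈ constRing n) (s γ β : Finset ℕ) :
    processCoeff z s γ β ∈ constRing n :=
  mul_mem (partDet_mem _ (stairCoeff_mem hz) _ _ _) (pow_mem (neg_mem (one_mem _)) _)

/-- The sum over the part removed last is the Laplace expansion along the new column `p`, with signs
controlled by `removalExponent_insert`. -/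
theorem sum_stairCoeff_lowerOp_sum (hz : ∀ l, z l ∈ constRing n) (hn : 0 < n) {p : ℕ}
    {s γ : Finset ℕ} (hs : ∀ i ∈ s, i < p) (hγ : γ ∈ strictPartitions (n - 1)) :
    ∑ b ∈ range n, stairCoeff z p b * lowerOp b
        (∑ β ∈ powersetCard #s (insert 0 γ), processCoeff z s γ β * Ptilde xvar (γ \ β)) =
      ∑ β ∈ powersetCard (#s + 1) (insert 0 γ),
        processCoeff z (insert p s) γ β * Ptilde xvar (γ \ β) := by
  have hps : p ∉ s := fun h => lt_irrefl _ (hs p h)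
  simp only [lowerOp_sum, lowerOp_const_mul _ (processCoeff_mem hz _ _ _), Finset.mul_sum]
  rw [Finset.sum_comm]
  have h1 : ∀ β ∈ powersetCard #s (insert 0 γ), ∑ b ∈ range n,
      stairCoeff z p b * (processCoeff z s γ β * lowerOp b (Ptilde xvar (γ \ β))) =
      ∑ b ∈ insert 0 γ \ β, partDet (stairCoeff z) #s s β * stairCoeff z p b *
        (-1) ^ (removalExponent γ β + (b + rank (γ \ β) b)) * Ptilde xvar (γ \ insert b β) := by
    intro β hβ
    have h2 : γ \ β ∈ strictPartitions (n - 1) :=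
      mem_powerset.mpr (sdiff_subset.trans (mem_powerset.mp hγ))
    have h3 : ∑ b ∈ range n, stairCoeff z p b *
        (processCoeff z s γ β * lowerOp b (Ptilde xvar (γ \ β))) =
        processCoeff z s γ β * ∑ b ∈ range n, stairCoeff z p b * lowerOp b (Ptilde xvar (γ \ β)) := by
      rw [Finset.mul_sum]
      exact Finset.sum_congr rfl fun b _ => by ring
    rw [h3, sum_stairCoeff_lowerOp h2 hn, ← Finset.sum_subset (s₁ := insert 0 γ \ β), Finset.mul_sum]
    · refine Finset.sum_congr rfl fun b _ => ?_
      rw [processCoeff, pow_add _ (removalExponent γ β), sdiff_insert]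
      ring
    · intro b hb
      simp only [mem_sdiff, mem_insert] at hb ⊢
      tauto
    -- Here `0` would be removed a second time. Then an earlier sign change took place, so `p > 0`
    -- and the coefficient of `b = 0` vanishes.
    · intro b hb hb'
      have hb0 : b = 0 ∧ b ∈ β := by
        simp only [mem_sdiff, mem_insert] at hb hb'
        tauto
      have h4 : 0 < #s := by
        rw [← (mem_powersetCard.mp hβ).2]
        exact card_pos.mpr ⟨b, hb0.2⟩
      obtain ⟨i, hi⟩ := card_pos.mp h4
      have := hs i hi
      rw [stairCoeff, if_neg (by omega), zero_mul]
  rw [Finset.sum_congr rfl h1, ← sum_powersetCard_succ (insert 0 γ) #s fun β b =>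
    partDet (stairCoeff z) #s s β * stairCoeff z p b *
      (-1) ^ (removalExponent γ β + (b + rank (γ \ β) b)) * Ptilde xvar (γ \ insert b β)]
  refine Finset.sum_congr rfl fun β hβ => ?_
  obtain ⟨h2, h3⟩ := mem_powersetCard.mp hβ
  rw [processCoeff, card_insert_of_notMem hps, partDet_insert _ hs h3, Finset.sum_mul,
    Finset.sum_mul]
  refine Finset.sum_congr rfl fun b hb => ?_
  have h4 := removalExponent_insert (h2 hb) (notMem_erase b β)
  rw [insert_erase hb, rank_erase_of_le le_rfl] at h4
  rw [insert_erase hb, h4, pow_add _ _ (rank β b)]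
  linear_combination -(partDet (stairCoeff z) #s s (β.erase b) * stairCoeff z p b *
    (-1) ^ (removalExponent γ (β.erase b) + (b + rank (γ \ β.erase b) b)) * Ptilde xvar (γ \ β)) *
      neg_one_pow_mul_self (R := PolyXY n) (rank β b)

/-- Each step strips a row, and each sign change removes one more element of `γ ∪ {0}`. The sequence
`z` is kept general: `z = y` gives the theorem, and `z = 0` the test that the word is reduced. -/
theorem process_stairProd_mul (hz : ∀ l, z l ∈ constRing n) (M : Finset ℕ) {γ : Finset ℕ}
    (hγ : γ ∈ strictPartitions (n - 1)) {P : ℕ} (hP : P ≤ n) :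
    process M P (stairProd z (n - 1) * Ptilde xvar γ) =
      (-1) ^ (∑ p ∈ range P, (n - 1 - p) + (n - 1) * #{i ∈ M | i < P}) *
        (stairProd z (n - 1 - P) * ∑ β ∈ powersetCard #{i ∈ M | i < P} (insert 0 γ),
          processCoeff z {i ∈ M | i < P} γ β * Ptilde xvar (γ \ β)) := by
  induction P with
  | zero =>
    rw [filter_false_of_mem fun i _ => Nat.not_lt_zero i]
    have h1 : partDet (stairCoeff z) 0 ∅ ∅ = 1 := Matrix.det_fin_zero
    simp [process, processCoeff, h1, removalExponent, weight]
  | succ P ih =>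
    have ih := ih (by omega)
    have hsymm : IsSymmX (∑ β ∈ powersetCard #{i ∈ M | i < P} (insert 0 γ),
        processCoeff z {i ∈ M | i < P} γ β * Ptilde xvar (γ \ β)) :=
      isSymmX_sum _ fun β _ => (isSymmX_Ptilde _).const_mul (processCoeff_mem hz _ _ _)
    have hsign : ∀ m, (-1 : PolyXY n) ^ m ∈ constRing n := fun m =>
      pow_mem (neg_mem (one_mem _)) m
    rw [process, ih, filter_lt_succ, Finset.sum_range_succ]
    by_cases h : P ∈ M
    · rw [if_pos h, if_pos h, map_mul, bact_of_mem_constRing (hsign _),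
        chain_mul_of_sw_eq _ _ (fun j _ _ => sw_of_mem_constRing (hsign _) j),
        chain_flip_stairProd_mul hz (by omega) hsymm,
        sum_stairCoeff_lowerOp_sum hz (by omega) (fun i hi => (mem_filter.mp hi).2) hγ,
        card_insert_of_notMem (by simp)]
      ring
    · rw [if_neg h, if_neg h,
        chain_mul_of_sw_eq _ _ (fun j _ _ => sw_of_mem_constRing (hsign _) j),
        chain_stairProd_mul hz (by omega) hsymm,
        show n - 1 - (P + 1) = n - 1 - P - 1 by omega]
      ring

end Expansion

end TypeD

end

noncomputable section

namespace TypeD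

open Finset

/-! ### The formula for maximal Grassmannian elements -/

section Formula

variable {n : ℕ}

/-- The variable `y_{l+1}`, or `0` if `l ≥ n`. -/
def yn (l : ℕ) : PolyXY n := if h : l < n then yvar ⟨l, h⟩ else 0

theorem yn_mem (l : ℕ) : (yn l : PolyXY n) ∈ constRing n := by
  rw [yn]
  split_ifs
  · exact yvar_mem_constRing _
  · exact zero_mem _

theorem Delta_eq : Delta n = stairProd yn (n - 1) := by
  rw [Delta, Finset.prod_filter, Fintype.prod_prod_type, stairProd, Finset.prod_range]
  refine Finset.prod_congr rfl fun i _ => ?_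
  have h1 := i.2
  have h2 : range (n - 1 - i) = {l ∈ range n | (i : ℕ) + 1 + (l + 1) ≤ n} := by
    ext l
    simp only [mem_filter, mem_range]
    omega
  rw [rowProd, h2, Finset.prod_filter, Finset.prod_range]
  refine Finset.prod_congr rfl fun j _ => ?_
  simp only [xn_of_lt h1, yn, j.2, dif_pos, Fin.eta]

theorem elemY_eq_stairCoeff {p b : ℕ} :
    elemY n (n - 1 - p) ((b : ℤ) - (p : ℤ)) = stairCoeff yn p b := by
  rw [elemY, stairCoeff]
  by_cases h : p ≤ b
  · rw [if_pos (by omega), if_pos h]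
    have h1 : ({i : Fin n | (i : ℕ) < n - 1 - p} : Finset (Fin n)).map Fin.valEmbedding =
        range (n - 1 - p) := by
      ext l
      simp only [mem_map, mem_filter, mem_univ, true_and, Fin.valEmbedding_apply, mem_range]
      constructor
      · rintro ⟨i, hi, rfl⟩
        exact hi
      · intro hl
        exact ⟨⟨l, by omega⟩, hl, rfl⟩
    rw [← h1, Finset.map_val, Multiset.map_map]
    congr 1
    · refine Multiset.map_congr rfl fun i _ => ?_
      simp only [Function.comp_apply, Fin.valEmbedding_apply, yn, i.2, dif_pos, Fin.eta]
    · omega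
  · rw [if_neg (by omega), if_neg h]

theorem esymm_map_zero {R : Type*} [CommRing R] (s : Multiset ℕ) (k : ℕ) :
    (s.map fun _ => (0 : R)).esymm k = if k = 0 then 1 else 0 := by
  rcases k with _ | k
  · rw [esymm_zero_right, if_pos rfl]
  · rw [if_neg (Nat.succ_ne_zero k)]
    induction s using Multiset.induction_on with
    | empty => exact esymm_eq_zero (by simp)
    | cons a s ih => rw [Multiset.map_cons, esymm_cons_succ, ih, zero_mul, add_zero]

theorem stairCoeff_zero : stairCoeff (fun _ => (0 : PolyXY n)) = fun p b => if b = p then 1 else 0 := by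
  funext p b
  rw [stairCoeff, esymm_map_zero]
  split_ifs <;> first | rfl | omega

theorem Ptilde_empty (v : Fin n → PolyXY n) : Ptilde v ∅ = 1 := by
  simp [Ptilde, Qtilde, pfaffian]

theorem process_flipSet {z : ℕ → PolyXY n} (hz : ∀ l, z l ∈ constRing n) (hn : 1 ≤ n)
    {lam : Finset ℕ} (hlam : lam ∈ strictPartitions (n - 1)) {γ : Finset ℕ}
    (hγ : γ ∈ strictPartitions (n - 1)) :
    process (flipSet n lam) n (stairProd z (n - 1) * Ptilde xvar γ) =
      (-1) ^ n.choose 2 * ∑ β ∈ powersetCard (evenColength n lam) (insert 0 γ),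
        processCoeff z (flipSet n lam) γ β * Ptilde xvar (γ \ β) := by
  have h1 : {i ∈ flipSet n lam | i < n} = flipSet n lam :=
    filter_true_of_mem fun i hi => flipSet_lt hn hi
  have h2 : ∑ p ∈ range n, (n - 1 - p) = n.choose 2 := by
    rw [Finset.sum_range_reflect (fun i => i), Finset.sum_range_id, Nat.choose_two_right]
  rw [process_stairProd_mul hz _ hγ le_rfl, h1, h2, card_flipSet hn hlam, pow_add,
    ((even_evenColength hlam).mul_left _).neg_one_pow, mul_one,
    show n - 1 - n = 0 by omega, stairProd_zero, one_mul]

/-- For `z = 0` the determinant is a Kronecker delta. Only `β = flipSet n lam` remains; it removes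
all parts and leaves a sign. -/
theorem process_flipSet_ne_zero (hn : 1 ≤ n) {lam : Finset ℕ}
    (hlam : lam ∈ strictPartitions (n - 1)) :
    process (flipSet n lam) n (stairProd (fun _ => (0 : PolyXY n)) (n - 1) *
      Ptilde xvar (dual (n - 1) lam)) ≠ 0 := by
  have h1 : dual (n - 1) lam ⊆ flipSet n lam := by
    rw [flipSet]
    split_ifs
    · exact subset_insert _ _
    · exact Subset.rfl
  have h2 : flipSet n lam ⊆ insert 0 (dual (n - 1) lam) := by
    rw [flipSet]
    split_ifs
    · exact Subset.rfl
    · exact subset_insert _ _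
  have hcard := card_flipSet hn hlam
  have hdual : dual (n - 1) lam ∈ strictPartitions (n - 1) := mem_powerset.mpr sdiff_subset
  rw [process_flipSet (fun _ => zero_mem _) hn hlam hdual,
    Finset.sum_eq_single (flipSet n lam)]
  · rw [processCoeff, stairCoeff_zero, partDet_ite rfl, if_pos rfl, sdiff_eq_empty_iff_subset.mpr h1,
      Ptilde_empty, one_mul, mul_one]
    exact mul_ne_zero (pow_ne_zero _ (by simp)) (pow_ne_zero _ (by simp))
  · intro β hβ h
    rw [processCoeff, stairCoeff_zero,
      partDet_ite ((mem_powersetCard.mp hβ).2.trans hcard.symm), if_neg h]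
    ring
  · intro h
    exact absurd (mem_powersetCard.mpr ⟨h2, hcard⟩) h

theorem Ptilde_yvar_mem (s : Finset ℕ) : Ptilde (yvar (n := n)) s ∈ constRing n := by
  let φ : MvPolynomial (Fin n) ZHalf →+* PolyXY n :=
    (MvPolynomial.rename (R := ZHalf) (Sum.inr : Fin n → Fin n ⊕ Fin n)).toRingHom
  have h2 : Qtilde (yvar (n := n)) s ∈ constRing n := by
    refine ⟨Qtilde MvPolynomial.X s, ?_⟩
    refine (map_Qtilde φ _ _).trans ?_
    congr 1
    funext j
    exact MvPolynomial.rename_X _ _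
  exact mul_mem ((constRing n).algebraMap_mem _) h2

/-- The process is linear over polynomials in `Y`, so the `P̃_γ(X)` are treated one by one. The
staircase sign `(-1) ^ n.choose 2` cancels the sign in the definition. -/
theorem doubleSchubert_maxGrass (hn : 1 ≤ n) {lam : Finset ℕ}
    (hlam : lam ∈ strictPartitions (n - 1)) :
    doubleSchubert (maxGrass hn hlam) = ∑ γ ∈ strictPartitions (n - 1),
      ∑ β ∈ powersetCard (evenColength n lam) (insert 0 γ),
        Ptilde yvar (dual (n - 1) γ) *
          (processCoeff yn (flipSet n lam) γ β * Ptilde xvar (γ \ β)) := by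
  have h1 : Delta n * PtildeKernel n (n - 1) = ∑ γ ∈ strictPartitions (n - 1),
      Ptilde yvar (dual (n - 1) γ) * (stairProd yn (n - 1) * Ptilde xvar γ) := by
    rw [PtildeKernel, Delta_eq, Finset.mul_sum]
    exact Finset.sum_congr rfl fun γ _ => by ring
  rw [doubleSchubert, divDiffWeyl_maxGrass hn hlam (process_flipSet_ne_zero hn hlam), h1,
    process_sum, Finset.mul_sum]
  refine Finset.sum_congr rfl fun γ hγ => ?_
  rw [process_const_mul _ _ (Ptilde_yvar_mem _), process_flipSet yn_mem hn hlam hγ,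
    ← Nat.choose_two_right, ← Finset.mul_sum]
  linear_combination (Ptilde yvar (dual (n - 1) γ) *
    ∑ β ∈ powersetCard (evenColength n lam) (insert 0 γ),
      processCoeff yn (flipSet n lam) γ β * Ptilde xvar (γ \ β)) *
        neg_one_pow_mul_self (R := PolyXY n) (n.choose 2)

/-- A term `0` and the default value beyond the last term look alike, so the columns of the
determinant can be read off from `λ'`. -/
theorem part_flipSet (lam : Finset ℕ) (i : ℕ) :
    part (flipSet n lam) i = part (dual (n - 1) lam) i :=
  eq_of_forall_lt_iff fun b => by rw [lt_part_iff, lt_part_iff, rank_flipSet]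

/-- The substitution is `α = γ \ β`. Its inverse drops a possible `0` from `β`, since `γ` has
positive parts only. -/
theorem sum_powersetCard_insert_zero {M : Type*} [AddCommMonoid M] (m k : ℕ)
    (F : Finset ℕ → Finset ℕ → M) :
    ∑ γ ∈ strictPartitions m, ∑ β ∈ powersetCard k (insert 0 γ), F (γ \ β) β =
      ∑ α ∈ strictPartitions m, ∑ β ∈ strictPartitionsPlus m with #β = k ∧ Disjoint α β, F α β := by
  have hzero : ∀ {s}, s ∈ strictPartitions m → 0 ∉ s := fun hs h => by
    simpa using mem_powerset.mp hs h
  rw [Finset.sum_sigma', Finset.sum_sigma']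
  refine Finset.sum_nbij' (fun x => ⟨x.1 \ x.2, x.2⟩) (fun x => ⟨x.1 ∪ x.2.erase 0, x.2⟩)
    ?_ ?_ ?_ ?_ ?_
  · rintro ⟨γ, β⟩ h
    simp only [mem_sigma, mem_powersetCard, mem_filter] at h ⊢
    obtain ⟨h1, h2, h3⟩ := h
    refine ⟨mem_powerset.mpr (sdiff_subset.trans (mem_powerset.mp h1)), ?_, h3,
      sdiff_disjoint⟩
    refine mem_powerset.mpr fun b hb => mem_range.mpr ?_
    rcases mem_insert.mp (h2 hb) with rfl | hb
    · omega
    · have := mem_Icc.mp (mem_powerset.mp h1 hb)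
      omega
  · rintro ⟨α, β⟩ h
    simp only [mem_sigma, mem_powersetCard, mem_filter] at h ⊢
    obtain ⟨h1, h2, h3, h4⟩ := h
    refine ⟨mem_powerset.mpr (union_subset (mem_powerset.mp h1) fun b hb => ?_), fun b hb => ?_, h3⟩
    · have h5 := mem_range.mp (mem_powerset.mp h2 (mem_of_mem_erase hb))
      have h6 := ne_of_mem_erase hb
      exact mem_Icc.mpr ⟨by omega, by omega⟩
    · rcases eq_or_ne b 0 with rfl | h5
      · exact mem_insert_self _ _
      · exact mem_insert_of_mem (mem_union_right _ (mem_erase.mpr ⟨h5, hb⟩))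
  · rintro ⟨γ, β⟩ h
    simp only [mem_sigma, mem_powersetCard] at h
    obtain ⟨h1, h2, -⟩ := h
    have h3 : γ \ β ∪ β.erase 0 = γ := by
      ext c
      have h4 : c ∈ β → c = 0 ∨ c ∈ γ := fun hc => mem_insert.mp (h2 hc)
      have h5 : c ∈ γ → c ≠ 0 := fun hc h => hzero h1 (h ▸ hc)
      simp only [mem_union, mem_sdiff, mem_erase]
      tauto
    simp only [h3]
  · rintro ⟨α, β⟩ h
    simp only [mem_sigma, mem_filter] at h
    obtain ⟨h1, -, -, h4⟩ := h
    have h3 : (α ∪ β.erase 0) \ β = α := by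
      ext c
      have h5 : c ∈ α → c ∉ β := fun hc => disjoint_left.mp h4 hc
      simp only [mem_union, mem_sdiff, mem_erase]
      tauto
    simp only [h3]
  · intro x _
    rfl

theorem dual_eq_of_subset {m : ℕ} {γ β : Finset ℕ} (h : β ⊆ insert 0 γ) :
    dual m γ = dual m (γ \ β ∪ β) := by
  ext c
  have h1 : c ∈ β → c = 0 ∨ c ∈ γ := fun hc => mem_insert.mp (h hc)
  simp only [dual, mem_sdiff, mem_Icc, mem_union]
  constructor
  · rintro ⟨h2, h3⟩
    refine ⟨h2, fun h4 => ?_⟩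
    rcases h4 with h4 | h4
    · exact h3 h4.1
    · rcases h1 h4 with h5 | h5
      · omega
      · exact h3 h5
  · rintro ⟨h2, h3⟩
    exact ⟨h2, fun h4 => h3 (by tauto)⟩

end Formula

end TypeD

end

open TypeD in
theorem theorem3p5 (n : ℕ) (hn : 1 ≤ n) (lam : Finset ℕ)
    (hlam : lam ∈ strictPartitions (n - 1)) :
    doubleSchubert (maxGrass hn hlam) =
      (-1) ^ (signExponent n lam + weight (dual (n - 1) lam)) *
        ∑ α ∈ strictPartitions (n - 1), Ptilde (xvar (n := n)) α *
          ∑ β ∈ strictPartitionsPlus (n - 1) with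
              DiagramLE (dual (n - 1) lam) β ∧ β.card = evenColength n lam ∧ Disjoint α β,
            (-1) ^ (intertwine α β + weight β) *
              Ptilde (yvar (n := n)) (dual (n - 1) (α ∪ β)) *
              Matrix.det (Matrix.of fun i j : Fin (evenColength n lam) =>
                elemY n (n - 1 - part (dual (n - 1) lam) j)
                  ((part β i : ℤ) - (part (dual (n - 1) lam) j : ℤ))) := by
  have hdet : ∀ β : Finset ℕ, Matrix.det (Matrix.of fun i j : Fin (evenColength n lam) =>
      elemY n (n - 1 - part (dual (n - 1) lam) j)
        ((part β i : ℤ) - (part (dual (n - 1) lam) j : ℤ))) =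
      partDet (stairCoeff yn) (evenColength n lam) (flipSet n lam) β := fun β => by
    simp only [elemY_eq_stairCoeff, partDet, part_flipSet]
  have hzero : ∀ β, ¬ DiagramLE (dual (n - 1) lam) β →
      partDet (stairCoeff yn) (evenColength n lam) (flipSet n lam) β = (0 : PolyXY n) :=
    fun β h => partDet_eq_zero (fun p b hb => by rw [stairCoeff, if_neg (by omega)])
      (card_flipSet hn hlam).le fun h' => h fun i => by
        rw [← part_flipSet]
        exact h' i
  rw [doubleSchubert_maxGrass hn hlam, neg_one_pow_signExponent hn hlam, Finset.mul_sum]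
  refine (Finset.sum_congr rfl fun γ _ => Finset.sum_congr rfl fun β hβ => ?_).trans
    ((sum_powersetCard_insert_zero (n - 1) (evenColength n lam) fun α β =>
      (-1) ^ (evenColength n lam).choose 2 * (Ptilde (xvar (n := n)) α *
        ((-1) ^ (intertwine α β + weight β) * Ptilde yvar (dual (n - 1) (α ∪ β)) *
          partDet (stairCoeff yn) (evenColength n lam) (flipSet n lam) β))).trans
            (Finset.sum_congr rfl fun α _ => ?_))
  -- For `α = γ \ β` the removal exponent is `intertwine α β + weight β` plus `k.choose 2`, the
  -- latter being the global sign.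
  · obtain ⟨h1, h2⟩ := Finset.mem_powersetCard.mp hβ
    rw [processCoeff, card_flipSet hn hlam, removalExponent, intertwine_eq, h2,
      dual_eq_of_subset h1]
    ring
  · rw [← Finset.mul_sum, ← Finset.mul_sum]
    refine congrArg (HMul.hMul _) (congrArg (HMul.hMul _) ?_)
    simp only [hdet]
    -- The terms without `β ⊃ λ'` have determinant zero.
    refine (Finset.sum_subset (fun β hβ => ?_) fun β hβ hβ' => ?_).symm
    · simp only [Finset.mem_filter] at hβ ⊢
      exact ⟨hβ.1, hβ.2.2⟩
    · simp only [Finset.mem_filter] at hβ hβ'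
      rw [hzero β fun h => hβ' ⟨hβ.1, h, hβ.2⟩, mul_zero]
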